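/- Let $k\in\mathbb C$, let $Q:\,]0,\infty[\to\mathbb C$ be locally integrable, and for $m\in\mathbb C$ consider the equation $$\Big(-\partial_x^2+\big(m^2-\tfrac14\big)\tfrac1{x^2}+Q(x)\Big)g=-k^2g \qquad (*)$$ for $g\in AC^1]0,\infty[$, that is, $g$ differentiable with locally absolutely continuous derivative, the equation holding almost everywhere. For $\varepsilon\ge0$ and $\beta\ge 0$ write $Q\in\mathscr L^{(0)}_{\varepsilon}$ if $\int_0^1x^{1-\varepsilon}|Q(x)|\,dx<\infty$ and $Q\in\mathscr L^{(0)}_{\varepsilon,\ln^\beta}$ if $\int_0^1x^{1-\varepsilon}(1+|\ln x|^\beta)|Q(x)|\,dx<\infty$ (with $\ln=\ln^1$). Let $$u_m^0(x,k)=\big(\tfrac2k\big)^m\sqrt x\,I_m(kx)=x^{\frac12+m}\sum_{n\ge0}\frac{(k^2x^2/4)^n}{n!\,\Gamma(m+n+1)},\qquad u_m^0(x,0)=\frac{x^{\frac12+m}}{\Gamma(m+1)},$$ $$p_0^0(x,k)=-\sqrt x\,K_0(kx)-\big(\ln\tfrac k2+\gamma\big)u_0^0(x,k)\ (k\ne0),\qquad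 p_0^0(x,0)=\sqrt x\,\ln x,$$ where $I_m$, $K_0$ are the modified Bessel and Macdonald functions and $\gamma$ is Euler's constant. The forward Green's operator $G^0_\to$ is the integral operator on $]0,\infty[$ with kernel $$G^0_\to(x,y)=\theta(x-y)\,\frac{h_1(x)h_2(y)-h_2(x)h_1(y)}{h_1h_2'-h_1'h_2},$$ where $h_1,h_2$ is any pair of linearly independent solutions of $(*)$ with $Q=0$. For $a>0$ and $\phi>0$ let $L^\infty(]0,a[,\phi)$ be the space of (classes of) measurable $f$ with $\|f/\phi\|_{L^\infty(]0,a[)}<\infty$. (i) Let $m\in\mathbb C$ and $\varepsilon\ge2\max(-\operatorname{Re}m,0)$, and suppose $Q\in\mathscr L^{(0)}_\varepsilon$ if $m\ne0$, and $Q\in\mathscr L^{(0)}_{\varepsilon,\ln}$ if $m=0$. Then $\mathbb 1+G^0_\to Q$ is boundedly invertible on $L^\infty(]0,a[,x^{\frac12+\operatorname{Re}m})$ for every $a>0$, and $$u_m(\cdot,k):=(\mathbb 1+G^0_\to Q)^{-1}u_m^0(\cdot,k)$$ (the function on $]0,\infty[$ whose restriction to each $]0,a[$ is the preimage of $u^0_m(\cdot,k)|_{]0,a[}$)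 is the unique solution in $AC^1]0,\infty[$ of $(*)$ such that, as $x\to0$, $$u_m(x,k)-u_m^0(x,k)=o\big(x^{\frac12+\operatorname{Re}m+\varepsilon}\big),\qquad \partial_xu_m(x,k)-\partial_xu_m^0(x,k)=o\big(x^{-\frac12+\operatorname{Re}m+\varepsilon}\big).$$ It is also the unique solution in $AC^1]0,\infty[$ of $(*)$ such that, as $x\to0$, $$u_m(x,k)-u_m^0(x,k)=o\big(x^{\frac12+|\operatorname{Re}m|}\big),\qquad \partial_xu_m(x,k)-\partial_xu_m^0(x,k)=o\big(x^{-\frac12+|\operatorname{Re}m|}\big).$$ (ii) Let $m=0$, $\varepsilon\ge0$ and $Q\in\mathscr L^{(0)}_{\varepsilon,\ln^2}$. Then $\mathbb 1+G^0_\to Q$ is boundedly invertible on $L^\infty(]0,a[,x^{\frac12}(1+|\ln x|))$ for every $a>0$, and, in the same sense as in (i), $$p_0(\cdot,k):=(\mathbb 1+G^0_\to Q)^{-1}p_0^0(\cdot,k)$$ is the unique solution in $AC^1]0,\infty[$ of $(*)$ such that, as $x\to0$, $$p_0(x,k)-p_0^0(x,k)=o\big(x^{\frac12+\varepsilon}\big),\qquad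 \partial_xp_0(x,k)-\partial_xp_0^0(x,k)=o\big(x^{-\frac12+\varepsilon}\big).$$ It is also the unique solution in $AC^1]0,\infty[$ of $(*)$ for which these two relations hold with $\varepsilon$ replaced by $0$. -/

import Mathlib

open Filter Topology MeasureTheory Set Asymptotics

noncomputable section

namespace PerturbedBessel

/-! Functions on the open half-line `]0,∞[` are represented by functions `ℝ → ℂ`, of which only the
restriction to `Ioi 0` matters. -/

/-! ### Unperturbed eigenfunctions -/

/-- The modified Bessel function `I_m(z)`, principal branch. At the poles of `Γ` the value
`Complex.Gamma` is `0`, so the corresponding coefficients `1/Γ` vanish, as they should. -/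
def besselI (m z : ℂ) : ℂ :=
  (z / 2) ^ m * ∑' n : ℕ, (z ^ 2 / 4) ^ n / ((n.factorial : ℂ) * Complex.Gamma (m + n + 1))

/-- The Macdonald function `K_m(z)`: `(π/2) (I_{-m}(z) - I_m(z)) / sin (π m)`, with its limiting
value at integer `m`. -/
def besselK (m z : ℂ) : ℂ :=
  limUnder (𝓝[≠] m) fun μ : ℂ =>
    (Real.pi : ℂ) / 2 * (besselI (-μ) z - besselI μ z) / Complex.sin (Real.pi * μ)

/-- `u_m^0(x,k) = (2/k)^m √x I_m(kx)`, and `x^{1/2+m}/Γ(m+1)` at `k = 0`. The factor `(2/k)^m`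
is written `(k/2)^{-m}`; then the branches cancel for every `k ≠ 0`. -/
def u0 (m k : ℂ) (x : ℝ) : ℂ :=
  if k = 0 then (x : ℂ) ^ (1 / 2 + m) / Complex.Gamma (m + 1)
  else (k / 2) ^ (-m) * (Real.sqrt x : ℂ) * besselI m (k * x)

/-- `v_0^0(x,k) = √x K_0(kx)` for `k ≠ 0`. -/
def v00 (k : ℂ) (x : ℝ) : ℂ := (Real.sqrt x : ℂ) * besselK 0 (k * x)

/-- The logarithmic solution `p_0^0(x,k) = -v_0^0(x,k) - (ln(k/2) + γ) u_0^0(x,k)` for `m = 0`, and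
`√x ln x` at `k = 0`. -/
def p00 (k : ℂ) (x : ℝ) : ℂ :=
  if k = 0 then (Real.sqrt x : ℂ) * (Real.log x : ℂ)
  else -v00 k x - (Complex.log (k / 2) + (Real.eulerMascheroniConstant : ℂ)) * u0 0 k x

/-! ### The perturbed equation -/

/-- `AC¹]0,∞[`: differentiable functions with locally absolutely continuous derivative. -/
def AC1 (f : ℝ → ℂ) : Prop :=
  (∀ x, 0 < x → DifferentiableAt ℝ f x) ∧
    ∀ a b : ℝ, 0 < a → 0 < b → AbsolutelyContinuousOnInterval (deriv f) a b

/-- `f ∈ AC¹]0,∞[` and `-f'' + (m² - 1/4) x⁻² f + Q f = -k² f` almost everywhere. The unperturbed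
equation is the case `Q = 0`. -/
def IsEigensolution (m k : ℂ) (Q f : ℝ → ℂ) : Prop :=
  AC1 f ∧ ∀ᵐ x ∂(volume.restrict (Ioi (0 : ℝ))),
    -deriv (deriv f) x + (m ^ 2 - 1 / 4) / (x : ℂ) ^ 2 * f x + Q x * f x = -k ^ 2 * f x

/-- `𝓛^{(0)}_ε`. -/
def L0 (ε : ℝ) (Q : ℝ → ℂ) : Prop :=
  LocallyIntegrableOn Q (Ioi 0) ∧
    IntegrableOn (fun x : ℝ => x ^ (1 - ε) * ‖Q x‖) (Ioo 0 1)

/-- `𝓛^{(0)}_{ε,ln^β}`. -/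
def L0ln (ε β : ℝ) (Q : ℝ → ℂ) : Prop :=
  LocallyIntegrableOn Q (Ioi 0) ∧
    IntegrableOn (fun x : ℝ => x ^ (1 - ε) * (1 + |Real.log x| ^ β) * ‖Q x‖) (Ioo 0 1)

/-- `g` solves the perturbed equation, with `g - g⁰ = o(x^{1/2+s})` and
`g' - g⁰' = o(x^{-1/2+s})` as `x → 0`. -/
def ApproximatesAtZero (m k : ℂ) (Q g0 : ℝ → ℂ) (s : ℝ) (g : ℝ → ℂ) : Prop :=
  IsEigensolution m k Q g ∧
    (fun x => g x - g0 x) =o[𝓝[>] (0 : ℝ)] (fun x => x ^ (1 / 2 + s)) ∧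
    (fun x => deriv g x - deriv g0 x) =o[𝓝[>] (0 : ℝ)] (fun x => x ^ (-1 / 2 + s))

/-- `g` is the only solution on `]0,∞[` that approximates `g⁰` to order `s`. -/
def IsUniqueApproximation (m k : ℂ) (Q g0 : ℝ → ℂ) (s : ℝ) (g : ℝ → ℂ) : Prop :=
  ApproximatesAtZero m k Q g0 s g ∧
    ∀ f, ApproximatesAtZero m k Q g0 s f → EqOn f g (Ioi 0)

/-! ### The forward Green's operator -/

/-- `h₁`, `h₂` solve the unperturbed equation and their Wronskian `h₁ h₂' - h₁' h₂` is the nonzero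
constant `w`. -/
def IsFundamentalPair (m k : ℂ) (h₁ h₂ : ℝ → ℂ) (w : ℂ) : Prop :=
  IsEigensolution m k 0 h₁ ∧ IsEigensolution m k 0 h₂ ∧ w ≠ 0 ∧
    ∀ x, 0 < x → h₁ x * deriv h₂ x - deriv h₁ x * h₂ x = w

/-- The kernel `G_→(x,y) = θ(x-y) (h₁(x) h₂(y) - h₂(x) h₁(y)) / w`. -/
def forwardGreen (h₁ h₂ : ℝ → ℂ) (w : ℂ) (x y : ℝ) : ℂ :=
  if y ≤ x then (h₁ x * h₂ y - h₂ x * h₁ y) / w else 0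

/-- `(G Q f)(x) = ∫₀^∞ G(x,y) Q(y) f(y) dy`. -/
def applyGQ (G : ℝ → ℝ → ℂ) (Q f : ℝ → ℂ) (x : ℝ) : ℂ :=
  ∫ y in Ioi (0 : ℝ), G x y * Q y * f y

/-- The norm of the weighted space `L^∞(]0,a[, φ)`. -/
def wNorm (a : ℝ) (φ : ℝ → ℝ) (f : ℝ → ℂ) : ENNReal :=
  eLpNorm (fun x => f x / (φ x : ℂ)) ⊤ (volume.restrict (Ioo 0 a))

/-- Membership in the weighted space `L^∞(]0,a[, φ)`. -/
def MemW (a : ℝ) (φ : ℝ → ℝ) (f : ℝ → ℂ) : Prop :=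
  MemLp (fun x => f x / (φ x : ℂ)) ⊤ (volume.restrict (Ioo 0 a))

/-- For a forward Volterra kernel `G`: the operator `1 + G Q` is well defined, bounded, and
boundedly invertible on `L^∞(]0,a[, φ)` (elements being identified when equal almost everywhere
on `]0,a[`). -/
structure InvertibleOn (G : ℝ → ℝ → ℂ) (Q : ℝ → ℂ) (a : ℝ) (φ : ℝ → ℝ) : Prop where
  integrable : ∀ f, MemW a φ f → ∀ x ∈ Ioo 0 a, IntegrableOn (fun y => G x y * Q y * f y) (Ioi 0)
  bounded : ∃ C : NNReal, ∀ f, MemW a φ f →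
    MemW a φ (applyGQ G Q f) ∧ wNorm a φ (applyGQ G Q f) ≤ C * wNorm a φ f
  injective : ∀ f g, MemW a φ f → MemW a φ g →
    (∀ᵐ x ∂(volume.restrict (Ioo 0 a)), f x + applyGQ G Q f x = g x + applyGQ G Q g x) →
    ∀ᵐ x ∂(volume.restrict (Ioo 0 a)), f x = g x
  surjective : ∃ C : NNReal, ∀ f, MemW a φ f → ∃ g, MemW a φ g ∧
    (∀ᵐ x ∂(volume.restrict (Ioo 0 a)), g x + applyGQ G Q g x = f x) ∧ wNorm a φ g ≤ C * wNorm a φ f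

/-- `g = (1 + G_→^0 Q)^{-1} g⁰`: for every interval `]0,a[` the operator `1 + G_→^0 Q` is invertible
on `L^∞(]0,a[, φ)`, `g⁰` restricts to an element of that space, and its preimage is the restriction
of `g`. The forward Green's operator may be computed from any fundamental pair, and there is such
a pair. -/
def IsInverseImage (m k : ℂ) (Q : ℝ → ℂ) (φ : ℝ → ℝ) (g0 g : ℝ → ℂ) : Prop :=
  (∃ h₁ h₂ w, IsFundamentalPair m k h₁ h₂ w) ∧
    ∀ h₁ h₂ w, IsFundamentalPair m k h₁ h₂ w → ∀ a : ℝ, 0 < a →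
      InvertibleOn (forwardGreen h₁ h₂ w) Q a φ ∧ MemW a φ g0 ∧ MemW a φ g ∧
        ∀ x ∈ Ioo 0 a, g x + applyGQ (forwardGreen h₁ h₂ w) Q g x = g0 x

end PerturbedBessel

end

noncomputable section

namespace PerturbedBessel

/-! ### Absolutely continuous complex-valued functions -/

/-! Variation of constants turns the perturbed equation into the Volterra equation `g + G Q g = g⁰`.
Everything rests on one estimate, isolated in `Admissible`: for `0 < y ≤ x ≤ a`, `|G(x,y)| φ(y) ≤ C
x^{1/2+s} ω(y)` and `|∂ₓG(x,y)| φ(y) ≤ C x^{-1/2+s} ω(y)`, where `ω |Q|` is integrable at `0` and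
`x^{1/2+s} ≤ C φ(x)`.

Existence. Let `ρ` be a suitable multiple of `ω |Q|` and `R` its primitive from `0`. The weight `φ
e^{2R}` is comparable to `φ` on `]0,a[`, and since `∫ ρ e^{2R} ≤ e^{2R}/2`, the operator `G Q` has
norm at most `1/2` for it (`exists_contraction_weight`). Picard iteration then inverts `1 + G Q`,
and the local preimages glue by uniqueness. The solution satisfies `|g - g⁰| ≤ C x^{1/2+s} ∫₀ˣ ω
|Q|` up to a constant; the integral tends to `0`, which gives the little-o. The derivative is
handled in the same way.

Uniqueness. The difference `d` of two solutions that approximate `g⁰` to the weaker order `r ≤ s`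
lies in the weighted spaces, and `volterra_of_isEigensolution` shows that `d + G Q d` is a solution
of the unperturbed equation. It is negligible compared with the regular behaviour at `0`, so a
Wronskian argument makes it vanish; injectivity of `1 + G Q` gives `d = 0`. Uniqueness to order `s`
follows.

Kernel estimate. For `m ≠ 0` it comes from a differential inequality for an energy that diagonalizes
the Euler operator (`hasDerivAt_energy`, `green_bound`), without Bessel asymptotics and with integer
`m` included. For `m = 0` the diagonalization degenerates; there `K_0 = -∂_μ I_μ` at `μ = 0` gives
an explicit logarithmic series for `p_0^0`, and the logarithms enter the kernel only through `ln x -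
ln y` (`green_bound_zero`). -/

theorem _root_.AbsolutelyContinuousOnInterval.lipschitzOn_comp {X Y : Type*}
    [PseudoMetricSpace X] [PseudoMetricSpace Y] {f : ℝ → X} {φ : X → Y} {a b : ℝ} {K : NNReal}
    {s : Set X} (hf : AbsolutelyContinuousOnInterval f a b) (hφ : LipschitzOnWith K φ s)
    (hs : MapsTo f (uIcc a b) s) : AbsolutelyContinuousOnInterval (fun x => φ (f x)) a b := by
  rw [absolutelyContinuousOnInterval_iff] at hf ⊢
  intro ε hε
  -- `K + 1` rather than `K`, so that the quotient makes sense for `K = 0`.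
  obtain ⟨δ, hδ, h⟩ := hf (ε / (K + 1)) (by positivity)
  refine ⟨δ, hδ, fun E hE hlt => ?_⟩
  have h1 := h E hE hlt
  calc ∑ i ∈ Finset.range E.1, dist (φ (f (E.2 i).1)) (φ (f (E.2 i).2))
      ≤ ∑ i ∈ Finset.range E.1, K * dist (f (E.2 i).1) (f (E.2 i).2) := by
        refine Finset.sum_le_sum fun i hi => ?_
        exact hφ.dist_le_mul _ (hs (hE.1 i hi).1) _ (hs (hE.1 i hi).2)
    _ = K * ∑ i ∈ Finset.range E.1, dist (f (E.2 i).1) (f (E.2 i).2) := by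
        rw [Finset.mul_sum]
    _ ≤ (K + 1) * ∑ i ∈ Finset.range E.1, dist (f (E.2 i).1) (f (E.2 i).2) := by
        gcongr
        simp
    _ < ε := by
        rw [lt_div_iff₀ (by positivity)] at h1
        linarith

theorem _root_.AbsolutelyContinuousOnInterval.congr_on {X : Type*} [PseudoMetricSpace X]
    {f g : ℝ → X} {a b : ℝ} (hf : AbsolutelyContinuousOnInterval f a b)
    (h : EqOn g f (uIcc a b)) : AbsolutelyContinuousOnInterval g a b := by
  rw [absolutelyContinuousOnInterval_iff] at hf ⊢
  intro ε hε
  obtain ⟨δ, hδ, H⟩ := hf ε hε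
  refine ⟨δ, hδ, fun E hE hlt => ?_⟩
  convert H E hE hlt using 1
  refine Finset.sum_congr rfl fun i hi => ?_
  rw [h (hE.1 i hi).1, h (hE.1 i hi).2]

theorem absolutelyContinuousOnInterval_of_hasDerivAt {f f' : ℝ → ℂ} {a b : ℝ}
    (hf : ∀ x ∈ uIcc a b, HasDerivAt f (f' x) x) (hc : ContinuousOn f' (uIcc a b)) :
    AbsolutelyContinuousOnInterval f a b := by
  obtain ⟨C, hC⟩ := isCompact_uIcc.exists_bound_of_continuousOn hc
  have hC0 : 0 ≤ C := (norm_nonneg _).trans (hC a left_mem_uIcc)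
  have : LipschitzOnWith ⟨C, hC0⟩ f (uIcc a b) := by
    refine Convex.lipschitzOnWith_of_nnnorm_hasDerivWithin_le (convex_uIcc a b)
      (fun x hx => (hf x hx).hasDerivWithinAt) (fun x hx => ?_)
    exact_mod_cast hC x hx
  exact this.absolutelyContinuousOnInterval

theorem _root_.AbsolutelyContinuousOnInterval.re {f : ℝ → ℂ} {a b : ℝ}
    (hf : AbsolutelyContinuousOnInterval f a b) :
    AbsolutelyContinuousOnInterval (fun x => (f x).re) a b :=
  hf.lipschitzOn_comp (K := 1) (s := univ) (φ := Complex.re)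
    (LipschitzWith.of_dist_le_mul (fun x y => by
      simpa [Complex.dist_eq, Real.dist_eq] using Complex.abs_re_le_norm (x - y))).lipschitzOnWith
    (mapsTo_univ _ _)

theorem _root_.AbsolutelyContinuousOnInterval.im {f : ℝ → ℂ} {a b : ℝ}
    (hf : AbsolutelyContinuousOnInterval f a b) :
    AbsolutelyContinuousOnInterval (fun x => (f x).im) a b :=
  hf.lipschitzOn_comp (K := 1) (s := univ) (φ := Complex.im)
    (LipschitzWith.of_dist_le_mul (fun x y => by
      simpa [Complex.dist_eq, Real.dist_eq] using Complex.abs_im_le_norm (x - y))).lipschitzOnWith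
    (mapsTo_univ _ _)

theorem _root_.AbsolutelyContinuousOnInterval.ofReal {f : ℝ → ℝ} {a b : ℝ}
    (hf : AbsolutelyContinuousOnInterval f a b) :
    AbsolutelyContinuousOnInterval (fun x => (f x : ℂ)) a b :=
  hf.lipschitzOn_comp (K := 1) (s := univ) (φ := Complex.ofReal)
    Complex.isometry_ofReal.lipschitz.lipschitzOnWith (mapsTo_univ _ _)

/-- Real and imaginary parts are treated separately and recombined as `re + i im`. -/
theorem absolutelyContinuousOnInterval_integral {f : ℝ → ℂ} {a b c : ℝ}
    (hf : IntervalIntegrable f volume a b) (hc : c ∈ uIcc a b) :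
    AbsolutelyContinuousOnInterval (fun x => ∫ v in c..x, f v) a b := by
  have hsub : ∀ x ∈ uIcc a b, IntervalIntegrable f volume c x := fun x hx =>
    hf.mono_set (uIcc_subset_uIcc hc hx)
  have hre : IntervalIntegrable (fun x => (f x).re) volume a b := ⟨hf.1.re, hf.2.re⟩
  have him : IntervalIntegrable (fun x => (f x).im) volume a b := ⟨hf.1.im, hf.2.im⟩
  have h1 := (hre.absolutelyContinuousOnInterval_intervalIntegral hc).ofReal
  have h2 := (him.absolutelyContinuousOnInterval_intervalIntegral hc).ofReal
  refine (h1.add (h2.const_smul Complex.I)).congr_on fun x hx => ?_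
  have e1 : ((∫ v in c..x, (f v).re : ℝ) : ℂ) = ∫ v in c..x, ((f v).re : ℂ) :=
    (intervalIntegral.integral_ofReal).symm
  have e2 : ((∫ v in c..x, (f v).im : ℝ) : ℂ) = ∫ v in c..x, ((f v).im : ℂ) :=
    (intervalIntegral.integral_ofReal).symm
  have i1 : IntervalIntegrable (fun v => ((f v).re : ℂ)) volume c x :=
    ⟨(hsub x hx).1.re.ofReal, (hsub x hx).2.re.ofReal⟩
  have i2 : IntervalIntegrable (fun v => ((f v).im : ℂ)) volume c x :=
    ⟨(hsub x hx).1.im.ofReal, (hsub x hx).2.im.ofReal⟩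
  simp only [Pi.add_apply, smul_eq_mul]
  rw [e1, e2, ← intervalIntegral.integral_const_mul,
    ← intervalIntegral.integral_add i1 (i2.const_mul _)]
  refine intervalIntegral.integral_congr fun v _ => ?_
  rw [mul_comm Complex.I]
  exact (Complex.re_add_im (f v)).symm

theorem _root_.AbsolutelyContinuousOnInterval.ae_differentiableAt_complex {f : ℝ → ℂ} {a b : ℝ}
    (hf : AbsolutelyContinuousOnInterval f a b) :
    ∀ᵐ x, x ∈ uIcc a b → DifferentiableAt ℝ f x := by
  filter_upwards [hf.re.ae_differentiableAt, hf.im.ae_differentiableAt] with x h1 h2 hx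
  have h1' := (h1 hx).hasDerivAt.ofReal_comp
  have h2' := (h2 hx).hasDerivAt.ofReal_comp
  have h3 := h1'.add (h2'.mul_const Complex.I)
  refine h3.differentiableAt.congr_of_eventuallyEq (Eventually.of_forall fun y => ?_)
  exact (Complex.re_add_im (f y)).symm

/-- The fundamental theorem of calculus for a complex-valued absolutely continuous function whose
almost everywhere derivative is known. -/
theorem _root_.AbsolutelyContinuousOnInterval.integral_eq_sub_of_ae_hasDerivAt {f f' : ℝ → ℂ}
    {a b : ℝ} (hf : AbsolutelyContinuousOnInterval f a b)
    (hd : ∀ᵐ x, x ∈ uIcc a b → HasDerivAt f (f' x) x) (hi : IntervalIntegrable f' volume a b) :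
    ∫ x in a..b, f' x = f b - f a := by
  have hac := hf.fun_sub (absolutelyContinuousOnInterval_integral hi left_mem_uIcc)
  have h0 : ∀ᵐ x, x ∈ uIcc a b → HasDerivAt (fun x => f x - ∫ v in a..x, f' v) 0 x := by
    filter_upwards [hd, hi.ae_hasDerivAt_integral] with x h1 h2 hx
    simpa using (h1 hx).fun_sub (h2 hx a left_mem_uIcc)
  obtain ⟨C, hC⟩ := hac.const_of_ae_hasDerivAt_zero h0
  have h1 := hC a left_mem_uIcc
  have h2 := hC b right_mem_uIcc
  simp only [intervalIntegral.integral_same, sub_zero] at h1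
  rw [← h1] at h2
  rw [← h2]
  ring

/-- For `ρ ≥ 0` with primitive `R`, the integral of `ρ e^{2R}` is at most `e^{2R}/2`. -/
theorem integral_mul_exp_primitive_le {ρ : ℝ → ℝ} {x : ℝ}
    (hρ : IntervalIntegrable ρ volume 0 x) :
    IntervalIntegrable (fun y => ρ y * Real.exp (2 * ∫ t in (0 : ℝ)..y, ρ t)) volume 0 x ∧
      ∫ y in (0 : ℝ)..x, ρ y * Real.exp (2 * ∫ t in (0 : ℝ)..y, ρ t) ≤
        Real.exp (2 * ∫ t in (0 : ℝ)..x, ρ t) / 2 := by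
  have hac := hρ.absolutelyContinuousOnInterval_intervalIntegral (c := 0) left_mem_uIcc
  have hi : IntervalIntegrable (fun y => ρ y * Real.exp (2 * ∫ t in (0 : ℝ)..y, ρ t)) volume 0 x :=
    hρ.mul_continuousOn ((continuousOn_const.mul hac.continuousOn).rexp)
  refine ⟨hi, ?_⟩
  obtain ⟨C, hC⟩ := hac.exists_bound
  -- The exponential is Lipschitz only on bounded sets; the primitive is bounded by `C` on the
  -- interval, so `[-2C, 2C]` suffices.
  obtain ⟨K, hK⟩ := (Real.contDiff_exp (n := 1)).contDiffOn.exists_lipschitzOnWith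
    (by decide) (convex_Icc (-(2 * C)) (2 * C)) isCompact_Icc
  have hac2 := (hac.const_mul 2).lipschitzOn_comp hK (fun y hy => by
    have := hC y hy
    rw [Real.norm_eq_abs, abs_le] at this
    constructor <;> linarith)
  have h1 := hac2.integral_deriv_eq_sub
  have h2 : ∫ y in (0 : ℝ)..x, deriv (fun y => Real.exp (2 * ∫ t in (0 : ℝ)..y, ρ t)) y =
      ∫ y in (0 : ℝ)..x, 2 * (ρ y * Real.exp (2 * ∫ t in (0 : ℝ)..y, ρ t)) := by
    refine intervalIntegral.integral_congr_ae ?_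
    filter_upwards [hρ.ae_hasDerivAt_integral] with y hy hy'
    have := ((hy (uIoc_subset_uIcc hy') 0 left_mem_uIcc).const_mul 2).exp
    rw [this.deriv]
    ring
  rw [h2, intervalIntegral.integral_const_mul] at h1
  simp only [intervalIntegral.integral_same, mul_zero, Real.exp_zero] at h1
  -- The exact value is `(e^{2R(x)} - 1)/2`; the contribution of the endpoint `0` is dropped.
  linarith

/-! ### Solutions of the unperturbed equation -/

/-- `f` is a classical solution of the unperturbed equation on `]0,∞[` with derivative `f'`. -/
def IsFreeSolution (m k : ℂ) (f f' : ℝ → ℂ) : Prop :=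
  ∀ x : ℝ, 0 < x → HasDerivAt f (f' x) x ∧
    HasDerivAt f' (((m ^ 2 - 1 / 4) / (x : ℂ) ^ 2 + k ^ 2) * f x) x

theorem uIcc_pos {a b x : ℝ} (ha : 0 < a) (hb : 0 < b) (hx : x ∈ uIcc a b) : 0 < x :=
  (lt_min ha hb).trans_le hx.1

theorem IsFreeSolution.continuousOn {m k : ℂ} {f f' : ℝ → ℂ} (h : IsFreeSolution m k f f') :
    ContinuousOn f (Ioi 0) := fun x hx => (h x hx).1.continuousAt.continuousWithinAt

theorem IsFreeSolution.continuousOn_deriv {m k : ℂ} {f f' : ℝ → ℂ}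
    (h : IsFreeSolution m k f f') : ContinuousOn f' (Ioi 0) :=
  fun x hx => (h x hx).2.continuousAt.continuousWithinAt

theorem continuousOn_potential (m k : ℂ) :
    ContinuousOn (fun x : ℝ => (m ^ 2 - 1 / 4) / (x : ℂ) ^ 2 + k ^ 2) (Ioi 0) := by
  refine ContinuousOn.add (ContinuousOn.div continuousOn_const (by fun_prop) fun x hx => ?_)
    continuousOn_const
  exact pow_ne_zero 2 (Complex.ofReal_ne_zero.2 (ne_of_gt hx))

theorem uIcc_subset_Ioi {a b : ℝ} (ha : 0 < a) (hb : 0 < b) : uIcc a b ⊆ Ioi 0 :=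
  fun _ hx => uIcc_pos ha hb hx

theorem IsFreeSolution.absolutelyContinuous {m k : ℂ} {f f' : ℝ → ℂ}
    (h : IsFreeSolution m k f f') {a b : ℝ} (ha : 0 < a) (hb : 0 < b) :
    AbsolutelyContinuousOnInterval f a b :=
  absolutelyContinuousOnInterval_of_hasDerivAt (fun x hx => (h x (uIcc_pos ha hb hx)).1)
    (h.continuousOn_deriv.mono (uIcc_subset_Ioi ha hb))

theorem IsFreeSolution.absolutelyContinuous_deriv {m k : ℂ} {f f' : ℝ → ℂ}
    (h : IsFreeSolution m k f f') {a b : ℝ} (ha : 0 < a) (hb : 0 < b) :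
    AbsolutelyContinuousOnInterval f' a b :=
  absolutelyContinuousOnInterval_of_hasDerivAt (fun x hx => (h x (uIcc_pos ha hb hx)).2)
    (((continuousOn_potential m k).mul h.continuousOn).mono (uIcc_subset_Ioi ha hb))

theorem IsFreeSolution.deriv_eq {m k : ℂ} {f f' : ℝ → ℂ} (h : IsFreeSolution m k f f')
    {x : ℝ} (hx : 0 < x) : deriv f x = f' x := (h x hx).1.deriv

theorem IsFreeSolution.isEigensolution {m k : ℂ} {f f' : ℝ → ℂ} (h : IsFreeSolution m k f f') :
    IsEigensolution m k 0 f := by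
  refine ⟨⟨fun x hx => (h x hx).1.differentiableAt, fun a b ha hb => ?_⟩, ?_⟩
  · exact (h.absolutelyContinuous_deriv ha hb).congr_on
      fun x hx => h.deriv_eq (uIcc_pos ha hb hx)
  · refine (ae_restrict_iff' measurableSet_Ioi).2 (Eventually.of_forall fun x hx => ?_)
    have : deriv (deriv f) x = ((m ^ 2 - 1 / 4) / (x : ℂ) ^ 2 + k ^ 2) * f x := by
      refine HasDerivAt.deriv ((h x hx).2.congr_of_eventuallyEq ?_)
      filter_upwards [Ioi_mem_nhds hx] with y hy using h.deriv_eq hy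
    rw [this]
    simp only [Pi.zero_apply]
    ring

/-- For `f ∈ AC¹` the second derivative exists almost everywhere on bounded intervals. -/
theorem AC1.ae_hasDerivAt_deriv {f : ℝ → ℂ} (h : AC1 f) {a b : ℝ} (ha : 0 < a) (hb : 0 < b) :
    ∀ᵐ x, x ∈ uIcc a b → HasDerivAt (deriv f) (deriv (deriv f) x) x := by
  filter_upwards [(h.2 a b ha hb).ae_differentiableAt_complex] with x hx hx'
  exact (hx hx').hasDerivAt

theorem AC1.continuousOn {f : ℝ → ℂ} (h : AC1 f) : ContinuousOn f (Ioi 0) :=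
  fun x hx => (h.1 x hx).continuousAt.continuousWithinAt

/-- Upgrades a derivative known almost everywhere to one at every point, once the candidate is
continuous: near `x`, `f` differs from a primitive of `g` by a constant. -/
theorem hasDerivAt_of_forall_integral {f g : ℝ → ℂ} (hg : ContinuousOn g (Ioi 0))
    (h : ∀ a b : ℝ, 0 < a → 0 < b → ∫ t in a..b, g t = f b - f a) {x : ℝ} (hx : 0 < x) :
    HasDerivAt f (g x) x := by
  have hm : Ioi (0 : ℝ) ∈ 𝓝 x := Ioi_mem_nhds hx
  have h1 : HasDerivAt (fun u => ∫ t in x..u, g t) (g x) x :=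
    intervalIntegral.integral_hasDerivAt_right (by simp)
      (hg.stronglyMeasurableAtFilter isOpen_Ioi x hx) (hg.continuousAt hm)
  refine (h1.add_const (f x)).congr_of_eventuallyEq ?_
  filter_upwards [hm] with y hy
  rw [h x y hx hy]
  ring

/-- For `Q = 0` the second derivative agrees almost everywhere with a continuous function, so
integrating makes the equation hold at every point. -/
theorem IsEigensolution.isFreeSolution {m k : ℂ} {f : ℝ → ℂ} (h : IsEigensolution m k 0 f) :
    IsFreeSolution m k f (deriv f) := by
  intro x hx
  refine ⟨(h.1.1 x hx).hasDerivAt, ?_⟩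
  have hc := (continuousOn_potential m k).mul h.1.continuousOn
  refine hasDerivAt_of_forall_integral
    (g := fun x => ((m ^ 2 - 1 / 4) / (x : ℂ) ^ 2 + k ^ 2) * f x) hc (fun a b ha hb => ?_) hx
  refine (h.1.2 a b ha hb).integral_eq_sub_of_ae_hasDerivAt ?_
    (hc.mono (uIcc_subset_Ioi ha hb)).intervalIntegrable
  filter_upwards [h.1.ae_hasDerivAt_deriv ha hb,
    (ae_restrict_iff' measurableSet_Ioi).1 h.2] with y h1 h2 hy
  convert h1 hy using 1
  have := h2 (uIcc_pos ha hb hy)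
  simp only [Pi.zero_apply] at this
  linear_combination this

/-- The Wronskian of two solutions of the unperturbed equation is constant. -/
theorem IsFreeSolution.wronskian_eq {m k : ℂ} {f f' g g' : ℝ → ℂ} (hf : IsFreeSolution m k f f')
    (hg : IsFreeSolution m k g g') {x y : ℝ} (hx : 0 < x) (hy : 0 < y) :
    f x * g' x - f' x * g x = f y * g' y - f' y * g y := by
  have hd : ∀ z ∈ Ioi (0 : ℝ), HasDerivAt (fun z => f z * g' z - f' z * g z) 0 z := by
    intro z hz
    exact (((hf z hz).1.fun_mul (hg z hz).2).fun_sub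
      ((hf z hz).2.fun_mul (hg z hz).1)).congr_deriv (by ring)
  exact isOpen_Ioi.is_const_of_deriv_eq_zero isPreconnected_Ioi
    (fun z hz => (hd z hz).differentiableAt.differentiableWithinAt)
    (fun z hz => (hd z hz).deriv) hx hy

/-! ### Variation of constants -/

theorem IsFundamentalPair.left {m k w : ℂ} {h₁ h₂ : ℝ → ℂ} (h : IsFundamentalPair m k h₁ h₂ w) :
    IsFreeSolution m k h₁ (deriv h₁) := h.1.isFreeSolution

theorem IsFundamentalPair.right {m k w : ℂ} {h₁ h₂ : ℝ → ℂ} (h : IsFundamentalPair m k h₁ h₂ w) :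
    IsFreeSolution m k h₂ (deriv h₂) := h.2.1.isFreeSolution

/-- The derivative of `applyGQ (forwardGreen h₁ h₂ w) Q f`. -/
def greenDeriv (h₁ h₂ : ℝ → ℂ) (w : ℂ) (Q f : ℝ → ℂ) (x : ℝ) : ℂ :=
  (deriv h₁ x * (∫ y in (0 : ℝ)..x, h₂ y * Q y * f y) -
    deriv h₂ x * ∫ y in (0 : ℝ)..x, h₁ y * Q y * f y) / w

/-- Both `h₁ Q f` and `h₂ Q f` are integrable up to the origin. -/
def PairIntegrable (h₁ h₂ Q f : ℝ → ℂ) (a : ℝ) : Prop :=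
  IntegrableOn (fun y => h₁ y * Q y * f y) (Ioc 0 a) ∧
    IntegrableOn (fun y => h₂ y * Q y * f y) (Ioc 0 a)

/-- Below the diagonal the kernel is a sum of two products, so that `G Q f` reduces to two
primitives from `0`. -/
theorem forwardGreen_mul_eq_indicator (h₁ h₂ : ℝ → ℂ) (w : ℂ) (Q f : ℝ → ℂ) (x : ℝ) :
    (fun y => forwardGreen h₁ h₂ w x y * Q y * f y) =
      (Iic x).indicator fun y =>
        h₁ x / w * (h₂ y * Q y * f y) - h₂ x / w * (h₁ y * Q y * f y) := by
  ext y
  by_cases hy : y ≤ x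
  · rw [indicator_of_mem (by exact hy)]
    simp only [forwardGreen, if_pos hy]
    ring
  · rw [indicator_of_notMem (by exact hy)]
    simp [forwardGreen, if_neg hy]

theorem PairIntegrable.integrableOn_green {h₁ h₂ Q f : ℝ → ℂ} {x : ℝ}
    (h : PairIntegrable h₁ h₂ Q f x) (w : ℂ) :
    IntegrableOn (fun y => forwardGreen h₁ h₂ w x y * Q y * f y) (Ioi 0) := by
  rw [forwardGreen_mul_eq_indicator, IntegrableOn, integrable_indicator_iff measurableSet_Iic,
    IntegrableOn, Measure.restrict_restrict measurableSet_Iic, inter_comm, Ioi_inter_Iic]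
  exact (h.2.const_mul _).sub (h.1.const_mul _)

theorem PairIntegrable.applyGQ_eq {h₁ h₂ Q f : ℝ → ℂ} {x : ℝ} (hx : 0 ≤ x)
    (h : PairIntegrable h₁ h₂ Q f x) (w : ℂ) :
    applyGQ (forwardGreen h₁ h₂ w) Q f x =
      (h₁ x * (∫ y in (0 : ℝ)..x, h₂ y * Q y * f y) -
        h₂ x * ∫ y in (0 : ℝ)..x, h₁ y * Q y * f y) / w := by
  rw [applyGQ, forwardGreen_mul_eq_indicator, setIntegral_indicator measurableSet_Iic,
    Ioi_inter_Iic, integral_sub (h.2.const_mul _) (h.1.const_mul _), integral_const_mul,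
    integral_const_mul, intervalIntegral.integral_of_le hx, intervalIntegral.integral_of_le hx]
  ring

theorem ac_primitive {F : ℝ → ℂ} (hF : ∀ a, 0 < a → IntegrableOn F (Ioc 0 a)) {a b : ℝ}
    (ha : 0 < a) (hb : 0 < b) :
    AbsolutelyContinuousOnInterval (fun x => ∫ y in (0 : ℝ)..x, F y) a b := by
  have h0 : 0 < max a b := lt_max_of_lt_left ha
  have hi : IntervalIntegrable F volume 0 (max a b) :=
    (intervalIntegrable_iff_integrableOn_Ioc_of_le h0.le).2 (hF _ h0)
  refine (absolutelyContinuousOnInterval_integral hi left_mem_uIcc).mono ?_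
  exact uIcc_subset_uIcc (by rw [uIcc_of_le h0.le]; exact ⟨ha.le, le_max_left _ _⟩)
    (by rw [uIcc_of_le h0.le]; exact ⟨hb.le, le_max_right _ _⟩)

theorem ae_hasDerivAt_primitive {F : ℝ → ℂ} (hF : ∀ a, 0 < a → IntegrableOn F (Ioc 0 a)) {a b : ℝ}
    (ha : 0 < a) (hb : 0 < b) :
    ∀ᵐ x, x ∈ uIcc a b → HasDerivAt (fun x => ∫ y in (0 : ℝ)..x, F y) (F x) x := by
  have h0 : 0 < max a b := lt_max_of_lt_left ha
  have hi : IntervalIntegrable F volume 0 (max a b) :=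
    (intervalIntegrable_iff_integrableOn_Ioc_of_le h0.le).2 (hF _ h0)
  filter_upwards [hi.ae_hasDerivAt_integral] with x hx hx'
  refine hx ?_ 0 left_mem_uIcc
  rw [uIcc_of_le h0.le]
  exact ⟨(uIcc_pos ha hb hx').le, hx'.2⟩

theorem continuousOn_primitive {F : ℝ → ℂ} (hF : ∀ a, 0 < a → IntegrableOn F (Ioc 0 a)) :
    ContinuousOn (fun x => ∫ y in (0 : ℝ)..x, F y) (Ioi 0) := by
  intro x hx
  have hx : 0 < x := hx
  have h := (ac_primitive hF (half_pos hx) (add_pos hx one_pos)).continuousOn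
  rw [uIcc_of_le (by linarith)] at h
  exact (h.continuousAt (Icc_mem_nhds (by linarith) (by linarith))).continuousWithinAt

/-- Countable exhaustion of the half-line by the intervals `[1/(n+1), n+1]`. -/
theorem ae_pos_of_forall_uIcc {p : ℝ → Prop}
    (h : ∀ a b : ℝ, 0 < a → 0 < b → ∀ᵐ x, x ∈ uIcc a b → p x) : ∀ᵐ x : ℝ, 0 < x → p x := by
  have key := fun n : ℕ => h ((n : ℝ) + 1)⁻¹ ((n : ℝ) + 1) (by positivity) (by positivity)
  filter_upwards [ae_all_iff.2 key] with x hx hx0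
  obtain ⟨n, hn⟩ := exists_nat_gt (max x x⁻¹)
  refine hx n ?_
  have h1 : x < n := (le_max_left _ _).trans_lt hn
  have h2 : x⁻¹ < n := (le_max_right _ _).trans_lt hn
  have h3 : (1 : ℝ) ≤ (n : ℝ) + 1 := by linarith
  rw [uIcc_of_le ((inv_le_one_of_one_le₀ h3).trans h3)]
  constructor
  · rw [inv_le_comm₀ (by linarith) hx0]; linarith
  · linarith

/-- A solution of the Volterra equation `g + G Q g = g⁰` solves the perturbed equation. -/
theorem isEigensolution_of_volterra {m k w : ℂ} {h₁ h₂ : ℝ → ℂ}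
    (hp : IsFundamentalPair m k h₁ h₂ w) {Q g g0 g0' : ℝ → ℂ} (hg0 : IsFreeSolution m k g0 g0')
    (hi : ∀ a, 0 < a → PairIntegrable h₁ h₂ Q g a)
    (hg : ∀ x, 0 < x → g x + applyGQ (forwardGreen h₁ h₂ w) Q g x = g0 x) :
    IsEigensolution m k Q g ∧ ∀ x, 0 < x → deriv g x = g0' x - greenDeriv h₁ h₂ w Q g x := by
  have hw := hp.2.2.1
  have hW := hp.2.2.2
  have hi1 := fun a ha => (hi a ha).1
  have hi2 := fun a ha => (hi a ha).2
  set I₁ : ℝ → ℂ := fun x => ∫ y in (0 : ℝ)..x, h₁ y * Q y * g y with hI₁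
  set I₂ : ℝ → ℂ := fun x => ∫ y in (0 : ℝ)..x, h₂ y * Q y * g y with hI₂
  set D : ℝ → ℂ := fun x => g0' x - w⁻¹ • (deriv h₁ x • I₂ x - deriv h₂ x • I₁ x) with hD
  have hDg : ∀ x, D x = g0' x - greenDeriv h₁ h₂ w Q g x := by
    intro x
    simp only [hD, greenDeriv, smul_eq_mul, hI₁, hI₂]
    ring
  have hgG : ∀ x, 0 < x → g x = g0 x - w⁻¹ • (h₁ x • I₂ x - h₂ x • I₁ x) := by
    intro x hx
    rw [← hg x hx, (hi x hx).applyGQ_eq hx.le]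
    simp only [smul_eq_mul, hI₁, hI₂]
    ring
  have hac : ∀ a b, 0 < a → 0 < b → AbsolutelyContinuousOnInterval g a b := by
    intro a b ha hb
    refine AbsolutelyContinuousOnInterval.congr_on ?_ fun x hx => hgG x (uIcc_pos ha hb hx)
    exact (hg0.absolutelyContinuous ha hb).fun_sub
      ((((hp.left.absolutelyContinuous ha hb).fun_smul (ac_primitive hi2 ha hb)).fun_sub
      ((hp.right.absolutelyContinuous ha hb).fun_smul (ac_primitive hi1 ha hb))).const_smul w⁻¹)
  have hacD : ∀ a b, 0 < a → 0 < b → AbsolutelyContinuousOnInterval D a b := by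
    intro a b ha hb
    exact (hg0.absolutelyContinuous_deriv ha hb).fun_sub
      ((((hp.left.absolutelyContinuous_deriv ha hb).fun_smul (ac_primitive hi2 ha hb)).fun_sub
      ((hp.right.absolutelyContinuous_deriv ha hb).fun_smul
        (ac_primitive hi1 ha hb))).const_smul w⁻¹)
  have hcD : ContinuousOn D (Ioi 0) := by
    exact hg0.continuousOn_deriv.sub
      ((((hp.left.continuousOn_deriv).smul (continuousOn_primitive hi2)).sub
      ((hp.right.continuousOn_deriv).smul (continuousOn_primitive hi1))).const_smul w⁻¹)
  have hder : ∀ x, 0 < x → HasDerivAt g (D x) x := by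
    intro x hx
    refine hasDerivAt_of_forall_integral hcD (fun a b ha hb => ?_) hx
    refine (hac a b ha hb).integral_eq_sub_of_ae_hasDerivAt ?_
      (hcD.mono (uIcc_subset_Ioi ha hb)).intervalIntegrable
    filter_upwards [ae_hasDerivAt_primitive hi1 ha hb, ae_hasDerivAt_primitive hi2 ha hb]
      with y h1 h2 hy
    have hy0 := uIcc_pos ha hb hy
    -- In the first derivative the primitives contribute `h₁ h₂ Q g - h₂ h₁ Q g = 0`, which is why
    -- `D` has no term in `Q g` outside the integrals.
    have := (hg0 y hy0).1.fun_sub ((((hp.left y hy0).1.fun_mul (h2 hy)).fun_sub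
      ((hp.right y hy0).1.fun_mul (h1 hy))).const_mul w⁻¹)
    refine (this.congr_of_eventuallyEq ?_).congr_deriv ?_
    · filter_upwards [Ioi_mem_nhds hy0] with z hz using hgG z hz
    · simp only [hD, smul_eq_mul, hI₁, hI₂]
      ring
  have hdg : ∀ x, 0 < x → deriv g x = D x := fun x hx => (hder x hx).deriv
  refine ⟨⟨⟨fun x hx => (hder x hx).differentiableAt, fun a b ha hb =>
    (hacD a b ha hb).congr_on fun x hx => hdg x (uIcc_pos ha hb hx)⟩, ?_⟩,
    fun x hx => (hdg x hx).trans (hDg x)⟩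
  · refine (ae_restrict_iff' measurableSet_Ioi).2 (ae_pos_of_forall_uIcc fun a b ha hb => ?_)
    filter_upwards [ae_hasDerivAt_primitive hi1 ha hb, ae_hasDerivAt_primitive hi2 ha hb]
      with y h1 h2 hy
    have hy0 := uIcc_pos ha hb hy
    have := (hg0 y hy0).2.fun_sub ((((hp.left y hy0).2.fun_mul (h2 hy)).fun_sub
      ((hp.right y hy0).2.fun_mul (h1 hy))).const_mul w⁻¹)
    have hev : deriv g =ᶠ[𝓝 y] D := by
      filter_upwards [Ioi_mem_nhds hy0] with z hz using hdg z hz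
    rw [(this.congr_of_eventuallyEq (f₁ := deriv g) hev).deriv]
    have e2 := hgG y hy0
    simp only [smul_eq_mul] at e2
    -- In the second derivative the primitives no longer cancel: they contribute `Q g` times the
    -- Wronskian over `w`, which is exactly the perturbation.
    have e3 := hW y hy0
    have e4 : w⁻¹ * (h₁ y * deriv h₂ y - deriv h₁ y * h₂ y) = 1 := by
      rw [e3]; exact inv_mul_cancel₀ hw
    linear_combination ((m ^ 2 - 1 / 4) / (y : ℂ) ^ 2 + k ^ 2) * e2 - Q y * g y * e4

/-- A solution `d` of the perturbed equation for which `h₁ Q d` and `h₂ Q d` are integrable at `0`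
satisfies a Volterra equation. -/
theorem volterra_of_isEigensolution {m k w : ℂ} {h₁ h₂ : ℝ → ℂ}
    (hp : IsFundamentalPair m k h₁ h₂ w) {Q d : ℝ → ℂ} (hd : IsEigensolution m k Q d)
    (hi : ∀ a, 0 < a → PairIntegrable h₁ h₂ Q d a) :
    ∃ c₁ c₂ : ℂ, ∀ x, 0 < x →
      d x + applyGQ (forwardGreen h₁ h₂ w) Q d x = c₁ * h₁ x + c₂ * h₂ x ∧
      deriv d x + greenDeriv h₁ h₂ w Q d x = c₁ * deriv h₁ x + c₂ * deriv h₂ x := by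
  have hw := hp.2.2.1
  have hW := hp.2.2.2
  -- Green's identity: `(h d' - h' d)' = h Q d` almost everywhere, so the Wronskian of `h` and `d`
  -- minus the primitive of `h Q d` is constant.
  have main : ∀ h h' : ℝ → ℂ, IsFreeSolution m k h h' →
      (∀ a, 0 < a → IntegrableOn (fun y => h y * Q y * d y) (Ioc 0 a)) →
      ∀ x, 0 < x → (h x * deriv d x - h' x * d x) - (∫ y in (0 : ℝ)..x, h y * Q y * d y) =
        (h 1 * deriv d 1 - h' 1 * d 1) - (∫ y in (0 : ℝ)..1, h y * Q y * d y) := by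
    intro h h' hh hI x hx
    have hacd : AbsolutelyContinuousOnInterval d 1 x :=
      absolutelyContinuousOnInterval_of_hasDerivAt
        (fun y hy => (hd.1.1 y (uIcc_pos one_pos hx hy)).hasDerivAt)
        (hd.1.2 1 x one_pos hx).continuousOn
    have hac := ((((hh.absolutelyContinuous one_pos hx).fun_smul (hd.1.2 1 x one_pos hx)).fun_sub
      ((hh.absolutelyContinuous_deriv one_pos hx).fun_smul hacd)).fun_sub
      (ac_primitive hI one_pos hx))
    have h0 : ∀ᵐ y, y ∈ uIcc 1 x → HasDerivAt (fun x => h x • deriv d x - h' x • d x -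
        ∫ y in (0 : ℝ)..x, h y * Q y * d y) 0 y := by
      filter_upwards [ae_hasDerivAt_primitive hI one_pos hx,
        hd.1.ae_hasDerivAt_deriv one_pos hx, (ae_restrict_iff' measurableSet_Ioi).1 hd.2]
        with y e1 e2 e3 hy
      have hy0 := uIcc_pos one_pos hx hy
      refine ((((hh y hy0).1.fun_mul (e2 hy)).fun_sub
        ((hh y hy0).2.fun_mul (hd.1.1 y hy0).hasDerivAt)).fun_sub (e1 hy)).congr_deriv ?_
      linear_combination - h y * e3 hy0
    obtain ⟨C, hC⟩ := hac.const_of_ae_hasDerivAt_zero h0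
    exact (hC x right_mem_uIcc).trans (hC 1 left_mem_uIcc).symm
  have m1 := main h₁ _ hp.left fun a ha => (hi a ha).1
  have m2 := main h₂ _ hp.right fun a ha => (hi a ha).2
  generalize (h₁ 1 * deriv d 1 - deriv h₁ 1 * d 1) -
    (∫ y in (0 : ℝ)..1, h₁ y * Q y * d y) = C₁ at m1
  generalize (h₂ 1 * deriv d 1 - deriv h₂ 1 * d 1) -
    (∫ y in (0 : ℝ)..1, h₂ y * Q y * d y) = C₂ at m2
  -- The two identities form a linear system for `d` and `d'` with determinant `w`; Cramer's rule
  -- gives these coefficients.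
  refine ⟨-C₂ / w, C₁ / w, fun x hx => ⟨?_, ?_⟩⟩
  · rw [(hi x hx).applyGQ_eq hx.le]
    field_simp
    linear_combination (-d x) * hW x hx - h₁ x * m2 x hx + h₂ x * m1 x hx
  · rw [greenDeriv]
    field_simp
    linear_combination (-deriv d x) * hW x hx - deriv h₁ x * m2 x hx + deriv h₂ x * m1 x hx

/-! ### Volterra inversion in weighted spaces -/

/-- `f` is measurable on `]0,a[` and bounded there by `M φ` almost everywhere. -/
def WBound (a : ℝ) (φ : ℝ → ℝ) (f : ℝ → ℂ) (M : ℝ) : Prop :=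
  AEStronglyMeasurable f (volume.restrict (Ioo 0 a)) ∧
    ∀ᵐ x ∂(volume.restrict (Ioo 0 a)), ‖f x‖ ≤ M * φ x

theorem ae_mem_Ioo (a : ℝ) : ∀ᵐ x ∂(volume.restrict (Ioo 0 a)), x ∈ Ioo 0 a :=
  ae_restrict_mem measurableSet_Ioo

theorem aestronglyMeasurable_weight {φ : ℝ → ℝ} (hφ : ContinuousOn φ (Ioi 0)) (a : ℝ) :
    AEStronglyMeasurable (fun x => (φ x : ℂ)) (volume.restrict (Ioo 0 a)) :=
  (Complex.continuous_ofReal.comp_continuousOn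
    (hφ.mono Ioo_subset_Ioi_self)).aestronglyMeasurable measurableSet_Ioo

theorem WBound.wNorm_le {a M : ℝ} {φ : ℝ → ℝ} {f : ℝ → ℂ} (hφ : ∀ x, 0 < x → 0 < φ x)
    (h : WBound a φ f M) : wNorm a φ f ≤ ENNReal.ofReal M := by
  rw [wNorm, eLpNorm_exponent_top]
  refine eLpNormEssSup_le_of_ae_bound ?_
  filter_upwards [h.2, ae_mem_Ioo a] with x hx hx0
  have := hφ x hx0.1
  rw [norm_div, Complex.norm_real, Real.norm_eq_abs, abs_of_pos this, div_le_iff₀ this]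
  exact hx

theorem WBound.memW {a M : ℝ} {φ : ℝ → ℝ} {f : ℝ → ℂ} (hφ : ∀ x, 0 < x → 0 < φ x)
    (hφc : ContinuousOn φ (Ioi 0)) (h : WBound a φ f M) : MemW a φ f := by
  refine ⟨?_, (h.wNorm_le hφ).trans_lt ENNReal.ofReal_lt_top⟩
  exact (h.1.aemeasurable.div
    (aestronglyMeasurable_weight hφc a).aemeasurable).aestronglyMeasurable

theorem MemW.wBound {a : ℝ} {φ : ℝ → ℝ} {f : ℝ → ℂ} (hφ : ∀ x, 0 < x → 0 < φ x)
    (hφc : ContinuousOn φ (Ioi 0)) (h : MemW a φ f) : WBound a φ f (wNorm a φ f).toReal := by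
  constructor
  · refine (h.1.mul (aestronglyMeasurable_weight hφc a)).congr ?_
    filter_upwards [ae_mem_Ioo a] with x hx
    simp only [Pi.mul_apply]
    exact div_mul_cancel₀ _ (Complex.ofReal_ne_zero.2 (hφ x hx.1).ne')
  · have h1 := ae_le_eLpNormEssSup (f := fun x => f x / (φ x : ℂ))
      (μ := volume.restrict (Ioo 0 a))
    filter_upwards [h1, ae_mem_Ioo a] with x hx hx0
    have hp := hφ x hx0.1
    rw [← eLpNorm_exponent_top] at hx
    have h2 := ENNReal.toReal_mono h.2.ne hx
    rw [toReal_enorm, norm_div, Complex.norm_real, Real.norm_eq_abs, abs_of_pos hp,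
      div_le_iff₀ hp] at h2
    exact h2

/-- The data under which the perturbation theory at the origin works: the weight `φ`, the
majorant `ω` with `ω Q` integrable at `0`, and the order `s` to which solutions are approximated. -/
structure Admissible (m k : ℂ) (Q : ℝ → ℂ) (φ ω : ℝ → ℝ) (s : ℝ) : Prop where
  weight_pos : ∀ x, 0 < x → 0 < φ x
  weight_cont : ContinuousOn φ (Ioi 0)
  weight_lower : ∀ a, 0 < a → ∃ C : ℝ, 0 ≤ C ∧ ∀ x, 0 < x → x ≤ a → x ^ (1 / 2 + s) ≤ C * φ x
  meas : AEStronglyMeasurable Q (volume.restrict (Ioi 0))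
  majorant_nonneg : ∀ x, 0 < x → 0 ≤ ω x
  majorant_int : ∀ a, 0 < a → IntegrableOn (fun y => ω y * ‖Q y‖) (Ioc 0 a)
  green : ∀ h₁ h₂ w, IsFundamentalPair m k h₁ h₂ w → ∀ a, 0 < a → ∃ C : ℝ, 0 ≤ C ∧
    ∀ x y, 0 < y → y ≤ x → x ≤ a →
      ‖h₁ x * h₂ y - h₂ x * h₁ y‖ * φ y ≤ C * x ^ (1 / 2 + s) * ω y ∧
      ‖deriv h₁ x * h₂ y - deriv h₂ x * h₁ y‖ * φ y ≤ C * x ^ (-1 / 2 + s) * ω y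

/-- At `x = a` the kernel and its `x`-derivative are two linear combinations of `h₁ y` and `h₂ y`
whose determinant is, up to sign, the Wronskian. Inverting the system bounds each function
separately. -/
theorem Admissible.pair_bound {m k : ℂ} {Q : ℝ → ℂ} {φ ω : ℝ → ℝ} {s : ℝ}
    (A : Admissible m k Q φ ω s) {h₁ h₂ : ℝ → ℂ} {w : ℂ} (hp : IsFundamentalPair m k h₁ h₂ w)
    {a : ℝ} (ha : 0 < a) : ∃ C : ℝ, 0 ≤ C ∧ ∀ y, 0 < y → y ≤ a →
      ‖h₁ y‖ * φ y ≤ C * ω y ∧ ‖h₂ y‖ * φ y ≤ C * ω y := by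
  obtain ⟨C, hC, hG⟩ := A.green h₁ h₂ w hp a ha
  have hw := hp.2.2.1
  have hW := hp.2.2.2 a ha
  have hw' : 0 < ‖w‖ := norm_pos_iff.2 hw
  set D := C * a ^ (1 / 2 + s) with hD
  set D' := C * a ^ (-1 / 2 + s) with hD'
  have hD0 : 0 ≤ D := by positivity
  have hD0' : 0 ≤ D' := by positivity
  have aux : ∀ (p q r t z : ℂ) (y : ℝ), 0 < y → ‖r‖ * φ y ≤ D * ω y → ‖t‖ * φ y ≤ D' * ω y →
      w * z = p * r + q * t → ‖z‖ * φ y ≤ (‖p‖ * D + ‖q‖ * D') / ‖w‖ * ω y := by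
    intro p q r t z y hy hr ht hz
    have hφ := A.weight_pos y hy
    have h1 : ‖w‖ * ‖z‖ ≤ ‖p‖ * ‖r‖ + ‖q‖ * ‖t‖ := by
      rw [← norm_mul, hz, ← norm_mul, ← norm_mul]
      exact norm_add_le _ _
    rw [div_mul_eq_mul_div, le_div_iff₀ hw']
    calc ‖z‖ * φ y * ‖w‖ = (‖w‖ * ‖z‖) * φ y := by ring
      _ ≤ (‖p‖ * ‖r‖ + ‖q‖ * ‖t‖) * φ y := by gcongr
      _ = ‖p‖ * (‖r‖ * φ y) + ‖q‖ * (‖t‖ * φ y) := by ring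
      _ ≤ ‖p‖ * (D * ω y) + ‖q‖ * (D' * ω y) := by gcongr
      _ = _ := by ring
  set C₁ := (‖deriv h₁ a‖ * D + ‖h₁ a‖ * D') / ‖w‖ with hC₁
  set C₂ := (‖deriv h₂ a‖ * D + ‖h₂ a‖ * D') / ‖w‖ with hC₂
  have hC10 : 0 ≤ C₁ := by positivity
  have hC20 : 0 ≤ C₂ := by positivity
  refine ⟨C₁ + C₂, by positivity, fun y hy hya => ?_⟩
  have hωy := A.majorant_nonneg y hy
  obtain ⟨g1, g2⟩ := hG a y hy hya le_rfl
  constructor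
  · refine (aux (deriv h₁ a) (-h₁ a) _ _ (h₁ y) y hy g1 g2 ?_).trans ?_
    · linear_combination -h₁ y * hW
    · rw [norm_neg, ← hC₁]
      gcongr
      linarith
  · refine (aux (deriv h₂ a) (-h₂ a) _ _ (h₂ y) y hy g1 g2 ?_).trans ?_
    · linear_combination -h₂ y * hW
    · rw [norm_neg, ← hC₂]
      gcongr
      linarith

theorem Admissible.pairIntegrable {m k : ℂ} {Q : ℝ → ℂ} {φ ω : ℝ → ℝ} {s : ℝ}
    (A : Admissible m k Q φ ω s) {h₁ h₂ : ℝ → ℂ} {w : ℂ} (hp : IsFundamentalPair m k h₁ h₂ w)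
    {a M : ℝ} (ha : 0 < a) {f : ℝ → ℂ} (hf : WBound a φ f M) : PairIntegrable h₁ h₂ Q f a := by
  obtain ⟨C, hC, hb⟩ := A.pair_bound hp ha
  have aux : ∀ h h' : ℝ → ℂ, IsFreeSolution m k h h' →
      (∀ y, 0 < y → y ≤ a → ‖h y‖ * φ y ≤ C * ω y) →
      IntegrableOn (fun y => h y * Q y * f y) (Ioc 0 a) := by
    intro h h' hh hbd
    rw [integrableOn_Ioc_iff_integrableOn_Ioo]
    have hI := ((A.majorant_int a ha).mono_set Ioo_subset_Ioc_self).const_mul (|M| * C)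
    refine Integrable.mono' hI ?_ ?_
    · exact (((hh.continuousOn.mono Ioo_subset_Ioi_self).aestronglyMeasurable
        measurableSet_Ioo).mul (A.meas.mono_set Ioo_subset_Ioi_self)).mul hf.1
    · filter_upwards [hf.2, ae_mem_Ioo a] with y hy hy0
      have h1 := hbd y hy0.1 hy0.2.le
      have hφ := A.weight_pos y hy0.1
      rw [norm_mul, norm_mul]
      calc ‖h y‖ * ‖Q y‖ * ‖f y‖ ≤ ‖h y‖ * ‖Q y‖ * (|M| * φ y) := by
            gcongr
            exact hy.trans (by gcongr; exact le_abs_self M)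
        _ = |M| * ‖Q y‖ * (‖h y‖ * φ y) := by ring
        _ ≤ |M| * ‖Q y‖ * (C * ω y) := by gcongr
        _ = _ := by ring
  exact ⟨aux h₁ _ hp.left fun y h0 h1 => (hb y h0 h1).1,
    aux h₂ _ hp.right fun y h0 h1 => (hb y h0 h1).2⟩

theorem PairIntegrable.mono {h₁ h₂ Q f : ℝ → ℂ} {a b : ℝ} (h : PairIntegrable h₁ h₂ Q f a)
    (hb : b ≤ a) : PairIntegrable h₁ h₂ Q f b :=
  ⟨h.1.mono_set (Ioc_subset_Ioc_right hb), h.2.mono_set (Ioc_subset_Ioc_right hb)⟩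

theorem PairIntegrable.applyGQ_sub {h₁ h₂ Q f g : ℝ → ℂ} {x : ℝ}
    (hf : PairIntegrable h₁ h₂ Q f x) (hg : PairIntegrable h₁ h₂ Q g x) (w : ℂ) :
    applyGQ (forwardGreen h₁ h₂ w) Q (fun y => f y - g y) x =
      applyGQ (forwardGreen h₁ h₂ w) Q f x - applyGQ (forwardGreen h₁ h₂ w) Q g x := by
  rw [applyGQ, applyGQ, applyGQ,
    ← integral_sub (hf.integrableOn_green w) (hg.integrableOn_green w)]
  congr 1
  ext y
  ring

/-- The two integrals are recombined before norms are taken, so that the kernel bound applies;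
separate bounds on `h₁` and `h₂` would be too weak at the origin. -/
theorem norm_combination_primitive_le {h₁ h₂ Q f : ℝ → ℂ} {x : ℝ} (hx : 0 < x)
    (hf : PairIntegrable h₁ h₂ Q f x) (p q w : ℂ) {B : ℝ → ℝ} (hB : IntegrableOn B (Ioc 0 x))
    (h : ∀ᵐ y ∂(volume.restrict (Ioo 0 x)), ‖p * h₂ y - q * h₁ y‖ * ‖Q y‖ * ‖f y‖ ≤ B y) :
    ‖(p * (∫ y in (0 : ℝ)..x, h₂ y * Q y * f y) -
      q * ∫ y in (0 : ℝ)..x, h₁ y * Q y * f y) / w‖ ≤ (∫ y in (0 : ℝ)..x, B y) / ‖w‖ := by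
  have i1 := (intervalIntegrable_iff_integrableOn_Ioc_of_le hx.le).2 hf.1
  have i2 := (intervalIntegrable_iff_integrableOn_Ioc_of_le hx.le).2 hf.2
  rw [norm_div, ← intervalIntegral.integral_const_mul, ← intervalIntegral.integral_const_mul,
    ← intervalIntegral.integral_sub (i2.const_mul _) (i1.const_mul _)]
  gcongr
  refine intervalIntegral.norm_integral_le_of_norm_le hx.le ?_
    ((intervalIntegrable_iff_integrableOn_Ioc_of_le hx.le).2 hB)
  rw [← ae_restrict_iff' measurableSet_Ioc, ← restrict_Ioo_eq_restrict_Ioc]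
  filter_upwards [h] with y hy
  rw [← norm_mul, ← norm_mul] at hy
  rwa [show p * (h₂ y * Q y * f y) - q * (h₁ y * Q y * f y) =
    (p * h₂ y - q * h₁ y) * Q y * f y by ring]

/-- Bounds for `G Q f` and its derivative when `|f| ≤ φ B`. -/
theorem Admissible.applyGQ_bound {m k : ℂ} {Q : ℝ → ℂ} {φ ω : ℝ → ℝ} {s : ℝ}
    (A : Admissible m k Q φ ω s) {h₁ h₂ : ℝ → ℂ} {w : ℂ} (hp : IsFundamentalPair m k h₁ h₂ w)
    {a : ℝ} (ha : 0 < a) : ∃ C : ℝ, 0 ≤ C ∧ ∀ (f : ℝ → ℂ) (B : ℝ → ℝ) (x : ℝ), 0 < x → x ≤ a →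
      PairIntegrable h₁ h₂ Q f x → IntegrableOn (fun y => ω y * ‖Q y‖ * B y) (Ioc 0 x) →
      (∀ᵐ y ∂(volume.restrict (Ioo 0 x)), ‖f y‖ ≤ B y * φ y) →
      ‖applyGQ (forwardGreen h₁ h₂ w) Q f x‖ ≤
          C * x ^ (1 / 2 + s) * ∫ y in (0 : ℝ)..x, ω y * ‖Q y‖ * B y ∧
      ‖greenDeriv h₁ h₂ w Q f x‖ ≤
          C * x ^ (-1 / 2 + s) * ∫ y in (0 : ℝ)..x, ω y * ‖Q y‖ * B y := by
  obtain ⟨C, hC, hG⟩ := A.green h₁ h₂ w hp a ha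
  refine ⟨C / ‖w‖, by positivity, fun f B x hx hxa hf hB hfB => ?_⟩
  have aux : ∀ (p q : ℂ) (D : ℝ), (∀ y, 0 < y → y ≤ x →
      ‖p * h₂ y - q * h₁ y‖ * φ y ≤ D * ω y) →
      ‖(p * (∫ y in (0 : ℝ)..x, h₂ y * Q y * f y) -
      q * ∫ y in (0 : ℝ)..x, h₁ y * Q y * f y) / w‖ ≤
        D / ‖w‖ * ∫ y in (0 : ℝ)..x, ω y * ‖Q y‖ * B y := by
    intro p q D hpq
    refine (norm_combination_primitive_le hx hf p q w (hB.const_mul D) ?_).trans (le_of_eq ?_)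
    · filter_upwards [hfB, ae_mem_Ioo x] with y hy hy0
      have hφ := A.weight_pos y hy0.1
      have hB0 : 0 ≤ B y := by
        by_contra hneg
        have := (norm_nonneg _).trans hy
        nlinarith
      calc ‖p * h₂ y - q * h₁ y‖ * ‖Q y‖ * ‖f y‖
          ≤ ‖p * h₂ y - q * h₁ y‖ * ‖Q y‖ * (B y * φ y) := by gcongr
        _ = (‖p * h₂ y - q * h₁ y‖ * φ y) * ‖Q y‖ * B y := by ring
        _ ≤ (D * ω y) * ‖Q y‖ * B y := by
          exact mul_le_mul_of_nonneg_right
            (mul_le_mul_of_nonneg_right (hpq y hy0.1 hy0.2.le) (norm_nonneg _)) hB0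
        _ = _ := by ring
    · rw [intervalIntegral.integral_const_mul]
      ring
  constructor
  · rw [hf.applyGQ_eq hx.le]
    refine (aux _ _ (C * x ^ (1 / 2 + s)) fun y h0 h1 => (hG x y h0 h1 hxa).1).trans (le_of_eq ?_)
    ring
  · rw [greenDeriv]
    refine (aux _ _ (C * x ^ (-1 / 2 + s)) fun y h0 h1 => (hG x y h0 h1 hxa).2).trans
      (le_of_eq ?_)
    ring

theorem aestronglyMeasurable_applyGQ {m k : ℂ} {h₁ h₂ : ℝ → ℂ} {w : ℂ}
    (hp : IsFundamentalPair m k h₁ h₂ w) {Q f : ℝ → ℂ} {a : ℝ} (ha : 0 < a)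
    (hf : PairIntegrable h₁ h₂ Q f a) :
    AEStronglyMeasurable (applyGQ (forwardGreen h₁ h₂ w) Q f) (volume.restrict (Ioo 0 a)) := by
  have hprim : ∀ F : ℝ → ℂ, IntegrableOn F (Ioc 0 a) →
      ContinuousOn (fun x => ∫ y in (0 : ℝ)..x, F y) (Ioo 0 a) := by
    intro F hF
    have h := intervalIntegral.continuousOn_primitive_interval'
      ((intervalIntegrable_iff_integrableOn_Ioc_of_le ha.le).2 hF) left_mem_uIcc
    rw [uIcc_of_le ha.le] at h
    exact h.mono Ioo_subset_Icc_self
  have hc := (((hp.left.continuousOn.mono Ioo_subset_Ioi_self).mul (hprim _ hf.2)).sub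
    ((hp.right.continuousOn.mono Ioo_subset_Ioi_self).mul (hprim _ hf.1))).div_const w
  refine (hc.aestronglyMeasurable (μ := volume) measurableSet_Ioo).congr ?_
  filter_upwards [ae_mem_Ioo a] with x hx
  exact ((hf.mono hx.2.le).applyGQ_eq hx.1.le w).symm

/-- After multiplying the weight by a bounded factor `E ≥ 1` the operator `G Q` has norm at most
`1/2`. -/
theorem Admissible.exists_contraction_weight {m k : ℂ} {Q : ℝ → ℂ} {φ ω : ℝ → ℝ} {s : ℝ}
    (A : Admissible m k Q φ ω s) {h₁ h₂ : ℝ → ℂ} {w : ℂ} (hp : IsFundamentalPair m k h₁ h₂ w)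
    {a : ℝ} (ha : 0 < a) : ∃ (E : ℝ → ℝ) (K : ℝ),
      (∀ x ∈ Ioo 0 a, 1 ≤ E x ∧ E x ≤ K) ∧
      ∀ f M, 0 ≤ M → WBound a (fun x => φ x * E x) f M → ∀ x ∈ Ioo 0 a,
        ‖applyGQ (forwardGreen h₁ h₂ w) Q f x‖ ≤ M / 2 * (φ x * E x) := by
  obtain ⟨C, hC, hG⟩ := A.applyGQ_bound hp ha
  obtain ⟨C', hC', hφ⟩ := A.weight_lower a ha
  set ρ : ℝ → ℝ := fun y => C * C' * (ω y * ‖Q y‖) with hρdef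
  have hρ : IntegrableOn ρ (Ioc 0 a) := (A.majorant_int a ha).const_mul _
  have hρ0 : ∀ y, 0 < y → 0 ≤ ρ y := fun y hy =>
    mul_nonneg (by positivity) (mul_nonneg (A.majorant_nonneg y hy) (norm_nonneg _))
  have hρi : ∀ x, 0 ≤ x → x ≤ a → IntervalIntegrable ρ volume 0 x := fun x hx hxa =>
    (intervalIntegrable_iff_integrableOn_Ioc_of_le hx).2 (hρ.mono_set (Ioc_subset_Ioc_right hxa))
  set R : ℝ → ℝ := fun x => ∫ t in (0 : ℝ)..x, ρ t with hR
  have hRmono : ∀ x y, 0 ≤ x → x ≤ y → y ≤ a → R x ≤ R y := by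
    intro x y hx hxy hya
    refine intervalIntegral.integral_mono_interval le_rfl hx hxy ?_ (hρi y (hx.trans hxy) hya)
    filter_upwards [ae_restrict_mem measurableSet_Ioc] with t ht using hρ0 t ht.1
  have hR0 : R 0 = 0 := by simp [hR]
  have hRc : ContinuousOn R (Icc 0 a) := by
    have h := intervalIntegral.continuousOn_primitive_interval' (hρi a ha.le le_rfl) left_mem_uIcc
    rwa [uIcc_of_le ha.le] at h
  -- The exponent `2 R` is chosen so that `∫ ρ e^{2R} ≤ e^{2R}/2`, which is the factor `1/2`. As `R`
  -- is nondecreasing and finite at `a`, the new weight is equivalent to `φ`.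
  refine ⟨fun x => Real.exp (2 * R x), Real.exp (2 * R a),
    fun x hx => ⟨?_, ?_⟩, fun f M hM hf x hx => ?_⟩
  · have := hRmono 0 x le_rfl hx.1.le hx.2.le
    exact Real.one_le_exp (by linarith)
  · have := hRmono x a hx.1.le hx.2.le le_rfl
    exact Real.exp_le_exp.2 (by linarith)
  · have hwb : WBound a φ f (M * Real.exp (2 * R a)) := by
      refine ⟨hf.1, ?_⟩
      filter_upwards [hf.2, ae_mem_Ioo a] with y hy hy0
      refine hy.trans ?_
      have h1 := hRmono y a hy0.1.le hy0.2.le le_rfl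
      have h2 := A.weight_pos y hy0.1
      calc M * (φ y * Real.exp (2 * R y)) ≤ M * (φ y * Real.exp (2 * R a)) := by gcongr
        _ = _ := by ring
    have hpi := (A.pairIntegrable hp ha hwb).mono hx.2.le
    obtain ⟨e1, e2⟩ := integral_mul_exp_primitive_le (hρi x hx.1.le hx.2.le)
    have hωE : IntegrableOn (fun y => ω y * ‖Q y‖ * (M * Real.exp (2 * R y))) (Ioc 0 x) := by
      have h1 : IntegrableOn (fun y => ω y * ‖Q y‖) (Icc 0 x) :=
        (integrableOn_Icc_iff_integrableOn_Ioc).2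
          ((A.majorant_int a ha).mono_set (Ioc_subset_Ioc_right hx.2.le))
      refine (h1.mul_continuousOn (g' := fun y => M * Real.exp (2 * R y)) ?_
        isCompact_Icc).mono_set Ioc_subset_Icc_self
      exact continuousOn_const.mul ((continuousOn_const.mul
        (hRc.mono (Icc_subset_Icc_right hx.2.le))).rexp)
    have hb := (hG f (fun y => M * Real.exp (2 * R y)) x hx.1 hx.2.le hpi hωE (by
      have := ae_restrict_of_ae_restrict_of_subset (Ioo_subset_Ioo_right hx.2.le) hf.2
      filter_upwards [this] with y hy
      refine hy.trans (le_of_eq ?_)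
      ring)).1
    refine hb.trans ?_
    have hI0 : 0 ≤ ∫ y in (0 : ℝ)..x, ω y * ‖Q y‖ * (M * Real.exp (2 * R y)) := by
      rw [intervalIntegral.integral_of_le hx.1.le]
      refine setIntegral_nonneg measurableSet_Ioc fun y hy => ?_
      have := A.majorant_nonneg y hy.1
      positivity
    have hφx := A.weight_pos x hx.1
    calc C * x ^ (1 / 2 + s) * ∫ y in (0 : ℝ)..x, ω y * ‖Q y‖ * (M * Real.exp (2 * R y))
        ≤ C * (C' * φ x) * ∫ y in (0 : ℝ)..x, ω y * ‖Q y‖ * (M * Real.exp (2 * R y)) := by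
          gcongr
          exact hφ x hx.1 hx.2.le
      _ = M * φ x * ∫ y in (0 : ℝ)..x, ρ y * Real.exp (2 * R y) := by
          rw [show (fun y => ω y * ‖Q y‖ * (M * Real.exp (2 * R y))) =
            fun y => M * (ω y * ‖Q y‖ * Real.exp (2 * R y)) by ext y; ring,
            show (fun y => ρ y * Real.exp (2 * R y)) =
            fun y => (C * C') * (ω y * ‖Q y‖ * Real.exp (2 * R y)) by ext y; simp only [hρdef]; ring,
            intervalIntegral.integral_const_mul, intervalIntegral.integral_const_mul]
          ring
      _ ≤ M * φ x * (Real.exp (2 * R x) / 2) := by gcongr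
      _ = _ := by ring

theorem WBound.sub {a M N : ℝ} {φ : ℝ → ℝ} {f g : ℝ → ℂ} (hf : WBound a φ f M)
    (hg : WBound a φ g N) : WBound a φ (fun x => f x - g x) (M + N) := by
  refine ⟨hf.1.sub hg.1, ?_⟩
  filter_upwards [hf.2, hg.2] with x h1 h2
  exact (norm_sub_le _ _).trans (by linarith)

theorem WBound.mono {a b M : ℝ} {φ : ℝ → ℝ} {f : ℝ → ℂ} (hf : WBound a φ f M) (h : b ≤ a) :
    WBound b φ f M :=
  ⟨hf.1.mono_set (Ioo_subset_Ioo_right h),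
    ae_restrict_of_ae_restrict_of_subset (Ioo_subset_Ioo_right h) hf.2⟩

theorem WBound.of_weight_le {a M K : ℝ} {φ ψ : ℝ → ℝ} {f : ℝ → ℂ} (hM : 0 ≤ M)
    (hf : WBound a φ f M) (h : ∀ x ∈ Ioo 0 a, φ x ≤ K * ψ x) : WBound a ψ f (M * K) := by
  refine ⟨hf.1, ?_⟩
  filter_upwards [hf.2, ae_mem_Ioo a] with x hx hx0
  calc ‖f x‖ ≤ M * φ x := hx
    _ ≤ M * (K * ψ x) := by gcongr; exact h x hx0
    _ = _ := by ring

theorem WBound.abs {a M : ℝ} {φ : ℝ → ℝ} {f : ℝ → ℂ} (hφ : ∀ x, 0 < x → 0 < φ x)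
    (hf : WBound a φ f M) : WBound a φ f |M| := by
  refine ⟨hf.1, ?_⟩
  filter_upwards [hf.2, ae_mem_Ioo a] with x hx hx0
  have := hφ x hx0.1
  exact hx.trans (by gcongr; exact le_abs_self M)

theorem applyGQ_congr {h₁ h₂ : ℝ → ℂ} {w : ℂ} {Q f g : ℝ → ℂ} {x : ℝ}
    (h : ∀ y, 0 < y → y ≤ x → f y = g y) :
    applyGQ (forwardGreen h₁ h₂ w) Q f x = applyGQ (forwardGreen h₁ h₂ w) Q g x := by
  refine setIntegral_congr_fun measurableSet_Ioi fun y hy => ?_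
  by_cases hyx : y ≤ x
  · simp only [h y hy hyx]
  · simp [forwardGreen, hyx]

/-- The contraction estimate with `M = 0`. The conclusion holds at every `x`, which is how
identities valid almost everywhere are later made pointwise. -/
theorem Admissible.applyGQ_eq_zero {m k : ℂ} {Q : ℝ → ℂ} {φ ω : ℝ → ℝ} {s : ℝ}
    (A : Admissible m k Q φ ω s) {h₁ h₂ : ℝ → ℂ} {w : ℂ} (hp : IsFundamentalPair m k h₁ h₂ w)
    {a : ℝ} (ha : 0 < a) {d : ℝ → ℂ} (hd : ∀ᵐ x ∂(volume.restrict (Ioo 0 a)), d x = 0)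
    {x : ℝ} (hx : x ∈ Ioo 0 a) : applyGQ (forwardGreen h₁ h₂ w) Q d x = 0 := by
  obtain ⟨E, K, -, hT⟩ := A.exists_contraction_weight hp ha
  have hb : WBound a (fun x => φ x * E x) d 0 := by
    refine ⟨(aestronglyMeasurable_const (b := (0 : ℂ))).congr ?_, ?_⟩
    · filter_upwards [hd] with y hy using hy.symm
    · filter_upwards [hd] with y hy
      simp [hy]
  simpa using hT d 0 le_rfl hb x hx

/-- Since `d = -G Q d`, each application of the contraction estimate halves the bound on `d`, so `d`
is bounded by `|M| 2^{-n}` times the weight for every `n`. -/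
theorem Admissible.eq_zero_of_volterra {m k : ℂ} {Q : ℝ → ℂ} {φ ω : ℝ → ℝ} {s : ℝ}
    (A : Admissible m k Q φ ω s) {h₁ h₂ : ℝ → ℂ} {w : ℂ} (hp : IsFundamentalPair m k h₁ h₂ w)
    {a M : ℝ} (ha : 0 < a) {d : ℝ → ℂ} (hd : WBound a φ d M)
    (h : ∀ᵐ x ∂(volume.restrict (Ioo 0 a)), d x + applyGQ (forwardGreen h₁ h₂ w) Q d x = 0) :
    ∀ᵐ x ∂(volume.restrict (Ioo 0 a)), d x = 0 := by
  obtain ⟨E, K, hE, hT⟩ := A.exists_contraction_weight hp ha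
  have h0 : WBound a (fun x => φ x * E x) d |M| := by
    have := (hd.abs A.weight_pos).of_weight_le (K := 1) (ψ := fun x => φ x * E x) (abs_nonneg M)
      fun x hx => by
        have := A.weight_pos x hx.1
        have := (hE x hx).1
        nlinarith
    simpa using this
  have hn : ∀ n : ℕ, WBound a (fun x => φ x * E x) d (|M| / 2 ^ n) := by
    intro n
    induction n with
    | zero => simpa using h0
    | succ n ih =>
      refine ⟨hd.1, ?_⟩
      filter_upwards [h, ae_mem_Ioo a] with x hx hx0
      rw [eq_neg_of_add_eq_zero_left hx, norm_neg]
      refine (hT d _ (by positivity) ih x hx0).trans (le_of_eq ?_)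
      rw [pow_succ]
      field_simp
  filter_upwards [ae_all_iff.2 fun n => (hn n).2] with x hx
  have hlim : Tendsto (fun n : ℕ => |M| / 2 ^ n * (φ x * E x)) atTop (𝓝 (0 * (φ x * E x))) := by
    refine Tendsto.mul_const _ ?_
    have := (tendsto_pow_atTop_nhds_zero_of_lt_one (r := (1 / 2 : ℝ)) (by norm_num)
      (by norm_num)).const_mul |M|
    simp only [mul_zero] at this
    refine this.congr fun n => ?_
    rw [div_pow, one_pow]
    ring
  rw [zero_mul] at hlim
  exact norm_le_zero_iff.1 (ge_of_tendsto' hlim hx)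

/-- Picard iteration `S_{n+1} = f - G Q S_n` in the contraction weight. Successive differences are
at most `M 2^{-n} ψ`, so the iterates converge pointwise almost everywhere, and the contraction
estimate lets `G Q` pass to the limit. Returning to `φ` costs the factor `K`. -/
theorem Admissible.exists_volterra {m k : ℂ} {Q : ℝ → ℂ} {φ ω : ℝ → ℝ} {s : ℝ}
    (A : Admissible m k Q φ ω s) {h₁ h₂ : ℝ → ℂ} {w : ℂ} (hp : IsFundamentalPair m k h₁ h₂ w)
    {a : ℝ} (ha : 0 < a) : ∃ K : ℝ, 0 ≤ K ∧ ∀ f M, 0 ≤ M → WBound a φ f M →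
      ∃ g, WBound a φ g (M * K) ∧ ∀ᵐ x ∂(volume.restrict (Ioo 0 a)),
        g x + applyGQ (forwardGreen h₁ h₂ w) Q g x = f x := by
  obtain ⟨E, K, hE, hT⟩ := A.exists_contraction_weight hp ha
  have hK : 0 ≤ K := by
    have := hE (a / 2) ⟨by linarith, by linarith⟩
    linarith
  refine ⟨2 * K, by positivity, fun f M hM hf => ?_⟩
  set T : (ℝ → ℂ) → ℝ → ℂ := fun g => applyGQ (forwardGreen h₁ h₂ w) Q g with hTdef
  set ψ : ℝ → ℝ := fun x => φ x * E x with hψ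
  have toφ : ∀ g N, 0 ≤ N → WBound a ψ g N → WBound a φ g (N * K) := fun g N hN hg =>
    hg.of_weight_le hN fun x hx => by
      have := A.weight_pos x hx.1
      have := (hE x hx).2
      simp only [hψ]
      nlinarith
  have toψ : ∀ g N, 0 ≤ N → WBound a φ g N → WBound a ψ g N := fun g N hN hg => by
    have := hg.of_weight_le (K := 1) (ψ := ψ) hN fun x hx => by
        have := A.weight_pos x hx.1
        have := (hE x hx).1
        simp only [hψ]
        nlinarith
    simpa using this
  have hTm : ∀ g N, 0 ≤ N → WBound a ψ g N → WBound a ψ (T g) (N / 2) := by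
    intro g N hN hg
    refine ⟨aestronglyMeasurable_applyGQ hp ha (A.pairIntegrable hp ha (toφ g N hN hg)), ?_⟩
    filter_upwards [ae_mem_Ioo a] with x hx using hT g N hN hg x hx
  have hTsub : ∀ g₁ g₂ N₁ N₂, 0 ≤ N₁ → 0 ≤ N₂ → WBound a ψ g₁ N₁ → WBound a ψ g₂ N₂ →
      ∀ x ∈ Ioo 0 a, T (fun y => g₁ y - g₂ y) x = T g₁ x - T g₂ x := by
    intro g₁ g₂ N₁ N₂ hN₁ hN₂ hg₁ hg₂ x hx
    exact ((A.pairIntegrable hp ha (toφ _ _ hN₁ hg₁)).mono hx.2.le).applyGQ_sub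
      ((A.pairIntegrable hp ha (toφ _ _ hN₂ hg₂)).mono hx.2.le) w
  set S : ℕ → ℝ → ℂ := fun n => Nat.rec (fun _ => 0) (fun _ g x => f x - T g x) n with hS
  have hS0 : S 0 = fun _ => 0 := rfl
  have hSs : ∀ n, S (n + 1) = fun x => f x - T (S n) x := fun n => rfl
  have hfψ := toψ f M hM hf
  -- The constant `2M` reproduces itself: `M + (2M)/2 = 2M`.
  have hSb : ∀ n, WBound a ψ (S n) (2 * M) := by
    intro n
    induction n with
    | zero =>
      rw [hS0]
      refine ⟨aestronglyMeasurable_const, ?_⟩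
      filter_upwards [ae_mem_Ioo a] with x hx
      have := A.weight_pos x hx.1
      have := (hE x hx).1
      simp only [norm_zero, hψ]
      positivity
    | succ n ih =>
      rw [hSs]
      have := hfψ.sub (hTm _ _ (by positivity) ih)
      rwa [show M + 2 * M / 2 = 2 * M by ring] at this
  have hdiff : ∀ n : ℕ, WBound a ψ (fun x => S (n + 1) x - S n x) (M / 2 ^ n) := by
    intro n
    induction n with
    | zero =>
      have : (fun x => S (0 + 1) x - S 0 x) = fun x => f x - T (S 0) x := by
        ext x; rw [hSs, hS0]; simp
      rw [this]
      have hz : ∀ᵐ x ∂(volume.restrict (Ioo 0 a)), T (S 0) x = 0 := by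
        filter_upwards [ae_mem_Ioo a] with x hx
        exact A.applyGQ_eq_zero hp ha (Eventually.of_forall fun y => rfl) hx
      refine ⟨hfψ.1.congr ?_, ?_⟩
      · filter_upwards [hz] with x hx
        simp [hx]
      · filter_upwards [hz, hfψ.2] with x hx h2
        simpa [hx] using h2
    | succ n ih =>
      have h1 := hTm _ _ (by positivity) ih
      have h2 : ∀ᵐ x ∂(volume.restrict (Ioo 0 a)),
          -T (fun x => S (n + 1) x - S n x) x = S (n + 1 + 1) x - S (n + 1) x := by
        filter_upwards [ae_mem_Ioo a] with x hx
        rw [hTsub _ _ _ _ (by positivity) (by positivity) (hSb (n + 1)) (hSb n) x hx,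
          hSs (n + 1), hSs n]
        ring
      refine ⟨h1.1.neg.congr h2, ?_⟩
      filter_upwards [h1.2, h2] with x e1 e2
      rw [← e2, norm_neg]
      refine e1.trans (le_of_eq ?_)
      rw [pow_succ]
      field_simp
  have hdist : ∀ᵐ x ∂(volume.restrict (Ioo 0 a)),
      ∀ n, dist (S n x) (S (n + 1) x) ≤ 2 * (M * ψ x) / 2 / 2 ^ n := by
    filter_upwards [ae_all_iff.2 fun n => (hdiff n).2] with x hx n
    rw [dist_comm, dist_eq_norm]
    refine (hx n).trans (le_of_eq ?_)
    ring
  set g : ℝ → ℂ := fun x => limUnder atTop fun n => S n x with hg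
  have hlim : ∀ᵐ x ∂(volume.restrict (Ioo 0 a)), Tendsto (fun n => S n x) atTop (𝓝 (g x)) := by
    filter_upwards [hdist] with x hx
    exact tendsto_nhds_limUnder (cauchySeq_tendsto_of_complete (cauchySeq_of_le_geometric_two hx))
  have hgm : AEStronglyMeasurable g (volume.restrict (Ioo 0 a)) :=
    aestronglyMeasurable_of_tendsto_ae atTop (fun n => (hSb n).1) hlim
  have hgS : ∀ n : ℕ, WBound a ψ (fun x => S n x - g x) (2 * M / 2 ^ n) := by
    intro n
    refine ⟨(hSb n).1.sub hgm, ?_⟩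
    filter_upwards [hdist, hlim] with x h1 h2
    rw [← dist_eq_norm]
    refine (dist_le_of_le_geometric_two_of_tendsto h1 h2 n).trans (le_of_eq ?_)
    ring
  have hgb : WBound a ψ g (2 * M) := by
    refine ⟨hgm, ?_⟩
    filter_upwards [(hgS 0).2] with x hx
    simpa [hS0] using hx
  refine ⟨g, ?_, ?_⟩
  · have := toφ g _ (by positivity) hgb
    rwa [show 2 * M * K = M * (2 * K) by ring] at this
  · filter_upwards [hlim, ae_mem_Ioo a] with x hx hx0
    have h1 : Tendsto (fun n => T (S n) x) atTop (𝓝 (T g x)) := by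
      rw [tendsto_iff_norm_sub_tendsto_zero]
      have h2 : ∀ n : ℕ, ‖T (S n) x - T g x‖ ≤ M * ψ x * (1 / 2) ^ n := by
        intro n
        rw [← hTsub _ _ _ _ (by positivity) (by positivity) (hSb n) hgb x hx0]
        refine (hT _ _ (by positivity) (hgS n) x hx0).trans (le_of_eq ?_)
        rw [div_pow, one_pow]
        ring
      refine squeeze_zero (fun n => norm_nonneg _) h2 ?_
      simpa using (tendsto_pow_atTop_nhds_zero_of_lt_one (r := (1 / 2 : ℝ)) (by norm_num)
        (by norm_num)).const_mul (M * ψ x)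
    have h3 : Tendsto (fun n => S (n + 1) x) atTop (𝓝 (f x - T g x)) := by
      simp only [hSs]
      exact tendsto_const_nhds.sub h1
    have h4 := tendsto_nhds_unique ((tendsto_add_atTop_iff_nat 1).2 hx) h3
    rw [h4]
    ring

theorem Admissible.invertibleOn {m k : ℂ} {Q : ℝ → ℂ} {φ ω : ℝ → ℝ} {s : ℝ}
    (A : Admissible m k Q φ ω s) {h₁ h₂ : ℝ → ℂ} {w : ℂ} (hp : IsFundamentalPair m k h₁ h₂ w)
    {a : ℝ} (ha : 0 < a) : InvertibleOn (forwardGreen h₁ h₂ w) Q a φ := by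
  have hpi : ∀ f, MemW a φ f → PairIntegrable h₁ h₂ Q f a := fun f hf =>
    A.pairIntegrable hp ha (hf.wBound A.weight_pos A.weight_cont)
  refine ⟨fun f hf x hx => ((hpi f hf).mono hx.2.le).integrableOn_green w, ?_, ?_, ?_⟩
  · obtain ⟨E, K, hE, hT⟩ := A.exists_contraction_weight hp ha
    refine ⟨(K / 2).toNNReal, fun f hf => ?_⟩
    have hb := hf.wBound A.weight_pos A.weight_cont
    have hbψ : WBound a (fun x => φ x * E x) f (wNorm a φ f).toReal := by
      have := hb.of_weight_le (K := 1) (ψ := fun x => φ x * E x) ENNReal.toReal_nonneg fun x hx => by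
        have := A.weight_pos x hx.1
        have := (hE x hx).1
        nlinarith
      simpa using this
    have hTb : WBound a φ (applyGQ (forwardGreen h₁ h₂ w) Q f)
        (K / 2 * (wNorm a φ f).toReal) := by
      refine ⟨aestronglyMeasurable_applyGQ hp ha (hpi f hf), ?_⟩
      filter_upwards [ae_mem_Ioo a] with x hx
      refine (hT f _ ENNReal.toReal_nonneg hbψ x hx).trans ?_
      have h1 := A.weight_pos x hx.1
      have h2 := (hE x hx).2
      calc (wNorm a φ f).toReal / 2 * (φ x * E x) ≤ (wNorm a φ f).toReal / 2 * (φ x * K) := by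
            gcongr
        _ = _ := by ring
    refine ⟨hTb.memW A.weight_pos A.weight_cont, (hTb.wNorm_le A.weight_pos).trans (le_of_eq ?_)⟩
    rw [ENNReal.ofReal_mul' ENNReal.toReal_nonneg, ENNReal.ofReal_toReal (show wNorm a φ f ≠ ⊤ from hf.2.ne)]
    rfl
  · intro f g hf hg h
    have hd := (hf.wBound A.weight_pos A.weight_cont).sub (hg.wBound A.weight_pos A.weight_cont)
    have := A.eq_zero_of_volterra hp ha hd (by
      filter_upwards [h, ae_mem_Ioo a] with x hx hx0
      rw [((hpi f hf).mono hx0.2.le).applyGQ_sub ((hpi g hg).mono hx0.2.le)]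
      linear_combination hx)
    filter_upwards [this] with x hx using sub_eq_zero.1 hx
  · obtain ⟨K, hK, hex⟩ := A.exists_volterra hp ha
    refine ⟨K.toNNReal, fun f hf => ?_⟩
    obtain ⟨g, hg, hgf⟩ := hex f _ ENNReal.toReal_nonneg (hf.wBound A.weight_pos A.weight_cont)
    refine ⟨g, hg.memW A.weight_pos A.weight_cont, hgf,
      (hg.wNorm_le A.weight_pos).trans (le_of_eq ?_)⟩
    rw [mul_comm, ENNReal.ofReal_mul' ENNReal.toReal_nonneg, ENNReal.ofReal_toReal (show wNorm a φ f ≠ ⊤ from hf.2.ne)]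
    rfl

/-! ### Solutions with prescribed behaviour at the origin -/

/-- The forward Green's kernel does not depend on the fundamental pair. -/
theorem IsFundamentalPair.forwardGreen_eq {m k w w' : ℂ} {h₁ h₂ p₁ p₂ : ℝ → ℂ}
    (h : IsFundamentalPair m k h₁ h₂ w) (p : IsFundamentalPair m k p₁ p₂ w') {x y : ℝ}
    (hx : 0 < x) (hy : 0 < y) :
    (h₁ x * h₂ y - h₂ x * h₁ y) / w = (p₁ x * p₂ y - p₂ x * p₁ y) / w' ∧
    (deriv h₁ x * h₂ y - deriv h₂ x * h₁ y) / w =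
      (deriv p₁ x * p₂ y - deriv p₂ x * p₁ y) / w' := by
  have hw := h.2.2.1
  have hw' := p.2.2.1
  have e1 := p.left.wronskian_eq h.left hx hy
  have e2 := p.left.wronskian_eq h.right hx hy
  have e3 := p.right.wronskian_eq h.left hx hy
  have e4 := p.right.wronskian_eq h.right hx hy
  have wx := h.2.2.2 x hx
  have wy := h.2.2.2 y hy
  have px := p.2.2.2 x hx
  have py := p.2.2.2 y hy
  -- These Wronskians are constants; divided by `w` they are the coordinates of `p₁`, `p₂` in the
  -- basis `h₁`, `h₂`, the same at `x` and at `y`.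
  generalize ha : p₁ x * deriv h₂ x - deriv p₁ x * h₂ x = α₁ at e2
  generalize hb : p₁ x * deriv h₁ x - deriv p₁ x * h₁ x = β₁ at e1
  generalize ha' : p₂ x * deriv h₂ x - deriv p₂ x * h₂ x = α₂ at e4
  generalize hb' : p₂ x * deriv h₁ x - deriv p₂ x * h₁ x = β₂ at e3
  have r1 : w * p₁ x = α₁ * h₁ x - β₁ * h₂ x := by rw [← ha, ← hb, ← wx]; ring
  have r2 : w * p₂ x = α₂ * h₁ x - β₂ * h₂ x := by rw [← ha', ← hb', ← wx]; ring
  have d1 : w * deriv p₁ x = α₁ * deriv h₁ x - β₁ * deriv h₂ x := by rw [← ha, ← hb, ← wx]; ring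
  have d2 : w * deriv p₂ x = α₂ * deriv h₁ x - β₂ * deriv h₂ x := by
    rw [← ha', ← hb', ← wx]; ring
  have s1 : w * p₁ y = α₁ * h₁ y - β₁ * h₂ y := by rw [e2, e1, ← wy]; ring
  have s2 : w * p₂ y = α₂ * h₁ y - β₂ * h₂ y := by rw [e4, e3, ← wy]; ring
  -- The change of basis has determinant `w'/w`. The antisymmetric numerator of the kernel scales by
  -- the same factor, so the quotient is invariant.
  have det : w * w' = -α₁ * β₂ + β₁ * α₂ := by
    have : w * (w * w') = w * (-α₁ * β₂ + β₁ * α₂) := by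
      calc w * (w * w') = (w * p₁ x) * (w * deriv p₂ x) - (w * deriv p₁ x) * (w * p₂ x) := by
            rw [← px]; ring
        _ = (-α₁ * β₂ + β₁ * α₂) * (h₁ x * deriv h₂ x - deriv h₁ x * h₂ x) := by
            rw [r1, r2, d1, d2]; ring
        _ = _ := by rw [wx]; ring
    exact mul_left_cancel₀ hw this
  constructor
  · rw [div_eq_div_iff hw hw']
    refine mul_left_cancel₀ hw ?_
    calc w * ((h₁ x * h₂ y - h₂ x * h₁ y) * w') = (w * w') * (h₁ x * h₂ y - h₂ x * h₁ y) := by ring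
      _ = (w * p₁ x) * (w * p₂ y) - (w * p₂ x) * (w * p₁ y) := by
        rw [det, r1, r2, s1, s2]; ring
      _ = _ := by ring
  · rw [div_eq_div_iff hw hw']
    refine mul_left_cancel₀ hw ?_
    calc w * ((deriv h₁ x * h₂ y - deriv h₂ x * h₁ y) * w') =
          (w * w') * (deriv h₁ x * h₂ y - deriv h₂ x * h₁ y) := by ring
      _ = (w * deriv p₁ x) * (w * p₂ y) - (w * deriv p₂ x) * (w * p₁ y) := by
        rw [det, d1, d2, s1, s2]; ring
      _ = _ := by ring

theorem IsFundamentalPair.applyGQ_eq {m k w w' : ℂ} {h₁ h₂ p₁ p₂ : ℝ → ℂ}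
    (h : IsFundamentalPair m k h₁ h₂ w) (p : IsFundamentalPair m k p₁ p₂ w') (Q f : ℝ → ℂ)
    {x : ℝ} (hx : 0 < x) :
    applyGQ (forwardGreen h₁ h₂ w) Q f x = applyGQ (forwardGreen p₁ p₂ w') Q f x := by
  refine setIntegral_congr_fun measurableSet_Ioi fun y hy => ?_
  simp only [forwardGreen, (h.forwardGreen_eq p hx hy).1]

theorem AC1.sub {f g : ℝ → ℂ} (hf : AC1 f) (hg : AC1 g) : AC1 (fun x => f x - g x) := by
  refine ⟨fun x hx => (hf.1 x hx).sub (hg.1 x hx), fun a b ha hb => ?_⟩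
  refine ((hf.2 a b ha hb).fun_sub (hg.2 a b ha hb)).congr_on fun x hx => ?_
  have h0 := uIcc_pos ha hb hx
  exact deriv_fun_sub (hf.1 x h0) (hg.1 x h0)

theorem IsEigensolution.sub {m k : ℂ} {Q f g : ℝ → ℂ} (hf : IsEigensolution m k Q f)
    (hg : IsEigensolution m k Q g) : IsEigensolution m k Q (fun x => f x - g x) := by
  refine ⟨hf.1.sub hg.1, ?_⟩
  have h1 := ae_pos_of_forall_uIcc fun a b ha hb => hf.1.ae_hasDerivAt_deriv (a := a) (b := b) ha hb
  have h2 := ae_pos_of_forall_uIcc fun a b ha hb => hg.1.ae_hasDerivAt_deriv (a := a) (b := b) ha hb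
  have h3 := (ae_restrict_iff' measurableSet_Ioi).1 hf.2
  have h4 := (ae_restrict_iff' measurableSet_Ioi).1 hg.2
  refine (ae_restrict_iff' measurableSet_Ioi).2 ?_
  filter_upwards [h1, h2, h3, h4] with x e1 e2 e3 e4 hx
  have hev : deriv (fun x => f x - g x) =ᶠ[𝓝 x] fun x => deriv f x - deriv g x := by
    filter_upwards [Ioi_mem_nhds hx] with y hy
    exact deriv_fun_sub (hf.1.1 y hy) (hg.1.1 y hy)
  rw [(((e1 hx).fun_sub (e2 hx)).congr_of_eventuallyEq hev).deriv]
  linear_combination e3 hx - e4 hx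

theorem isLittleO_of_norm_le_mul {f : ℝ → ℂ} {p C : ℝ} {η : ℝ → ℝ}
    (hη : Tendsto η (𝓝[>] 0) (𝓝 0))
    (h : ∀ᶠ x in 𝓝[>] (0 : ℝ), ‖f x‖ ≤ C * x ^ p * η x) :
    f =o[𝓝[>] (0 : ℝ)] fun x => x ^ p := by
  have h1 : f =O[𝓝[>] (0 : ℝ)] fun x => η x * x ^ p := by
    refine IsBigO.of_bound |C| ?_
    filter_upwards [h] with x hx
    refine hx.trans ((le_abs_self _).trans (le_of_eq ?_))
    rw [Real.norm_eq_abs, abs_mul, abs_mul, abs_mul]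
    ring
  refine h1.trans_isLittleO ?_
  have h2 : η =o[𝓝[>] (0 : ℝ)] fun _ => (1 : ℝ) := (isLittleO_one_iff ℝ).2 hη
  simpa using h2.mul_isBigO (isBigO_refl (fun x : ℝ => x ^ p) (𝓝[>] (0 : ℝ)))

theorem rpow_isBigO_rpow {p q : ℝ} (h : p ≤ q) :
    (fun x : ℝ => x ^ q) =O[𝓝[>] (0 : ℝ)] fun x => x ^ p := by
  refine IsBigO.of_bound 1 ?_
  filter_upwards [Ioo_mem_nhdsGT (zero_lt_one (α := ℝ))] with x hx
  rw [one_mul, Real.norm_of_nonneg (Real.rpow_nonneg hx.1.le _),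
    Real.norm_of_nonneg (Real.rpow_nonneg hx.1.le _)]
  exact Real.rpow_le_rpow_of_exponent_ge hx.1 hx.2.le h

/-- The bound on `G Q f` carries the factor `∫₀ˣ ω |Q|`, which tends to `0` with `x`: this improves
`O` to `o`. -/
theorem Admissible.applyGQ_isLittleO {m k : ℂ} {Q : ℝ → ℂ} {φ ω : ℝ → ℝ} {s : ℝ}
    (A : Admissible m k Q φ ω s) {h₁ h₂ : ℝ → ℂ} {w : ℂ} (hp : IsFundamentalPair m k h₁ h₂ w)
    {f : ℝ → ℂ} {M : ℝ} (hf : WBound 1 φ f M) :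
    (applyGQ (forwardGreen h₁ h₂ w) Q f =o[𝓝[>] (0 : ℝ)] fun x => x ^ (1 / 2 + s)) ∧
    (greenDeriv h₁ h₂ w Q f =o[𝓝[>] (0 : ℝ)] fun x => x ^ (-1 / 2 + s)) := by
  obtain ⟨C, hC, hG⟩ := A.applyGQ_bound hp one_pos
  have hI : IntegrableOn (fun y => ω y * ‖Q y‖ * M) (Ioc 0 1) :=
    (A.majorant_int 1 one_pos).mul_const M
  have hη : Tendsto (fun x => ∫ y in (0 : ℝ)..x, ω y * ‖Q y‖ * M) (𝓝[>] 0) (𝓝 0) := by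
    have h := intervalIntegral.continuousOn_primitive_interval'
      ((intervalIntegrable_iff_integrableOn_Ioc_of_le zero_le_one).2 hI) left_mem_uIcc
    rw [uIcc_of_le zero_le_one] at h
    have h0 := h 0 (left_mem_Icc.2 zero_le_one)
    rw [ContinuousWithinAt, intervalIntegral.integral_same] at h0
    refine h0.mono_left ?_
    rw [← nhdsWithin_Ioo_eq_nhdsGT (zero_lt_one (α := ℝ))]
    exact nhdsWithin_mono _ Ioo_subset_Icc_self
  have key := fun (x : ℝ) (hx : x ∈ Ioo (0 : ℝ) 1) =>
    hG f (fun _ => M) x hx.1 hx.2.le ((A.pairIntegrable hp one_pos hf).mono hx.2.le)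
      (hI.mono_set (Ioc_subset_Ioc_right hx.2.le)) (hf.mono hx.2.le).2
  have hev := Ioo_mem_nhdsGT (zero_lt_one (α := ℝ))
  exact ⟨isLittleO_of_norm_le_mul hη (by filter_upwards [hev] with x hx using (key x hx).1),
    isLittleO_of_norm_le_mul hη (by filter_upwards [hev] with x hx using (key x hx).2)⟩

/-- A global solution of the Volterra equation. -/
theorem Admissible.exists_global_volterra {m k : ℂ} {Q : ℝ → ℂ} {φ ω : ℝ → ℝ} {s : ℝ}
    (A : Admissible m k Q φ ω s) {h₁ h₂ : ℝ → ℂ} {w : ℂ} (hp : IsFundamentalPair m k h₁ h₂ w)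
    {g0 : ℝ → ℂ} (hg0 : ∀ a, 0 < a → ∃ M, 0 ≤ M ∧ WBound a φ g0 M) :
    ∃ u : ℝ → ℂ, (∀ a, 0 < a → ∃ M, WBound a φ u M) ∧
      ∀ x, 0 < x → u x + applyGQ (forwardGreen h₁ h₂ w) Q u x = g0 x := by
  have loc : ∀ a, 0 < a → ∃ v : ℝ → ℂ, (∃ M, WBound a φ v M) ∧
      ∀ x ∈ Ioo 0 a, v x + applyGQ (forwardGreen h₁ h₂ w) Q v x = g0 x := by
    intro a ha
    obtain ⟨K, hK, hex⟩ := A.exists_volterra hp ha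
    obtain ⟨M, hM, hb⟩ := hg0 a ha
    obtain ⟨g, hg, hge⟩ := hex g0 M hM hb
    -- `g` solves the equation only almost everywhere. The representative `v` solves it at every
    -- point, because `G Q v = G Q g` everywhere.
    set v : ℝ → ℂ := fun x => g0 x - applyGQ (forwardGreen h₁ h₂ w) Q g x with hv
    have hgv : ∀ᵐ x ∂(volume.restrict (Ioo 0 a)), g x = v x := by
      filter_upwards [hge] with x hx
      rw [hv]
      simp only
      rw [← hx]
      ring
    have hvb : WBound a φ v (M * K) := by
      refine ⟨hg.1.congr hgv, ?_⟩
      filter_upwards [hg.2, hgv] with x h1 h2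
      rwa [← h2]
    refine ⟨v, ⟨_, hvb⟩, fun x hx => ?_⟩
    have h0 := A.applyGQ_eq_zero hp ha (d := fun y => v y - g y) (by
      filter_upwards [hgv] with y hy
      rw [hy, sub_self]) hx
    rw [((A.pairIntegrable hp ha hvb).mono hx.2.le).applyGQ_sub
      ((A.pairIntegrable hp ha hg).mono hx.2.le)] at h0
    rw [sub_eq_zero.1 h0, hv]
    ring
  choose! v hvb hve using loc
  have huniq : ∀ a b x, 0 < a → a ≤ b → x ∈ Ioo 0 a → v a x = v b x := by
    intro a b x ha hab hx
    have hb := ha.trans_le hab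
    obtain ⟨M, hM⟩ := hvb a ha
    obtain ⟨N, hN⟩ := hvb b hb
    have hN' := hN.mono hab
    have hlin : ∀ y ∈ Ioo 0 a, (v a y - v b y) +
        applyGQ (forwardGreen h₁ h₂ w) Q (fun y => v a y - v b y) y = 0 := by
      intro y hy
      rw [((A.pairIntegrable hp ha hM).mono hy.2.le).applyGQ_sub
        ((A.pairIntegrable hp ha hN').mono hy.2.le)]
      linear_combination hve a ha y hy - hve b hb y ⟨hy.1, hy.2.trans_le hab⟩
    have h0 := A.eq_zero_of_volterra hp ha (hM.sub hN') (by
      filter_upwards [ae_mem_Ioo a] with y hy using hlin y hy)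
    have h1 := A.applyGQ_eq_zero hp ha h0 hx
    have h2 := hlin x hx
    rw [h1, add_zero] at h2
    exact sub_eq_zero.1 h2
  -- The local solutions agree on overlaps, so the value at `x` may be read off from any interval
  -- containing `x`; `]0, x+1[` is one.
  set u : ℝ → ℂ := fun x => v (x + 1) x with hu
  have huv : ∀ a x, 0 < a → x ∈ Ioo 0 a → u x = v a x := by
    intro a x ha hx
    rcases le_total (x + 1) a with h | h
    · exact huniq (x + 1) a x (by linarith [hx.1]) h ⟨hx.1, by linarith⟩
    · exact (huniq a (x + 1) x ha h hx).symm
  refine ⟨u, fun a ha => ?_, fun x hx => ?_⟩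
  · obtain ⟨M, hM⟩ := hvb a ha
    refine ⟨M, hM.1.congr ?_, ?_⟩
    · filter_upwards [ae_mem_Ioo a] with x hx using (huv a x ha hx).symm
    · filter_upwards [ae_mem_Ioo a, hM.2] with x hx h2
      rwa [huv a x ha hx]
  · have hx1 : (0 : ℝ) < x + 1 := by linarith
    rw [applyGQ_congr (g := v (x + 1)) fun y h0 h1 => huv (x + 1) y hx1 ⟨h0, by linarith⟩]
    exact hve (x + 1) hx1 x ⟨hx, by linarith⟩

theorem wBound_of_continuousOn_of_isLittleO {φ : ℝ → ℝ} {d : ℝ → ℂ} {p : ℝ}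
    (hφ : ∀ x, 0 < x → 0 < φ x) (hφc : ContinuousOn φ (Ioi 0)) (hd : ContinuousOn d (Ioi 0))
    (hp : ∀ a, 0 < a → ∃ C : ℝ, 0 ≤ C ∧ ∀ x, 0 < x → x ≤ a → x ^ p ≤ C * φ x)
    (ho : d =o[𝓝[>] (0 : ℝ)] fun x => x ^ p) {a : ℝ} (ha : 0 < a) : ∃ M, WBound a φ d M := by
  obtain ⟨C, hC, hCb⟩ := hp a ha
  have h1 := ho.def one_pos
  rw [eventually_nhdsWithin_iff, Metric.eventually_nhds_iff] at h1
  obtain ⟨δ, hδ, h1⟩ := h1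
  have hs : Icc (δ / 2) a ⊆ Ioi 0 := fun x hx => lt_of_lt_of_le (by positivity) hx.1
  obtain ⟨N, hN⟩ := isCompact_Icc.exists_bound_of_continuousOn
    ((hd.mono hs).div (Complex.continuous_ofReal.comp_continuousOn (hφc.mono hs))
      fun x hx => Complex.ofReal_ne_zero.2 (hφ x (hs hx)).ne')
  refine ⟨max C N, (hd.mono Ioo_subset_Ioi_self).aestronglyMeasurable measurableSet_Ioo, ?_⟩
  filter_upwards [ae_mem_Ioo a] with x hx
  have hφx := hφ x hx.1
  rcases lt_or_ge x δ with h | h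
  · have h2 := h1 (y := x) (by rw [Real.dist_eq, sub_zero, abs_of_pos hx.1]; exact h) hx.1
    rw [one_mul, Real.norm_of_nonneg (Real.rpow_nonneg hx.1.le _)] at h2
    refine (h2.trans (hCb x hx.1 hx.2.le)).trans ?_
    gcongr
    exact le_max_left _ _
  · have h2 := hN x ⟨by linarith, hx.2.le⟩
    simp only [Pi.div_apply, Function.comp_apply] at h2
    rw [norm_div, Complex.norm_real, Real.norm_of_nonneg hφx.le, div_le_iff₀ hφx] at h2
    refine h2.trans ?_
    gcongr
    exact le_max_right _ _

/-- The perturbation of an unperturbed solution `g⁰`, and its characterization by the behaviour at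
the origin. -/
theorem Admissible.exists_unique_approximation {m k : ℂ} {Q : ℝ → ℂ} {φ ω : ℝ → ℝ} {s r : ℝ}
    (A : Admissible m k Q φ ω s) (hrs : r ≤ s)
    (hφr : ∀ a, 0 < a → ∃ C : ℝ, 0 ≤ C ∧ ∀ x, 0 < x → x ≤ a → x ^ (1 / 2 + r) ≤ C * φ x)
    (hpair : ∃ h₁ h₂ w, IsFundamentalPair m k h₁ h₂ w)
    (hzero : ∀ e e' : ℝ → ℂ, IsFreeSolution m k e e' →
      (e =o[𝓝[>] (0 : ℝ)] fun x => x ^ (1 / 2 + r)) →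
      (e' =o[𝓝[>] (0 : ℝ)] fun x => x ^ (-1 / 2 + r)) → ∀ x, 0 < x → e x = 0)
    {g0 g0' : ℝ → ℂ} (hg0 : IsFreeSolution m k g0 g0')
    (hb : ∀ a, 0 < a → ∃ C : ℝ, 0 ≤ C ∧ ∀ x, 0 < x → x ≤ a → ‖g0 x‖ ≤ C * φ x) :
    ∃ u : ℝ → ℂ, IsInverseImage m k Q φ g0 u ∧ IsUniqueApproximation m k Q g0 s u ∧
      IsUniqueApproximation m k Q g0 r u := by
  have hg0b : ∀ a, 0 < a → ∃ M, 0 ≤ M ∧ WBound a φ g0 M := by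
    intro a ha
    obtain ⟨C, hC, hCb⟩ := hb a ha
    refine ⟨C, hC, (hg0.continuousOn.mono Ioo_subset_Ioi_self).aestronglyMeasurable
      measurableSet_Ioo, ?_⟩
    filter_upwards [ae_mem_Ioo a] with x hx using hCb x hx.1 hx.2.le
  obtain ⟨h₁, h₂, w, hp⟩ := id hpair
  obtain ⟨u, hub, hue⟩ := A.exists_global_volterra hp hg0b
  have hupi : ∀ a, 0 < a → PairIntegrable h₁ h₂ Q u a := fun a ha => by
    obtain ⟨M, hM⟩ := hub a ha
    exact A.pairIntegrable hp ha hM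
  obtain ⟨husol, hud⟩ := isEigensolution_of_volterra hp hg0 hupi hue
  have hmono : ∀ f, ApproximatesAtZero m k Q g0 s f → ApproximatesAtZero m k Q g0 r f :=
    fun f hf => ⟨hf.1, hf.2.1.trans_isBigO (rpow_isBigO_rpow (by linarith)),
      hf.2.2.trans_isBigO (rpow_isBigO_rpow (by linarith))⟩
  have hus : ApproximatesAtZero m k Q g0 s u := by
    obtain ⟨M, hM⟩ := hub 1 one_pos
    obtain ⟨o1, o2⟩ := A.applyGQ_isLittleO hp hM
    refine ⟨husol, o1.neg_left.congr' ?_ EventuallyEq.rfl, o2.neg_left.congr' ?_ EventuallyEq.rfl⟩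
    · filter_upwards [self_mem_nhdsWithin] with x hx
      rw [← hue x hx]
      ring
    · filter_upwards [self_mem_nhdsWithin] with x hx
      rw [hud x hx, hg0.deriv_eq hx]
      ring
  have hur := hmono u hus
  -- For `d = f - u`, both `d` and `G Q d` are negligible to order `r`, hence so is the unperturbed
  -- solution `d + G Q d = c₁ h₁ + c₂ h₂`. It vanishes by `hzero`, and injectivity of `1 + G Q`
  -- gives `d = 0`.
  have huniq : ∀ f, ApproximatesAtZero m k Q g0 r f → EqOn f u (Ioi 0) := by
    intro f hf
    have hd := hf.1.sub husol
    have od : (fun x => f x - u x) =o[𝓝[>] (0 : ℝ)] fun x => x ^ (1 / 2 + r) :=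
      (hf.2.1.sub hur.2.1).congr_left fun x => by ring
    have od' : (deriv fun x => f x - u x) =o[𝓝[>] (0 : ℝ)] fun x => x ^ (-1 / 2 + r) := by
      refine (hf.2.2.sub hur.2.2).congr' ?_ EventuallyEq.rfl
      filter_upwards [self_mem_nhdsWithin] with x hx
      rw [deriv_fun_sub (hf.1.1.1 x hx) (husol.1.1 x hx)]
      ring
    have hdb : ∀ a, 0 < a → ∃ M, WBound a φ (fun x => f x - u x) M := fun a ha =>
      wBound_of_continuousOn_of_isLittleO A.weight_pos A.weight_cont hd.1.continuousOn hφr od ha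
    obtain ⟨c₁, c₂, hc⟩ := volterra_of_isEigensolution hp hd fun a ha => by
      obtain ⟨M, hM⟩ := hdb a ha
      exact A.pairIntegrable hp ha hM
    obtain ⟨M, hM⟩ := hdb 1 one_pos
    obtain ⟨o1, o2⟩ := A.applyGQ_isLittleO hp hM
    have he := hzero (fun x => c₁ * h₁ x + c₂ * h₂ x)
      (fun x => c₁ * deriv h₁ x + c₂ * deriv h₂ x)
      (fun x hx => ⟨((hp.left x hx).1.const_mul c₁).fun_add ((hp.right x hx).1.const_mul c₂),
        (((hp.left x hx).2.const_mul c₁).fun_add ((hp.right x hx).2.const_mul c₂)).congr_deriv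
          (by ring)⟩)
      ((od.add (o1.trans_isBigO (rpow_isBigO_rpow (by linarith)))).congr' (by
        filter_upwards [self_mem_nhdsWithin] with x hx using (hc x hx).1) EventuallyEq.rfl)
      ((od'.add (o2.trans_isBigO (rpow_isBigO_rpow (by linarith)))).congr' (by
        filter_upwards [self_mem_nhdsWithin] with x hx using (hc x hx).2) EventuallyEq.rfl)
    intro x hx
    have hx : 0 < x := hx
    have hx1 : 0 < x + 1 := by linarith
    obtain ⟨N, hN⟩ := hdb (x + 1) hx1
    have hv : ∀ y, 0 < y → (f y - u y) +
        applyGQ (forwardGreen h₁ h₂ w) Q (fun x => f x - u x) y = 0 := fun y hy =>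
      (hc y hy).1.trans (he y hy)
    have h0 := A.eq_zero_of_volterra hp hx1 hN (by
      filter_upwards [ae_mem_Ioo (x + 1)] with y hy using hv y hy.1)
    have h2 := hv x hx
    rw [A.applyGQ_eq_zero hp hx1 h0 ⟨hx, by linarith⟩, add_zero] at h2
    exact sub_eq_zero.1 h2
  refine ⟨u, ⟨hpair, fun p₁ p₂ w' hp' a ha => ⟨A.invertibleOn hp' ha, ?_, ?_, ?_⟩⟩,
    ⟨hus, fun f hf => huniq f (hmono f hf)⟩, hur, huniq⟩
  · obtain ⟨M, -, hM⟩ := hg0b a ha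
    exact hM.memW A.weight_pos A.weight_cont
  · obtain ⟨M, hM⟩ := hub a ha
    exact hM.memW A.weight_pos A.weight_cont
  · intro x hx
    rw [hp'.applyGQ_eq hp Q u hx.1]
    exact hue x hx.1

/-! ### Entire power series -/

/-- Coefficients bounded by those of an exponential. -/
def ExpBounded (c : ℕ → ℂ) : Prop :=
  ∃ M B : ℝ, 0 ≤ M ∧ 0 ≤ B ∧ ∀ n : ℕ, ‖c n‖ ≤ M * (B ^ n / n.factorial)

/-- The power series with coefficients `c`, on the real line. -/
def pser (c : ℕ → ℂ) (t : ℝ) : ℂ := ∑' n : ℕ, c n * (t : ℂ) ^ n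

/-- The coefficients of the derivative of a power series. -/
def coeffDeriv (c : ℕ → ℂ) (n : ℕ) : ℂ := (n + 1) * c (n + 1)

theorem ExpBounded.coeffDeriv {c : ℕ → ℂ} (h : ExpBounded c) : ExpBounded (coeffDeriv c) := by
  obtain ⟨M, B, hM, hB, hc⟩ := h
  refine ⟨M * B, B, by positivity, hB, fun n => ?_⟩
  rw [PerturbedBessel.coeffDeriv, norm_mul]
  have h1 : ‖(n : ℂ) + 1‖ = n + 1 := by
    have : ((n : ℂ) + 1) = ((n + 1 : ℕ) : ℂ) := by push_cast; ring
    rw [this, Complex.norm_natCast]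
    push_cast; ring
  rw [h1]
  calc ((n : ℝ) + 1) * ‖c (n + 1)‖ ≤ ((n : ℝ) + 1) * (M * (B ^ (n + 1) / (n + 1).factorial)) := by
        gcongr
        exact hc (n + 1)
    _ = _ := by
        rw [Nat.factorial_succ, pow_succ]
        push_cast
        have : (0 : ℝ) < n.factorial := by exact_mod_cast n.factorial_pos
        field_simp

theorem ExpBounded.summable_norm {c : ℕ → ℂ} (h : ExpBounded c) (R : ℝ) (hR : 0 ≤ R) :
    Summable fun n => ‖c n‖ * R ^ n := by
  obtain ⟨M, B, hM, hB, hc⟩ := h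
  refine Summable.of_nonneg_of_le (fun n => by positivity) (fun n => ?_)
    ((Real.summable_pow_div_factorial (B * R)).mul_left M)
  calc ‖c n‖ * R ^ n ≤ M * (B ^ n / n.factorial) * R ^ n := by
        gcongr
        exact hc n
    _ = _ := by rw [mul_pow]; ring

theorem ExpBounded.hasSum {c : ℕ → ℂ} (h : ExpBounded c) (t : ℝ) :
    HasSum (fun n => c n * (t : ℂ) ^ n) (pser c t) := by
  refine Summable.hasSum (Summable.of_norm ?_)
  refine (h.summable_norm |t| (abs_nonneg t)).congr fun n => ?_
  rw [norm_mul, norm_pow, Complex.norm_real, Real.norm_eq_abs]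

theorem ExpBounded.hasDerivAt {c : ℕ → ℂ} (h : ExpBounded c) (t : ℝ) :
    HasDerivAt (pser c) (pser (PerturbedBessel.coeffDeriv c) t) t := by
  -- A ball containing `t` on which the termwise derivatives have the summable majorant `u`.
  set R := |t| + 1 with hR
  have hR0 : 0 ≤ R := by positivity
  set u : ℕ → ℝ := fun n => ‖c n‖ * (n * R ^ (n - 1)) with hu
  have hus : Summable u := by
    refine (summable_nat_add_iff 1).1 ((h.coeffDeriv.summable_norm R hR0).congr fun n => ?_)
    simp only [hu, PerturbedBessel.coeffDeriv, Nat.add_sub_cancel]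
    have : ((n : ℂ) + 1) = ((n + 1 : ℕ) : ℂ) := by push_cast; ring
    rw [norm_mul, this, Complex.norm_natCast]
    ring
  have hd : ∀ (n : ℕ) (y : ℝ), y ∈ Metric.ball (0 : ℝ) R →
      HasDerivAt (fun y : ℝ => c n * (y : ℂ) ^ n) (c n * (n * (y : ℂ) ^ (n - 1))) y := by
    intro n y _
    exact ((hasDerivAt_pow n (y : ℂ)).comp_ofReal).const_mul (c n)
  have hb : ∀ (n : ℕ) (y : ℝ), y ∈ Metric.ball (0 : ℝ) R →
      ‖c n * (n * (y : ℂ) ^ (n - 1))‖ ≤ u n := by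
    intro n y hy
    rw [mem_ball_zero_iff, Real.norm_eq_abs] at hy
    simp only [norm_mul, norm_pow, Complex.norm_real, Complex.norm_natCast, Real.norm_eq_abs, hu]
    gcongr
  have ht : t ∈ Metric.ball (0 : ℝ) R := by
    rw [mem_ball_zero_iff, Real.norm_eq_abs]
    linarith
  have key := hasDerivAt_tsum_of_isPreconnected hus Metric.isOpen_ball
    (convex_ball (0 : ℝ) R).isPreconnected hd hb ht (h.hasSum t).summable ht
  refine key.congr_deriv ?_
  have hsum : Summable fun n : ℕ => c n * (n * (t : ℂ) ^ (n - 1)) :=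
    Summable.of_norm_bounded hus fun n => hb n t ht
  rw [hsum.tsum_eq_zero_add]
  simp only [Nat.cast_zero, zero_mul, mul_zero, zero_add, Nat.add_sub_cancel, pser,
    PerturbedBessel.coeffDeriv]
  refine tsum_congr fun n => ?_
  push_cast
  ring

theorem ExpBounded.hasSum_mul_deriv {c : ℕ → ℂ} (h : ExpBounded c) (t : ℝ) :
    HasSum (fun n : ℕ => n * c n * (t : ℂ) ^ n)
      ((t : ℂ) * pser (PerturbedBessel.coeffDeriv c) t) := by
  have h1 := (h.coeffDeriv.hasSum t).mul_left (t : ℂ)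
  have h2 : HasSum (fun n : ℕ => ((n + 1 : ℕ) : ℂ) * c (n + 1) * (t : ℂ) ^ (n + 1))
      ((t : ℂ) * pser (PerturbedBessel.coeffDeriv c) t) := by
    refine h1.congr_fun fun n => ?_
    rw [PerturbedBessel.coeffDeriv, pow_succ]
    push_cast
    ring
  have h3 := (hasSum_nat_add_iff (f := fun n : ℕ => n * c n * (t : ℂ) ^ n) 1).1 h2
  simpa using h3

/-- The second-order operator `t ∂² + α ∂` applied to a power series. -/
theorem ExpBounded.ode {c d : ℕ → ℂ} (h : ExpBounded c) (α : ℂ)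
    (hd : ∀ n : ℕ, (n + α) * ((n + 1) * c (n + 1)) = d n) (t : ℝ) :
    (t : ℂ) * pser (PerturbedBessel.coeffDeriv (PerturbedBessel.coeffDeriv c)) t +
      α * pser (PerturbedBessel.coeffDeriv c) t = pser d t := by
  have h1 := (h.coeffDeriv.hasSum_mul_deriv t).add ((h.coeffDeriv.hasSum t).mul_left α)
  refine h1.tsum_eq.symm.trans (tsum_congr fun n => ?_)
  rw [← hd n, PerturbedBessel.coeffDeriv]
  ring

theorem ExpBounded.continuous {c : ℕ → ℂ} (h : ExpBounded c) : Continuous (pser c) :=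
  continuous_iff_continuousAt.2 fun t => (h.hasDerivAt t).continuousAt

theorem pser_zero (c : ℕ → ℂ) : pser c 0 = c 0 := by
  rw [pser, tsum_eq_single 0]
  · simp
  · intro n hn
    simp [hn]

/-- Bounds on compact intervals for a continuous function composed with the square. -/
theorem exists_bound_sq {A : ℝ → ℂ} (hA : Continuous A) (a : ℝ) :
    ∃ C : ℝ, 0 ≤ C ∧ ∀ x, 0 < x → x ≤ a → ‖A (x ^ 2)‖ ≤ C := by
  obtain ⟨C, hC⟩ := (isCompact_Icc (a := (0 : ℝ)) (b := a)).exists_bound_of_continuousOn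
    (hA.comp (continuous_pow 2)).continuousOn
  refine ⟨|C|, abs_nonneg C, fun x hx hxa => (hC x ⟨hx.le, hxa⟩).trans (le_abs_self C)⟩

/-! ### Reduction of the unperturbed equation -/

theorem hasDerivAt_cpow_real (s : ℂ) {x : ℝ} (hx : 0 < x) :
    HasDerivAt (fun x : ℝ => (x : ℂ) ^ s) (s / x * (x : ℂ) ^ s) x := by
  have hx' : (x : ℂ) ≠ 0 := Complex.ofReal_ne_zero.2 hx.ne'
  have h := (((hasDerivAt_id (x : ℂ)).cpow_const (c := s)
    (Complex.ofReal_mem_slitPlane.2 hx))).comp_ofReal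
  refine h.congr_deriv ?_
  simp only [id_eq, mul_one]
  rw [Complex.cpow_sub _ _ hx', Complex.cpow_one]
  ring

/-- Factoring out `x^{1/2+m}` removes the inverse-square potential. With `F(x) = A(x²)` and `t = x²`
the remaining equation reads `4 (t A'' + (m+1) A') = k² A`, which is a recurrence for Taylor
coefficients. -/
theorem isFreeSolution_cpow_mul {m k : ℂ} {F F₁ F₂ : ℝ → ℂ}
    (h1 : ∀ x, 0 < x → HasDerivAt F (F₁ x) x) (h2 : ∀ x, 0 < x → HasDerivAt F₁ (F₂ x) x)
    (h : ∀ x : ℝ, 0 < x → F₂ x + (1 + 2 * m) / x * F₁ x = k ^ 2 * F x) :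
    IsFreeSolution m k (fun x : ℝ => (x : ℂ) ^ (1 / 2 + m) * F x)
      (fun x : ℝ => (x : ℂ) ^ (1 / 2 + m) * ((1 / 2 + m) / x * F x + F₁ x)) := by
  intro x hx
  have hx' : (x : ℂ) ≠ 0 := Complex.ofReal_ne_zero.2 hx.ne'
  have hP := hasDerivAt_cpow_real (1 / 2 + m) hx
  constructor
  · exact (hP.fun_mul (h1 x hx)).congr_deriv (by ring)
  · have hinv : HasDerivAt (fun x : ℝ => (1 / 2 + m) / (x : ℂ)) (-(1 / 2 + m) / (x : ℂ) ^ 2) x := by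
      have := (((hasDerivAt_id (x : ℂ)).inv hx').const_mul (1 / 2 + m)).comp_ofReal
      refine (this.congr_deriv ?_)
      simp only [id_eq]
      ring
    have := hP.fun_mul ((hinv.fun_mul (h1 x hx)).fun_add (h2 x hx))
    refine this.congr_deriv ?_
    have e : F₂ x = k ^ 2 * F x - (1 + 2 * m) / x * F₁ x := by rw [← h x hx]; ring
    rw [e]
    field_simp
    ring

theorem hasDerivAt_comp_sq {A A' : ℝ → ℂ} (hA : ∀ t, HasDerivAt A (A' t) t) (x : ℝ) :
    HasDerivAt (fun x : ℝ => A (x ^ 2)) (2 * x * A' (x ^ 2)) x := by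
  have h := (hA (x ^ 2)).scomp x (hasDerivAt_pow 2 x)
  refine h.congr_deriv ?_
  simp

theorem hasDerivAt_two_mul_comp_sq {A A' : ℝ → ℂ} (hA : ∀ t, HasDerivAt A (A' t) t) (x : ℝ) :
    HasDerivAt (fun x : ℝ => 2 * (x : ℂ) * A (x ^ 2))
      (2 * A (x ^ 2) + 4 * (x : ℂ) ^ 2 * A' (x ^ 2)) x := by
  have h0 : HasDerivAt (fun x : ℝ => 2 * (x : ℂ)) (2 * 1) x :=
    ((hasDerivAt_id (x : ℂ)).comp_ofReal).const_mul 2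
  refine (h0.fun_mul (hasDerivAt_comp_sq hA x)).congr_deriv ?_
  ring

/-! ### The unperturbed solution `u_m^0` -/

/-- For `n ≤ N` with `N ≥ R`, compactness of the disc and continuity of `1/Γ`. Beyond `N`, `1/Γ(z) =
z/Γ(z+1)` with `|μ+n+1| ≥ 1` makes the sequence nonincreasing. Uniformity in `μ` is what allows
differentiation in the order. -/
theorem exists_bound_inv_Gamma (R : ℝ) : ∃ M : ℝ, 0 ≤ M ∧ ∀ μ : ℂ, ‖μ‖ ≤ R → ∀ n : ℕ,
    ‖(Complex.Gamma (μ + n + 1))⁻¹‖ ≤ M := by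
  have h1 : ∀ n : ℕ, ∃ C : ℝ, ∀ μ ∈ Metric.closedBall (0 : ℂ) R,
      ‖(Complex.Gamma (μ + n + 1))⁻¹‖ ≤ C := by
    intro n
    refine (isCompact_closedBall (0 : ℂ) R).exists_bound_of_continuousOn
      (Continuous.continuousOn ?_)
    exact Complex.differentiable_one_div_Gamma.continuous.comp (by fun_prop)
  choose C hC using h1
  obtain ⟨N, hN⟩ := exists_nat_ge R
  have hle : ∀ n ≤ N, |C n| ≤ ∑ i ∈ Finset.range (N + 1), |C i| := fun n hn =>
    Finset.single_le_sum (f := fun i => |C i|) (fun i _ => abs_nonneg _)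
      (Finset.mem_range.2 (by omega))
  refine ⟨∑ i ∈ Finset.range (N + 1), |C i|, Finset.sum_nonneg fun i _ => abs_nonneg _,
    fun μ hμ n => ?_⟩
  have hμ' : μ ∈ Metric.closedBall (0 : ℂ) R := mem_closedBall_zero_iff.2 hμ
  have hsmall : ∀ n ≤ N, ‖(Complex.Gamma (μ + n + 1))⁻¹‖ ≤
      ∑ i ∈ Finset.range (N + 1), |C i| := fun n hn =>
    ((hC n μ hμ').trans (le_abs_self _)).trans (hle n hn)
  rcases le_total n N with h | h
  · exact hsmall n h
  · induction n, h using Nat.le_induction with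
    | base => exact hsmall N le_rfl
    | succ n hn ih =>
      have hrec := Complex.one_div_Gamma_eq_self_mul_one_div_Gamma_add_one (μ + n + 1)
      have hone : (1 : ℝ) ≤ ‖μ + n + 1‖ := by
        have e1 : ‖((n + 1 : ℕ) : ℂ)‖ ≤ ‖μ + n + 1‖ + ‖μ‖ := by
          have : ((n + 1 : ℕ) : ℂ) = (μ + n + 1) - μ := by push_cast; ring
          rw [this]
          exact norm_sub_le _ _
        rw [Complex.norm_natCast] at e1
        push_cast at e1
        have : (N : ℝ) ≤ n := by exact_mod_cast hn
        linarith
      refine le_trans ?_ ih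
      have e : μ + ((n + 1 : ℕ) : ℂ) + 1 = μ + n + 1 + 1 := by push_cast; ring
      rw [e, hrec, norm_mul]
      exact le_mul_of_one_le_left (norm_nonneg _) hone

/-- The Taylor coefficients of `x^{-1/2-m} u_m^0(x,k)` in powers of `x²`. -/
def uCoeff (m k : ℂ) (n : ℕ) : ℂ :=
  (k ^ 2 / 4) ^ n / ((n.factorial : ℂ) * Complex.Gamma (m + n + 1))

theorem uCoeff_expBounded (m k : ℂ) : ExpBounded (uCoeff m k) := by
  obtain ⟨M, hM, h⟩ := exists_bound_inv_Gamma ‖m‖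
  refine ⟨M, ‖k ^ 2 / 4‖, hM, norm_nonneg _, fun n => ?_⟩
  have e : uCoeff m k n = (Complex.Gamma (m + n + 1))⁻¹ * ((k ^ 2 / 4) ^ n / n.factorial) := by
    rw [uCoeff, div_mul_eq_div_div, div_eq_mul_inv _ (Complex.Gamma _)]
    ring
  rw [e, norm_mul, norm_div, norm_pow, Complex.norm_natCast]
  gcongr
  exact h m le_rfl n

/-- The functional equation is used for the reciprocal `1/Γ`, so the recurrence also holds at the
poles of `Γ`. -/
theorem uCoeff_succ (m k : ℂ) (n : ℕ) :
    (n + (m + 1)) * ((n + 1) * uCoeff m k (n + 1)) = k ^ 2 / 4 * uCoeff m k n := by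
  have hrec := Complex.one_div_Gamma_eq_self_mul_one_div_Gamma_add_one (m + n + 1)
  have e : m + ((n + 1 : ℕ) : ℂ) + 1 = m + n + 1 + 1 := by push_cast; ring
  have hf : ((n : ℂ) + 1) ≠ 0 := Nat.cast_add_one_ne_zero n
  have hf' : (n.factorial : ℂ) ≠ 0 := Nat.cast_ne_zero.2 n.factorial_ne_zero
  simp only [uCoeff]
  rw [e, div_mul_eq_div_div, div_mul_eq_div_div, div_eq_mul_inv _ (Complex.Gamma _),
    div_eq_mul_inv _ (Complex.Gamma (m + n + 1)), hrec, Nat.factorial_succ, pow_succ]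
  push_cast
  field_simp
  ring

theorem uSeries_ode (m k : ℂ) (t : ℝ) :
    (t : ℂ) * pser (coeffDeriv (coeffDeriv (uCoeff m k))) t +
      (m + 1) * pser (coeffDeriv (uCoeff m k)) t = k ^ 2 / 4 * pser (uCoeff m k) t := by
  rw [(uCoeff_expBounded m k).ode (m + 1) (uCoeff_succ m k), pser, pser, tsum_mul_left.symm]
  exact tsum_congr fun n => by ring

theorem cpow_half_add (m : ℂ) {x : ℝ} (hx : 0 < x) :
    (x : ℂ) ^ (1 / 2 + m) = (Real.sqrt x : ℂ) * (x : ℂ) ^ m := by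
  rw [Complex.cpow_add _ _ (Complex.ofReal_ne_zero.2 hx.ne'), Real.sqrt_eq_rpow,
    Complex.ofReal_cpow hx.le]
  norm_num

theorem log_mul_div_two {k : ℂ} (hk : k ≠ 0) {x : ℝ} (hx : 0 < x) :
    Complex.log (k * x / 2) = Real.log x + Complex.log (k / 2) := by
  rw [show k * x / 2 = (x : ℂ) * (k / 2) by ring,
    Complex.log_ofReal_mul hx (div_ne_zero hk two_ne_zero)]

theorem uCoeff_mul_pow (m k : ℂ) (x : ℝ) (n : ℕ) :
    ((k * x) ^ 2 / 4) ^ n / ((n.factorial : ℂ) * Complex.Gamma (m + n + 1)) =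
      uCoeff m k n * ((x ^ 2 : ℝ) : ℂ) ^ n := by
  rw [uCoeff, div_mul_eq_mul_div, ← mul_pow]
  congr 2
  push_cast
  ring

/-- Multiplying by `x > 0` does not change the branch of the logarithm, so `(kx/2)^m = x^m (k/2)^m`
and the prefactor `(k/2)^{-m}` cancels. At `k = 0` only the constant term of the series survives. -/
theorem u0_eq (m k : ℂ) {x : ℝ} (hx : 0 < x) :
    u0 m k x = (x : ℂ) ^ (1 / 2 + m) * pser (uCoeff m k) (x ^ 2) := by
  have hx' : (x : ℂ) ≠ 0 := Complex.ofReal_ne_zero.2 hx.ne'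
  rw [u0]
  split_ifs with hk
  · subst hk
    rw [pser, tsum_eq_single 0]
    · simp [uCoeff, div_eq_mul_inv]
    · intro n hn
      simp [uCoeff, hn]
  · have hk2 : k / 2 ≠ 0 := div_ne_zero hk two_ne_zero
    have hkx : k * x / 2 ≠ 0 := div_ne_zero (mul_ne_zero hk hx') two_ne_zero
    have e1 : (k * x / 2) ^ m = (x : ℂ) ^ m * (k / 2) ^ m := by
      rw [Complex.cpow_def_of_ne_zero hkx, Complex.cpow_def_of_ne_zero hx',
        Complex.cpow_def_of_ne_zero hk2, ← Complex.exp_add, log_mul_div_two hk hx,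
        Complex.ofReal_log hx.le, add_mul]
    have e2 : (k / 2) ^ (-m) * (k / 2) ^ m = 1 := by
      rw [← Complex.cpow_add _ _ hk2, neg_add_cancel, Complex.cpow_zero]
    rw [besselI, e1, cpow_half_add m hx, pser]
    simp_rw [uCoeff_mul_pow]
    linear_combination (Real.sqrt x : ℂ) * (x : ℂ) ^ m *
      (∑' n : ℕ, uCoeff m k n * ((x ^ 2 : ℝ) : ℂ) ^ n) * e2

theorem IsFreeSolution.congr {m k : ℂ} {f g f' : ℝ → ℂ} (h : IsFreeSolution m k f f')
    (hg : ∀ x, 0 < x → g x = f x) : IsFreeSolution m k g f' := by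
  intro x hx
  refine ⟨(h x hx).1.congr_of_eventuallyEq ?_, by rw [hg x hx]; exact (h x hx).2⟩
  filter_upwards [Ioi_mem_nhds hx] with y hy using hg y hy

theorem u0_isFreeSolution (m k : ℂ) :
    IsFreeSolution m k (u0 m k) (fun x : ℝ => (x : ℂ) ^ (1 / 2 + m) *
      ((1 / 2 + m) / x * pser (uCoeff m k) (x ^ 2) +
        2 * x * pser (coeffDeriv (uCoeff m k)) (x ^ 2))) := by
  have hA := uCoeff_expBounded m k
  refine IsFreeSolution.congr (isFreeSolution_cpow_mul (m := m) (k := k)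
    (F := fun x : ℝ => pser (uCoeff m k) (x ^ 2))
    (F₁ := fun x : ℝ => 2 * x * pser (coeffDeriv (uCoeff m k)) (x ^ 2))
    (fun x _ => hasDerivAt_comp_sq hA.hasDerivAt x)
    (fun x _ => hasDerivAt_two_mul_comp_sq hA.coeffDeriv.hasDerivAt x) fun x hx => ?_)
    fun x hx => u0_eq m k hx
  have hx' : (x : ℂ) ≠ 0 := Complex.ofReal_ne_zero.2 hx.ne'
  have h := uSeries_ode m k (x ^ 2)
  push_cast at h
  have e : (1 + 2 * m) / (x : ℂ) * (2 * x * pser (coeffDeriv (uCoeff m k)) (x ^ 2)) =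
      2 * (1 + 2 * m) * pser (coeffDeriv (uCoeff m k)) (x ^ 2) := by
    field_simp
  rw [e]
  linear_combination 4 * h

theorem norm_cpow_half_add (m : ℂ) {x : ℝ} (hx : 0 < x) :
    ‖(x : ℂ) ^ (1 / 2 + m)‖ = x ^ (1 / 2 + m.re) := by
  rw [Complex.norm_cpow_eq_rpow_re_of_pos hx]
  norm_num

theorem u0_bound (m k : ℂ) (a : ℝ) : ∃ C : ℝ, 0 ≤ C ∧
    ∀ x, 0 < x → x ≤ a → ‖u0 m k x‖ ≤ C * x ^ (1 / 2 + m.re) := by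
  obtain ⟨C, hC, h⟩ := exists_bound_sq (uCoeff_expBounded m k).continuous a
  refine ⟨C, hC, fun x hx hxa => ?_⟩
  rw [u0_eq m k hx, norm_mul, norm_cpow_half_add m hx, mul_comm]
  gcongr
  exact h x hx hxa

/-! ### The logarithmic solution `p_0^0` -/

/-- From `Γ(n+1) = n!` and `Γ'(n+1) = n! (H_n - γ)`. -/
theorem hasDerivAt_inv_Gamma_nat (n : ℕ) :
    HasDerivAt (fun μ : ℂ => (Complex.Gamma (μ + n + 1))⁻¹)
      (((Real.eulerMascheroniConstant : ℂ) - (harmonic n : ℂ)) / n.factorial) 0 := by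
  have hf : (n.factorial : ℂ) ≠ 0 := Nat.cast_ne_zero.2 n.factorial_ne_zero
  have h1 := Complex.hasDerivAt_Gamma_nat n
  have h2 : HasDerivAt (fun μ : ℂ => μ + n + 1) 1 0 :=
    ((hasDerivAt_id (0 : ℂ)).add_const (n : ℂ)).add_const 1
  have h1' : HasDerivAt Complex.Gamma
      (n.factorial * (-Real.eulerMascheroniConstant + harmonic n)) ((0 : ℂ) + n + 1) := by
    rw [zero_add]; exact h1
  have hG : Complex.Gamma ((0 : ℂ) + n + 1) = n.factorial := by
    rw [zero_add, Complex.Gamma_nat_eq_factorial]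
  have h3 := (h1'.comp (0 : ℂ) h2).fun_inv (by
    simp only [Function.comp_apply]
    rw [hG]; exact hf)
  refine h3.congr_deriv ?_
  simp only [Function.comp_apply]
  rw [hG]
  field_simp
  ring

/-- The series consists of entire functions of `μ` and converges uniformly on the unit disc, so it
may be differentiated termwise; the factor `(z/2)^μ` contributes the logarithm. -/
theorem hasDerivAt_besselI_order (z : ℂ) (hz : z ≠ 0) :
    HasDerivAt (fun μ : ℂ => besselI μ z)
      (Complex.log (z / 2) * (∑' n : ℕ, (z ^ 2 / 4) ^ n / ((n.factorial : ℂ) * n.factorial)) +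
        ∑' n : ℕ, (z ^ 2 / 4) ^ n / (n.factorial : ℂ) *
          (((Real.eulerMascheroniConstant : ℂ) - (harmonic n : ℂ)) / n.factorial)) 0 := by
  obtain ⟨M, hM, hb⟩ := exists_bound_inv_Gamma 1
  set F : ℕ → ℂ → ℂ := fun n μ =>
    (z ^ 2 / 4) ^ n / (n.factorial : ℂ) * (Complex.Gamma (μ + n + 1))⁻¹ with hF
  have hsum : Summable fun n : ℕ => ‖z ^ 2 / 4‖ ^ n / (n.factorial : ℝ) * M :=
    (Real.summable_pow_div_factorial ‖z ^ 2 / 4‖).mul_right M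
  have hdF : ∀ n, Differentiable ℂ (F n) := fun n =>
    (Complex.differentiable_one_div_Gamma.comp
      ((differentiable_id.add_const (n : ℂ)).add_const 1)).const_mul _
  have hle : ∀ (n : ℕ) (μ : ℂ), μ ∈ Metric.ball (0 : ℂ) 1 →
      ‖F n μ‖ ≤ ‖z ^ 2 / 4‖ ^ n / (n.factorial : ℝ) * M := by
    intro n μ hμ
    simp only [hF]
    rw [norm_mul, norm_div, norm_pow, Complex.norm_natCast]
    gcongr
    exact hb μ (mem_ball_zero_iff.1 hμ).le n
  have h0 : (0 : ℂ) ∈ Metric.ball (0 : ℂ) 1 := Metric.mem_ball_self one_pos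
  have hd := Complex.differentiableOn_tsum_of_summable_norm hsum
    (fun n => (hdF n).differentiableOn) Metric.isOpen_ball hle
  have hs := Complex.hasSum_deriv_of_summable_norm hsum
    (fun n => (hdF n).differentiableOn) Metric.isOpen_ball hle h0
  have hder := (hd.differentiableAt (Metric.isOpen_ball.mem_nhds h0)).hasDerivAt
  rw [← hs.tsum_eq] at hder
  have hpow : HasDerivAt (fun μ : ℂ => (z / 2) ^ μ)
      ((z / 2) ^ (0 : ℂ) * Complex.log (z / 2) * 1) 0 :=
    (hasDerivAt_id (0 : ℂ)).const_cpow (Or.inl (div_ne_zero hz two_ne_zero))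
  have key := hpow.fun_mul hder
  have hfun : (fun μ : ℂ => besselI μ z) = fun μ => (z / 2) ^ μ * ∑' n, F n μ := by
    ext μ
    rw [besselI]
    congr 1
    refine tsum_congr fun n => ?_
    simp only [hF]
    rw [div_mul_eq_div_div, div_eq_mul_inv _ (Complex.Gamma _)]
  rw [hfun]
  refine key.congr_deriv ?_
  rw [Complex.cpow_zero, one_mul, mul_one, one_mul]
  congr 1
  · congr 1
    refine tsum_congr fun n => ?_
    simp only [hF]
    rw [zero_add, Complex.Gamma_nat_eq_factorial, div_mul_eq_div_div,
      div_eq_mul_inv _ (n.factorial : ℂ)]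
    rfl
  · refine tsum_congr fun n => ?_
    exact ((hasDerivAt_inv_Gamma_nat n).const_mul _).deriv

/-- Numerator and `sin (π μ)` both vanish at `μ = 0`, so the limit is the quotient of their
derivatives: `(π/2) (-2D)/π = -D`. -/
theorem besselK_zero_eq {z D : ℂ} (h : HasDerivAt (fun μ : ℂ => besselI μ z) D 0) :
    besselK 0 z = -D := by
  refine Tendsto.limUnder_eq ?_
  have h0 : HasDerivAt (fun μ : ℂ => besselI (-μ) z) (-D) 0 := by
    have h' : HasDerivAt (fun μ : ℂ => besselI μ z) D (-0) := by rwa [neg_zero]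
    exact (h'.comp (0 : ℂ) (hasDerivAt_neg (0 : ℂ))).congr_deriv (by ring)
  have h1 : HasDerivAt (fun μ : ℂ => besselI (-μ) z - besselI μ z) (-D - D) 0 := h0.fun_sub h
  have h2 : HasDerivAt (fun μ : ℂ => Complex.sin (Real.pi * μ)) (Real.pi : ℂ) 0 := by
    have := ((hasDerivAt_id (0 : ℂ)).const_mul (Real.pi : ℂ)).csin
    simpa using this
  have t1 := h1.tendsto_slope
  have t2 := h2.tendsto_slope
  have hpi : (Real.pi : ℂ) ≠ 0 := Complex.ofReal_ne_zero.2 Real.pi_ne_zero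
  have t3 := (t1.div t2 hpi).const_mul ((Real.pi : ℂ) / 2)
  have e : (Real.pi : ℂ) / 2 * ((-D - D) / Real.pi) = -D := by
    field_simp
    ring
  rw [e] at t3
  refine t3.congr' ?_
  filter_upwards [self_mem_nhdsWithin] with μ hμ
  have hμ : μ ≠ 0 := hμ
  simp only [Pi.div_apply, slope_def_field, neg_zero, sub_self, mul_zero, Complex.sin_zero,
    sub_zero]
  rw [div_div_div_cancel_right₀ hμ]
  ring

/-- The Taylor coefficients of the regular part of `p_0^0`. -/
def pCoeff (k : ℂ) (n : ℕ) : ℂ := (harmonic n : ℂ) * uCoeff 0 k n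

theorem norm_harmonic_le (n : ℕ) : ‖(harmonic n : ℂ)‖ ≤ 2 ^ n := by
  have h : ((harmonic n : ℚ) : ℝ) ≤ n := by
    rw [harmonic]
    push_cast
    calc ∑ i ∈ Finset.range n, ((i : ℝ) + 1)⁻¹ ≤ ∑ i ∈ Finset.range n, (1 : ℝ) := by
          refine Finset.sum_le_sum fun i _ => inv_le_one_of_one_le₀ ?_
          have : (0 : ℝ) ≤ i := Nat.cast_nonneg i
          linarith
      _ = n := by simp
  have h0 : (0 : ℝ) ≤ (harmonic n : ℚ) := by
    rw [harmonic]
    push_cast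
    exact Finset.sum_nonneg fun i _ => by positivity
  have e : (harmonic n : ℂ) = (((harmonic n : ℚ) : ℝ) : ℂ) := by push_cast; rfl
  rw [e, Complex.norm_real, Real.norm_of_nonneg h0]
  refine h.trans ?_
  exact_mod_cast (Nat.lt_two_pow_self (n := n)).le

theorem pCoeff_expBounded (k : ℂ) : ExpBounded (pCoeff k) := by
  obtain ⟨M, B, hM, hB, h⟩ := uCoeff_expBounded 0 k
  -- The crude bound `H_n ≤ 2^n` is absorbed by doubling `B`.
  refine ⟨M, 2 * B, hM, by positivity, fun n => ?_⟩
  rw [pCoeff, norm_mul]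
  calc ‖(harmonic n : ℂ)‖ * ‖uCoeff 0 k n‖ ≤ 2 ^ n * (M * (B ^ n / n.factorial)) := by
        gcongr
        · exact norm_harmonic_le n
        · exact h n
    _ = _ := by rw [mul_pow]; ring

/-- From `H_{n+1} = H_n + 1/(n+1)`. The inhomogeneous term cancels the one that arises when the
logarithm in `pFactor` is differentiated. -/
theorem pSeries_ode (k : ℂ) (t : ℝ) :
    (t : ℂ) * pser (coeffDeriv (coeffDeriv (pCoeff k))) t + 1 * pser (coeffDeriv (pCoeff k)) t =
      k ^ 2 / 4 * pser (pCoeff k) t + pser (coeffDeriv (uCoeff 0 k)) t := by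
  rw [(pCoeff_expBounded k).ode (d := fun n => k ^ 2 / 4 * pCoeff k n + coeffDeriv (uCoeff 0 k) n) 1
    fun n => ?_]
  · refine HasSum.tsum_eq ?_
    refine (((pCoeff_expBounded k).hasSum t).mul_left (k ^ 2 / 4)).add
      ((uCoeff_expBounded 0 k).coeffDeriv.hasSum t) |>.congr_fun fun n => ?_
    ring
  · have h := uCoeff_succ 0 k n
    have hn : ((n : ℂ) + 1) ≠ 0 := Nat.cast_add_one_ne_zero n
    have e : (harmonic (n + 1) : ℂ) = harmonic n + ((n : ℂ) + 1)⁻¹ := by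
      rw [harmonic_succ]
      push_cast
      ring
    rw [zero_add] at h
    rw [pCoeff, pCoeff, coeffDeriv, e]
    have e2 : ((n : ℂ) + 1)⁻¹ * ((n + 1) * ((n + 1) * uCoeff 0 k (n + 1))) =
      (n + 1) * uCoeff 0 k (n + 1) := by field_simp
    linear_combination (harmonic n : ℂ) * h + e2

/-- Since `log(kx/2) = ln x + log(k/2)`, subtracting `(log(k/2) + γ) u_0^0` leaves `ln x` as the
only logarithm. At `k = 0` the second series vanishes because `H_0 = 0`. -/
theorem p00_eq (k : ℂ) {x : ℝ} (hx : 0 < x) :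
    p00 k x = (x : ℂ) ^ ((1 / 2 : ℂ) + 0) *
      ((Real.log x : ℂ) * pser (uCoeff 0 k) (x ^ 2) - pser (pCoeff k) (x ^ 2)) := by
  have hx' : (x : ℂ) ≠ 0 := Complex.ofReal_ne_zero.2 hx.ne'
  rw [cpow_half_add 0 hx, Complex.cpow_zero, mul_one, p00]
  split_ifs with hk
  · subst hk
    have e1 : pser (uCoeff 0 0) (x ^ 2) = 1 := by
      rw [pser, tsum_eq_single 0]
      · simp [uCoeff]
      · intro n hn
        simp [uCoeff, hn]
    have e2 : pser (pCoeff 0) (x ^ 2) = 0 := by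
      rw [pser, tsum_eq_single 0]
      · simp [pCoeff]
      · intro n hn
        simp [pCoeff, uCoeff, hn]
    rw [e1, e2]
    ring
  · have hkx : k * x ≠ 0 := mul_ne_zero hk hx'
    have hu := uCoeff_expBounded 0 k
    have hp := pCoeff_expBounded k
    have s1 : (∑' n : ℕ, ((k * x) ^ 2 / 4) ^ n / ((n.factorial : ℂ) * n.factorial)) =
        pser (uCoeff 0 k) (x ^ 2) := by
      rw [pser]
      refine tsum_congr fun n => ?_
      rw [← uCoeff_mul_pow, zero_add, Complex.Gamma_nat_eq_factorial]
    have s2 : (∑' n : ℕ, ((k * x) ^ 2 / 4) ^ n / (n.factorial : ℂ) *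
          (((Real.eulerMascheroniConstant : ℂ) - (harmonic n : ℂ)) / n.factorial)) =
        Real.eulerMascheroniConstant * pser (uCoeff 0 k) (x ^ 2) - pser (pCoeff k) (x ^ 2) := by
      refine HasSum.tsum_eq ?_
      refine (((hu.hasSum (x ^ 2)).mul_left (Real.eulerMascheroniConstant : ℂ)).sub
        (hp.hasSum (x ^ 2))).congr_fun fun n => ?_
      have h1 := uCoeff_mul_pow 0 k x n
      rw [zero_add, Complex.Gamma_nat_eq_factorial] at h1
      rw [pCoeff]
      linear_combination ((Real.eulerMascheroniConstant : ℂ) - (harmonic n : ℂ)) * h1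
    have hK := besselK_zero_eq (hasDerivAt_besselI_order (k * x) hkx)
    rw [s1, s2, log_mul_div_two hk hx] at hK
    rw [v00, hK, u0_eq 0 k hx, cpow_half_add 0 hx, Complex.cpow_zero]
    ring

/-- The factor `x^{-1/2} p_0^0(x,k)`. -/
def pFactor (k : ℂ) (x : ℝ) : ℂ :=
  (Real.log x : ℂ) * pser (uCoeff 0 k) (x ^ 2) - pser (pCoeff k) (x ^ 2)

/-- The derivative of `pFactor`. -/
def pFactorDeriv (k : ℂ) (x : ℝ) : ℂ :=
  1 / (x : ℂ) * pser (uCoeff 0 k) (x ^ 2) +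
    (Real.log x : ℂ) * (2 * x * pser (coeffDeriv (uCoeff 0 k)) (x ^ 2)) -
    2 * x * pser (coeffDeriv (pCoeff k)) (x ^ 2)

theorem p00_isFreeSolution (k : ℂ) :
    IsFreeSolution 0 k (p00 k) (fun x : ℝ => (x : ℂ) ^ ((1 / 2 : ℂ) + 0) *
      ((1 / 2 + 0) / x * pFactor k x + pFactorDeriv k x)) := by
  have hA := uCoeff_expBounded 0 k
  have hT := pCoeff_expBounded k
  have hlog : ∀ x : ℝ, 0 < x → HasDerivAt (fun x : ℝ => (Real.log x : ℂ)) (1 / (x : ℂ)) x := by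
    intro x hx
    refine (Real.hasDerivAt_log hx.ne').ofReal_comp.congr_deriv ?_
    push_cast
    ring
  have hinv : ∀ x : ℝ, 0 < x →
      HasDerivAt (fun x : ℝ => 1 / (x : ℂ)) (-1 / (x : ℂ) ^ 2) x := by
    intro x hx
    have hx' : (x : ℂ) ≠ 0 := Complex.ofReal_ne_zero.2 hx.ne'
    have := ((hasDerivAt_id (x : ℂ)).inv hx').comp_ofReal
    simpa using this
  refine IsFreeSolution.congr (isFreeSolution_cpow_mul (m := 0) (k := k)
    (F := pFactor k) (F₁ := pFactorDeriv k)
    (fun x hx => (((hlog x hx).fun_mul (hasDerivAt_comp_sq hA.hasDerivAt x)).fun_sub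
      (hasDerivAt_comp_sq hT.hasDerivAt x)))
    (fun x hx => ((((hinv x hx).fun_mul (hasDerivAt_comp_sq hA.hasDerivAt x)).fun_add
      ((hlog x hx).fun_mul (hasDerivAt_two_mul_comp_sq hA.coeffDeriv.hasDerivAt x))).fun_sub
      (hasDerivAt_two_mul_comp_sq hT.coeffDeriv.hasDerivAt x))) fun x hx => ?_)
    fun x hx => p00_eq k hx
  have hx' : (x : ℂ) ≠ 0 := Complex.ofReal_ne_zero.2 hx.ne'
  have h1 := uSeries_ode 0 k (x ^ 2)
  have h2 := pSeries_ode k (x ^ 2)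
  push_cast at h1 h2
  simp only [pFactor, pFactorDeriv]
  generalize pser (uCoeff 0 k) (x ^ 2) = A at *
  generalize pser (coeffDeriv (uCoeff 0 k)) (x ^ 2) = A' at *
  generalize pser (coeffDeriv (coeffDeriv (uCoeff 0 k))) (x ^ 2) = A'' at *
  generalize pser (pCoeff k) (x ^ 2) = T at *
  generalize pser (coeffDeriv (pCoeff k)) (x ^ 2) = T' at *
  generalize pser (coeffDeriv (coeffDeriv (pCoeff k))) (x ^ 2) = T'' at *
  generalize (Real.log x : ℂ) = L
  field_simp
  linear_combination 4 * (x : ℂ) ^ 2 * L * h1 - 4 * (x : ℂ) ^ 2 * h2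

/-! ### Energy estimates for `m ≠ 0` -/

/-- The sum of the squares of the two components of a solution that diagonalize the Euler operator
`-∂² + (m² - 1/4) x⁻²`. -/
def energy (m : ℂ) (f f' : ℝ → ℂ) (x : ℝ) : ℝ :=
  ‖(x : ℂ) * f' x + (m - 1 / 2) * f x‖ ^ 2 + ‖(x : ℂ) * f' x - (m + 1 / 2) * f x‖ ^ 2

theorem energy_nonneg (m : ℂ) (f f' : ℝ → ℂ) (x : ℝ) : 0 ≤ energy m f f' x := by
  unfold energy
  positivity

/-- With `c = k² x² f`, the components `p`, `n` satisfy `x p' = (1/2+m) p + c` and `x n' = (1/2-m) n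
+ c`, coupled only through `c`. The remainder is controlled by the energy because `f = (p-n)/(2m)`;
here `m ≠ 0` is essential. -/
theorem IsFreeSolution.hasDerivAt_energy {m k : ℂ} (hm : m ≠ 0) {f f' : ℝ → ℂ}
    (h : IsFreeSolution m k f f') {x : ℝ} (hx : 0 < x) :
    ∃ D : ℝ, HasDerivAt (energy m f f') D x ∧
      |x * D - energy m f f' x| ≤
        (2 * |m.re| + 2 * (‖k‖ ^ 2 / ‖m‖) * x ^ 2) * energy m f f' x := by
  have hx' : (x : ℂ) ≠ 0 := Complex.ofReal_ne_zero.2 hx.ne'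
  have hmn : 0 < ‖m‖ := norm_pos_iff.2 hm
  obtain ⟨h1, h2⟩ := h x hx
  have hid : HasDerivAt (fun x : ℝ => (x : ℂ)) 1 x := (hasDerivAt_id (x : ℂ)).comp_ofReal
  have hP := ((hid.fun_mul h2).fun_add (h1.const_mul (m - 1 / 2))).norm_sq
  have hN := ((hid.fun_mul h2).fun_sub (h1.const_mul (m + 1 / 2))).norm_sq
  refine ⟨_, hP.fun_add hN, ?_⟩
  set p : ℂ := (x : ℂ) * f' x + (m - 1 / 2) * f x with hp
  set n : ℂ := (x : ℂ) * f' x - (m + 1 / 2) * f x with hn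
  have hE : energy m f f' x = ‖p‖ ^ 2 + ‖n‖ ^ 2 := rfl
  have hf : f x = (p - n) / (2 * m) := by
    rw [hp, hn]
    field_simp
    ring
  set c : ℂ := k ^ 2 * (x : ℂ) ^ 2 * f x with hc
  have e1 : (x : ℂ) * (1 * f' x + x * (((m ^ 2 - 1 / 4) / (x : ℂ) ^ 2 + k ^ 2) * f x) +
      (m - 1 / 2) * f' x) = (m + 1 / 2) * p + c := by
    rw [hp, hc]
    field_simp
    ring
  have e2 : (x : ℂ) * (1 * f' x + x * (((m ^ 2 - 1 / 4) / (x : ℂ) ^ 2 + k ^ 2) * f x) -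
      (m + 1 / 2) * f' x) = (1 / 2 - m) * n + c := by
    rw [hn, hc]
    field_simp
    ring
  have inner_mul : ∀ a b z c : ℂ, (x : ℂ) * z = a * b + c →
      x * inner ℝ b z = a.re * ‖b‖ ^ 2 + inner ℝ b c := by
    intro a b z c hz
    have hab : inner ℝ b (a * b) = a.re * ‖b‖ ^ 2 := by
      rw [Complex.inner, ← Complex.normSq_eq_norm_sq, mul_assoc, Complex.mul_conj]
      simp
    rw [← hab, ← inner_add_right, ← hz, ← Complex.real_smul, inner_smul_right]
  have i1 := inner_mul _ p _ _ e1
  have i2 := inner_mul _ n _ _ e2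
  rw [hE, show ∀ a b : ℝ, x * (2 * a + 2 * b) = 2 * (x * a) + 2 * (x * b) by intros; ring, i1, i2]
  have b1 := abs_real_inner_le_norm p c
  have b2 := abs_real_inner_le_norm n c
  have hcn : ‖c‖ ≤ ‖k‖ ^ 2 * x ^ 2 * ((‖p‖ + ‖n‖) / (2 * ‖m‖)) := by
    rw [hc, hf, norm_mul, norm_mul, norm_pow, norm_pow, Complex.norm_real, norm_div, norm_mul,
      Real.norm_of_nonneg hx.le]
    simp only [RCLike.norm_ofNat]
    gcongr
    exact norm_sub_le _ _
  have r1 : (m + 1 / 2).re = m.re + 1 / 2 := by simp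
  have r2 : (1 / 2 - m).re = 1 / 2 - m.re := by simp
  rw [r1, r2, show 2 * ((m.re + 1 / 2) * ‖p‖ ^ 2 + inner ℝ p c) +
    2 * ((1 / 2 - m.re) * ‖n‖ ^ 2 + inner ℝ n c) - (‖p‖ ^ 2 + ‖n‖ ^ 2) =
    2 * m.re * (‖p‖ ^ 2 - ‖n‖ ^ 2) + 2 * (inner ℝ p c + inner ℝ n c) by ring]
  have t1 : |2 * m.re * (‖p‖ ^ 2 - ‖n‖ ^ 2)| ≤ 2 * |m.re| * (‖p‖ ^ 2 + ‖n‖ ^ 2) := by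
    rw [abs_mul, abs_mul, abs_two]
    gcongr
    rw [abs_le]
    constructor <;> nlinarith [sq_nonneg ‖p‖, sq_nonneg ‖n‖]
  have t2 : |2 * (inner ℝ p c + inner ℝ n c)| ≤
      2 * (‖k‖ ^ 2 / ‖m‖) * x ^ 2 * (‖p‖ ^ 2 + ‖n‖ ^ 2) := by
    rw [abs_mul, abs_two]
    calc 2 * |inner ℝ p c + inner ℝ n c| ≤ 2 * ((‖p‖ + ‖n‖) * ‖c‖) := by
          gcongr
          refine (abs_add_le _ _).trans ?_
          linarith
      _ ≤ 2 * ((‖p‖ + ‖n‖) * (‖k‖ ^ 2 * x ^ 2 * ((‖p‖ + ‖n‖) / (2 * ‖m‖)))) := by gcongr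
      _ = ‖k‖ ^ 2 / ‖m‖ * x ^ 2 * (‖p‖ + ‖n‖) ^ 2 := by field_simp
      _ ≤ ‖k‖ ^ 2 / ‖m‖ * x ^ 2 * (2 * (‖p‖ ^ 2 + ‖n‖ ^ 2)) := by
          gcongr
          nlinarith [sq_nonneg (‖p‖ - ‖n‖)]
      _ = _ := by ring
  refine (abs_add_le _ _).trans ?_
  linarith

theorem hasDerivAt_weighted_energy {m : ℂ} {f f' : ℝ → ℂ} {x D : ℝ}
    (hx : 0 < x) (hD : HasDerivAt (energy m f f') D x) (q c : ℝ) :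
    HasDerivAt (fun x => energy m f f' x * (x ^ q * Real.exp (c * x ^ 2)))
      (x ^ q * Real.exp (c * x ^ 2) / x *
        (x * D + q * energy m f f' x + 2 * c * x ^ 2 * energy m f f' x)) x := by
  have h1 := Real.hasDerivAt_rpow_const (p := q) (Or.inl hx.ne')
  have h2 := ((hasDerivAt_pow 2 x).const_mul c).exp
  refine (hD.fun_mul (h1.fun_mul h2)).congr_deriv ?_
  rw [Real.rpow_sub_one hx.ne']
  push_cast
  field_simp
  ring

/-- Grönwall's argument: the power of `x` absorbs `1 + 2|Re m|` and the Gaussian absorbs the term in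
`k²`. This controls growth away from the origin. -/
theorem IsFreeSolution.energy_forward {m k : ℂ} (hm : m ≠ 0) {f f' : ℝ → ℂ}
    (h : IsFreeSolution m k f f') {x y : ℝ} (hy : 0 < y) (hyx : y ≤ x) :
    energy m f f' x * (x ^ (-(1 + 2 * |m.re|)) * Real.exp (-(‖k‖ ^ 2 / ‖m‖) * x ^ 2)) ≤
      energy m f f' y * (y ^ (-(1 + 2 * |m.re|)) * Real.exp (-(‖k‖ ^ 2 / ‖m‖) * y ^ 2)) := by
  choose! D hD hDb using fun x (hx : 0 < x) => h.hasDerivAt_energy hm hx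
  have hd := fun x (hx : 0 < x) => hasDerivAt_weighted_energy hx (hD x hx)
    (-(1 + 2 * |m.re|)) (-(‖k‖ ^ 2 / ‖m‖))
  have anti := antitoneOn_of_deriv_nonpos (convex_Ioi (0 : ℝ))
    (fun x hx => (hd x hx).continuousAt.continuousWithinAt)
    (fun x hx => (hd x (by simpa using hx)).differentiableAt.differentiableWithinAt)
    (fun x hx => by
      have hx : 0 < x := by simpa using hx
      rw [(hd x hx).deriv]
      refine mul_nonpos_of_nonneg_of_nonpos (by positivity) ?_
      have := (abs_le.1 (hDb x hx)).2
      nlinarith)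
  exact anti hy (hy.trans_le hyx) hyx

/-- The lower half of the same differential inequality; it controls growth towards the origin. -/
theorem IsFreeSolution.energy_backward {m k : ℂ} (hm : m ≠ 0) {f f' : ℝ → ℂ}
    (h : IsFreeSolution m k f f') {x y : ℝ} (hy : 0 < y) (hyx : y ≤ x) :
    energy m f f' y * (y ^ (-(1 - 2 * |m.re|)) * Real.exp ((‖k‖ ^ 2 / ‖m‖) * y ^ 2)) ≤
      energy m f f' x * (x ^ (-(1 - 2 * |m.re|)) * Real.exp ((‖k‖ ^ 2 / ‖m‖) * x ^ 2)) := by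
  choose! D hD hDb using fun x (hx : 0 < x) => h.hasDerivAt_energy hm hx
  have hd := fun x (hx : 0 < x) => hasDerivAt_weighted_energy hx (hD x hx)
    (-(1 - 2 * |m.re|)) (‖k‖ ^ 2 / ‖m‖)
  have mono := monotoneOn_of_deriv_nonneg (convex_Ioi (0 : ℝ))
    (fun x hx => (hd x hx).continuousAt.continuousWithinAt)
    (fun x hx => (hd x (by simpa using hx)).differentiableAt.differentiableWithinAt)
    (fun x hx => by
      have hx : 0 < x := by simpa using hx
      rw [(hd x hx).deriv]
      refine mul_nonneg (by positivity) ?_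
      have := (abs_le.1 (hDb x hx)).1
      nlinarith)
  exact mono hy (hy.trans_le hyx) hyx

/-- A solution and its derivative are controlled by the energy. -/
theorem norm_le_of_energy {m : ℂ} (hm : m ≠ 0) : ∃ C : ℝ, 0 ≤ C ∧ ∀ (f f' : ℝ → ℂ) (x B : ℝ),
    0 < x → 0 ≤ B → energy m f f' x ≤ B ^ 2 → ‖f x‖ ≤ C * B ∧ x * ‖f' x‖ ≤ C * B := by
  have hmn : 0 < ‖m‖ := norm_pos_iff.2 hm
  refine ⟨1 + 1 / ‖m‖, by positivity, fun f f' x B hx hB h => ?_⟩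
  set p : ℂ := (x : ℂ) * f' x + (m - 1 / 2) * f x with hp
  set n : ℂ := (x : ℂ) * f' x - (m + 1 / 2) * f x with hn
  have hE : ‖p‖ ^ 2 + ‖n‖ ^ 2 ≤ B ^ 2 := h
  have hpB : ‖p‖ ≤ B := abs_le_of_sq_le_sq' (by nlinarith [sq_nonneg ‖n‖]) hB |>.2
  have hnB : ‖n‖ ≤ B := abs_le_of_sq_le_sq' (by nlinarith [sq_nonneg ‖p‖]) hB |>.2
  have hf : f x = (p - n) / (2 * m) := by
    rw [hp, hn]
    field_simp
    ring
  have hf' : (x : ℂ) * f' x = (p + n) / 2 + f x / 2 := by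
    rw [hp, hn]
    ring
  have b1 : ‖f x‖ ≤ 1 / ‖m‖ * B := by
    rw [hf, norm_div, norm_mul]
    simp only [RCLike.norm_ofNat]
    rw [div_le_iff₀ (by positivity)]
    calc ‖p - n‖ ≤ ‖p‖ + ‖n‖ := norm_sub_le _ _
      _ ≤ 2 * B := by linarith
      _ = _ := by field_simp
  have hB1 : 0 ≤ 1 / ‖m‖ * B := by positivity
  constructor
  · linarith
  · have e : x * ‖f' x‖ = ‖(x : ℂ) * f' x‖ := by
      rw [norm_mul, Complex.norm_real, Real.norm_of_nonneg hx.le]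
    rw [e, hf']
    calc ‖(p + n) / 2 + f x / 2‖ ≤ ‖(p + n) / 2‖ + ‖f x / 2‖ := norm_add_le _ _
      _ = ‖p + n‖ / 2 + ‖f x‖ / 2 := by rw [norm_div, norm_div]; simp
      _ ≤ (‖p‖ + ‖n‖) / 2 + ‖f x‖ / 2 := by gcongr; exact norm_add_le _ _
      _ ≤ _ := by linarith

/-- Every unperturbed solution is `O(x^{1/2-|Re m|})` at the origin. -/
theorem IsFreeSolution.bound_at_zero {m k : ℂ} (hm : m ≠ 0) {f f' : ℝ → ℂ}
    (h : IsFreeSolution m k f f') : ∃ C : ℝ, 0 ≤ C ∧ ∀ y, 0 < y → y ≤ 1 →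
      ‖f y‖ ≤ C * y ^ (1 / 2 - |m.re|) ∧ ‖f' y‖ ≤ C * y ^ (-1 / 2 - |m.re|) := by
  obtain ⟨C, hC, hb⟩ := norm_le_of_energy hm
  set K := energy m f f' 1 * Real.exp (‖k‖ ^ 2 / ‖m‖) with hK
  have hK0 : 0 ≤ K := mul_nonneg (energy_nonneg _ _ _ _) (Real.exp_nonneg _)
  refine ⟨C * Real.sqrt K, by positivity, fun y hy hy1 => ?_⟩
  have h1 := h.energy_backward hm hy hy1
  have he : energy m f f' y ≤ (Real.sqrt K * y ^ (1 / 2 - |m.re|)) ^ 2 := by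
    rw [mul_pow, Real.sq_sqrt hK0, ← Real.rpow_mul_natCast hy.le]
    push_cast
    rw [show (1 / 2 - |m.re|) * 2 = 1 - 2 * |m.re| by ring]
    rw [Real.one_rpow, one_mul, one_pow, mul_one, ← hK] at h1
    have h2 : energy m f f' y * y ^ (-(1 - 2 * |m.re|)) ≤ K := by
      refine le_trans ?_ h1
      rw [← mul_assoc]
      exact le_mul_of_one_le_right (mul_nonneg (energy_nonneg _ _ _ _) (by positivity))
        (Real.one_le_exp (by positivity))
    rw [Real.rpow_neg hy.le, ← div_eq_mul_inv, div_le_iff₀ (by positivity)] at h2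
    exact h2
  obtain ⟨b1, b2⟩ := hb f f' y _ hy (by positivity) he
  constructor
  · rwa [mul_assoc]
  · rw [show -1 / 2 - |m.re| = (1 / 2 - |m.re|) - 1 by ring, Real.rpow_sub_one hy.ne',
      ← mul_div_assoc, le_div_iff₀ hy]
    linarith

/-- The bound `|G(x,y)| ≤ C x^{1/2+|Re m|} y^{1/2-|Re m|}`, and its analogue for `∂ₓG`. -/
theorem IsFundamentalPair.green_bound {m k : ℂ} (hm : m ≠ 0) {h₁ h₂ : ℝ → ℂ} {w : ℂ}
    (hp : IsFundamentalPair m k h₁ h₂ w) (a : ℝ) : ∃ C : ℝ, 0 ≤ C ∧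
    ∀ x y, 0 < y → y ≤ x → x ≤ a →
      ‖h₁ x * h₂ y - h₂ x * h₁ y‖ ≤ C * (x ^ (1 / 2 + |m.re|) * y ^ (1 / 2 - |m.re|)) ∧
      ‖deriv h₁ x * h₂ y - deriv h₂ x * h₁ y‖ ≤
        C * (x ^ (-1 / 2 + |m.re|) * y ^ (1 / 2 - |m.re|)) := by
  obtain ⟨C, hC, hb⟩ := norm_le_of_energy hm
  set K := 2 * ‖w‖ ^ 2 * Real.exp (‖k‖ ^ 2 / ‖m‖ * a ^ 2) with hK
  have hK0 : 0 ≤ K := by positivity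
  refine ⟨C * Real.sqrt K, by positivity, fun x y hy hyx hxa => ?_⟩
  have hx : 0 < x := hy.trans_le hyx
  -- For fixed `y` the numerator of the kernel is a solution in `x` that vanishes at `x = y` with
  -- derivative `-w`. Its energy there is `2 |w|² y²`, and it is propagated forward to `x`.
  have hsol : IsFreeSolution m k (fun x => h₁ x * h₂ y - h₂ x * h₁ y)
      (fun x => deriv h₁ x * h₂ y - deriv h₂ x * h₁ y) := fun z hz =>
    ⟨((hp.left z hz).1.mul_const _).fun_sub ((hp.right z hz).1.mul_const _),
      (((hp.left z hz).2.mul_const _).fun_sub ((hp.right z hz).2.mul_const _)).congr_deriv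
        (by ring)⟩
  have h1 := hsol.energy_forward hm hy hyx
  have hEy : energy m (fun x => h₁ x * h₂ y - h₂ x * h₁ y)
      (fun x => deriv h₁ x * h₂ y - deriv h₂ x * h₁ y) y = 2 * ‖w‖ ^ 2 * y ^ 2 := by
    have e0 : h₁ y * h₂ y - h₂ y * h₁ y = 0 := by ring
    have e1 : deriv h₁ y * h₂ y - deriv h₂ y * h₁ y = -w := by
      rw [← hp.2.2.2 y hy]; ring
    simp only [energy, e0, e1, mul_zero, add_zero, sub_zero, norm_mul, norm_neg,
      Complex.norm_real, Real.norm_of_nonneg hy.le]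
    ring
  set E := energy m (fun x => h₁ x * h₂ y - h₂ x * h₁ y)
      (fun x => deriv h₁ x * h₂ y - deriv h₂ x * h₁ y) x with hE
  have he : E ≤ (Real.sqrt K * (x ^ (1 / 2 + |m.re|) * y ^ (1 / 2 - |m.re|))) ^ 2 := by
    rw [mul_pow, mul_pow, Real.sq_sqrt hK0, ← Real.rpow_mul_natCast hy.le,
      ← Real.rpow_mul_natCast hx.le]
    push_cast
    rw [show (1 / 2 - |m.re|) * 2 = 1 - 2 * |m.re| by ring,
      show (1 / 2 + |m.re|) * 2 = 1 + 2 * |m.re| by ring]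
    rw [hEy, Real.rpow_neg hx.le, Real.rpow_neg hy.le] at h1
    have hxp : 0 < x ^ (1 + 2 * |m.re|) := by positivity
    have hey : Real.exp (-(‖k‖ ^ 2 / ‖m‖) * y ^ 2) ≤ 1 := by
      refine Real.exp_le_one_iff.2 ?_
      have : 0 ≤ ‖k‖ ^ 2 / ‖m‖ * y ^ 2 := by positivity
      linarith
    have hexx : Real.exp (-(‖k‖ ^ 2 / ‖m‖) * x ^ 2) * Real.exp (‖k‖ ^ 2 / ‖m‖ * a ^ 2) ≥ 1 := by
      rw [← Real.exp_add]
      refine Real.one_le_exp ?_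
      have : ‖k‖ ^ 2 / ‖m‖ * x ^ 2 ≤ ‖k‖ ^ 2 / ‖m‖ * a ^ 2 := by gcongr
      linarith
    have hypow : y ^ 2 * (y ^ (1 + 2 * |m.re|))⁻¹ = y ^ (1 - 2 * |m.re|) := by
      rw [← Real.rpow_neg hy.le, ← Real.rpow_natCast, ← Real.rpow_add hy]
      congr 1
      push_cast
      ring
    have hE0 : 0 ≤ E := energy_nonneg _ _ _ _
    calc E ≤ E * (Real.exp (-(‖k‖ ^ 2 / ‖m‖) * x ^ 2) * Real.exp (‖k‖ ^ 2 / ‖m‖ * a ^ 2)) :=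
          le_mul_of_one_le_right hE0 hexx
      _ = (E * ((x ^ (1 + 2 * |m.re|))⁻¹ * Real.exp (-(‖k‖ ^ 2 / ‖m‖) * x ^ 2))) *
          (x ^ (1 + 2 * |m.re|) * Real.exp (‖k‖ ^ 2 / ‖m‖ * a ^ 2)) := by
          field_simp
      _ ≤ (2 * ‖w‖ ^ 2 * y ^ 2 * ((y ^ (1 + 2 * |m.re|))⁻¹ * 1)) *
          (x ^ (1 + 2 * |m.re|) * Real.exp (‖k‖ ^ 2 / ‖m‖ * a ^ 2)) := by
          refine mul_le_mul_of_nonneg_right (h1.trans ?_) (by positivity)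
          gcongr
      _ = _ := by
          rw [← hypow, hK]
          ring
  obtain ⟨b1, b2⟩ := hb _ _ x _ hx (by positivity) he
  constructor
  · rwa [mul_assoc]
  · rw [show -1 / 2 + |m.re| = (1 / 2 + |m.re|) - 1 by ring, Real.rpow_sub_one hx.ne',
      div_mul_eq_mul_div, ← mul_div_assoc, le_div_iff₀ hx]
    linarith

/-- A solution that is negligible at the origin compared to the regular behaviour vanishes. -/
theorem IsFreeSolution.eq_zero_of_isLittleO {m k : ℂ} (hm : m ≠ 0) {h₁ h₂ : ℝ → ℂ} {w : ℂ}
    (hp : IsFundamentalPair m k h₁ h₂ w) {e e' : ℝ → ℂ} (he : IsFreeSolution m k e e')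
    (o : e =o[𝓝[>] (0 : ℝ)] fun x => x ^ (1 / 2 + |m.re|))
    (o' : e' =o[𝓝[>] (0 : ℝ)] fun x => x ^ (-1 / 2 + |m.re|)) {x : ℝ} (hx : 0 < x) : e x = 0 := by
  -- The Wronskian with any solution is constant, and it tends to `0` at the origin because the
  -- exponents `±1/2 + |Re m|` and `∓1/2 - |Re m|` cancel.
  have key : ∀ h h' : ℝ → ℂ, IsFreeSolution m k h h' → e x * h' x - e' x * h x = 0 := by
    intro h h' hh
    obtain ⟨C, hC, hb⟩ := hh.bound_at_zero hm
    have hev := Ioo_mem_nhdsGT (zero_lt_one (α := ℝ))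
    have O : h =O[𝓝[>] (0 : ℝ)] fun x => x ^ (1 / 2 - |m.re|) := by
      refine IsBigO.of_bound C ?_
      filter_upwards [hev] with y hy
      rw [Real.norm_of_nonneg (Real.rpow_nonneg hy.1.le _)]
      exact (hb y hy.1 hy.2.le).1
    have O' : h' =O[𝓝[>] (0 : ℝ)] fun x => x ^ (-1 / 2 - |m.re|) := by
      refine IsBigO.of_bound C ?_
      filter_upwards [hev] with y hy
      rw [Real.norm_of_nonneg (Real.rpow_nonneg hy.1.le _)]
      exact (hb y hy.1 hy.2.le).2
    have l1 : (fun y => e y * h' y) =o[𝓝[>] (0 : ℝ)] fun _ => (1 : ℝ) := by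
      refine (o.mul_isBigO O').congr' EventuallyEq.rfl ?_
      filter_upwards [self_mem_nhdsWithin] with y hy
      rw [← Real.rpow_add hy]
      norm_num
    have l2 : (fun y => e' y * h y) =o[𝓝[>] (0 : ℝ)] fun _ => (1 : ℝ) := by
      refine (o'.mul_isBigO O).congr' EventuallyEq.rfl ?_
      filter_upwards [self_mem_nhdsWithin] with y hy
      rw [← Real.rpow_add hy]
      norm_num
    have l3 := (isLittleO_one_iff ℝ).1 (l1.sub l2)
    have l4 : Tendsto (fun y => e y * h' y - e' y * h y) (𝓝[>] (0 : ℝ))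
        (𝓝 (e x * h' x - e' x * h x)) := by
      refine tendsto_const_nhds.congr' ?_
      filter_upwards [self_mem_nhdsWithin] with y hy using he.wronskian_eq hh hx hy
    exact tendsto_nhds_unique l4 l3
  have k1 := key h₁ _ hp.left
  have k2 := key h₂ _ hp.right
  have hW := hp.2.2.2 x hx
  refine (mul_eq_zero.1 ?_).resolve_left hp.2.2.1
  rw [← hW]
  linear_combination h₁ x * k2 - h₂ x * k1

/-! ### Existence of fundamental pairs -/

theorem IsFreeSolution.isFundamentalPair {m k w : ℂ} {f f' g g' : ℝ → ℂ}
    (hf : IsFreeSolution m k f f') (hg : IsFreeSolution m k g g') (hw : w ≠ 0)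
    (hW : ∀ x, 0 < x → f x * g' x - f' x * g x = w) : IsFundamentalPair m k f g w :=
  ⟨hf.isEigensolution, hg.isEigensolution, hw, fun x hx => by
    rw [hf.deriv_eq hx, hg.deriv_eq hx, hW x hx]⟩

/-- A constant Wronskian can be evaluated at the singular point once its expression extends
continuously there. -/
theorem IsFreeSolution.wronskian_eq_limit {m k : ℂ} {f f' g g' : ℝ → ℂ}
    (hf : IsFreeSolution m k f f') (hg : IsFreeSolution m k g g') {Φ : ℝ → ℂ} (hΦ : Continuous Φ)
    (h : ∀ x, 0 < x → f x * g' x - f' x * g x = Φ x) {x : ℝ} (hx : 0 < x) :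
    f x * g' x - f' x * g x = Φ 0 := by
  have l1 : Tendsto Φ (𝓝[>] (0 : ℝ)) (𝓝 (Φ 0)) := hΦ.continuousAt.tendsto.mono_left inf_le_left
  have l2 : Tendsto Φ (𝓝[>] (0 : ℝ)) (𝓝 (f x * g' x - f' x * g x)) := by
    refine tendsto_const_nhds.congr' ?_
    filter_upwards [self_mem_nhdsWithin] with y hy
    rw [← h y hy, hf.wronskian_eq hg hx hy]
  exact tendsto_nhds_unique l2 l1

theorem IsFreeSolution.of_sq_eq {m m' k : ℂ} {f f' : ℝ → ℂ} (h : IsFreeSolution m k f f')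
    (hm : m' ^ 2 = m ^ 2) : IsFreeSolution m' k f f' := by
  intro x hx
  rw [hm]
  exact h x hx

theorem IsFundamentalPair.of_sq_eq {m m' k w : ℂ} {h₁ h₂ : ℝ → ℂ}
    (h : IsFundamentalPair m k h₁ h₂ w) (hm : m' ^ 2 = m ^ 2) : IsFundamentalPair m' k h₁ h₂ w :=
  (h.left.of_sq_eq hm).isFundamentalPair (h.right.of_sq_eq hm) h.2.2.1 h.2.2.2

theorem continuous_pser_sq {c : ℕ → ℂ} (h : ExpBounded c) :
    Continuous fun x : ℝ => pser c (x ^ 2) := h.continuous.comp (continuous_pow 2)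

/-- The logarithms cancel in the Wronskian, and what remains tends to `1` at the origin. -/
theorem isFundamentalPair_zero (k : ℂ) : IsFundamentalPair 0 k (u0 0 k) (p00 k) 1 := by
  have hu := u0_isFreeSolution 0 k
  have hp := p00_isFreeSolution k
  have hA := uCoeff_expBounded 0 k
  have hT := pCoeff_expBounded k
  refine hu.isFundamentalPair hp one_ne_zero fun x hx => ?_
  set Φ : ℝ → ℂ := fun x => pser (uCoeff 0 k) (x ^ 2) ^ 2 +
    2 * (x : ℂ) ^ 2 * (pser (coeffDeriv (uCoeff 0 k)) (x ^ 2) * pser (pCoeff k) (x ^ 2) -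
      pser (uCoeff 0 k) (x ^ 2) * pser (coeffDeriv (pCoeff k)) (x ^ 2)) with hΦ
  have hc : Continuous Φ := by
    have c1 := continuous_pser_sq hA
    have c2 := continuous_pser_sq hT
    have c3 := continuous_pser_sq hA.coeffDeriv
    have c4 := continuous_pser_sq hT.coeffDeriv
    fun_prop
  have h0 : Φ 0 = 1 := by
    have e : ((0 : ℝ) ^ 2) = 0 := by norm_num
    simp only [hΦ, e, pser_zero]
    simp [uCoeff]
  refine (hu.wronskian_eq_limit hp hc (fun y hy => ?_) hx).trans h0
  have hy' : (y : ℂ) ≠ 0 := Complex.ofReal_ne_zero.2 hy.ne'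
  have hP : (y : ℂ) ^ ((1 / 2 : ℂ) + 0) * (y : ℂ) ^ ((1 / 2 : ℂ) + 0) = y := by
    rw [← Complex.cpow_add _ _ hy']
    norm_num
  rw [u0_eq 0 k hy, p00_eq k hy]
  simp only [hΦ, pFactor, pFactorDeriv]
  generalize (y : ℂ) ^ ((1 / 2 : ℂ) + 0) = P at *
  have e1 : (y : ℂ) * (1 / y) = 1 := by field_simp
  linear_combination (pser (uCoeff 0 k) (y ^ 2) * (1 / (y : ℂ) * pser (uCoeff 0 k) (y ^ 2)) +
    2 * y * (pser (coeffDeriv (uCoeff 0 k)) (y ^ 2) * pser (pCoeff k) (y ^ 2) -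
      pser (uCoeff 0 k) (y ^ 2) * pser (coeffDeriv (pCoeff k)) (y ^ 2))) * hP +
      pser (uCoeff 0 k) (y ^ 2) ^ 2 * e1

theorem isFundamentalPair_euler {m : ℂ} (hm : m ≠ 0) :
    ∃ h₁ h₂ w, IsFundamentalPair m 0 h₁ h₂ w := by
  have hsol : ∀ μ : ℂ, IsFreeSolution μ 0 (fun x : ℝ => (x : ℂ) ^ (1 / 2 + μ) * 1)
      (fun x : ℝ => (x : ℂ) ^ (1 / 2 + μ) * ((1 / 2 + μ) / x * 1 + 0)) := fun μ =>
    isFreeSolution_cpow_mul (F := fun _ => 1) (F₁ := fun _ => 0) (F₂ := fun _ => 0)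
      (fun x _ => hasDerivAt_const x _) (fun x _ => hasDerivAt_const x _) fun x _ => by ring
  refine ⟨_, _, -2 * m, (hsol m).isFundamentalPair ((hsol (-m)).of_sq_eq (by ring))
    (mul_ne_zero (by norm_num) hm) fun x hx => ?_⟩
  have hx' : (x : ℂ) ≠ 0 := Complex.ofReal_ne_zero.2 hx.ne'
  have hP : (x : ℂ) ^ (1 / 2 + m) * (x : ℂ) ^ (1 / 2 + -m) = x := by
    rw [← Complex.cpow_add _ _ hx', show (1 / 2 + m) + (1 / 2 + -m) = 1 by ring, Complex.cpow_one]
  have e1 : (x : ℂ) * (1 / x) = 1 := by field_simp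
  linear_combination (-2 * m * (1 / (x : ℂ))) * hP - 2 * m * e1

/-- The pair is `u_m^0`, `u_{-m}^0`, with Wronskian `-2m / (Γ(1+m) Γ(1-m))`, nonzero away from the
integers. -/
theorem isFundamentalPair_of_not_int {m k : ℂ} (hm : ∀ n : ℤ, m ≠ n) :
    ∃ h₁ h₂ w, IsFundamentalPair m k h₁ h₂ w := by
  have h1 := u0_isFreeSolution m k
  have h2 := (u0_isFreeSolution (-m) k).of_sq_eq (m' := m) (by ring)
  have hA := uCoeff_expBounded m k
  have hB := uCoeff_expBounded (-m) k
  have hm0 : m ≠ 0 := by simpa using hm 0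
  set Φ : ℝ → ℂ := fun x => -2 * m * (pser (uCoeff m k) (x ^ 2) * pser (uCoeff (-m) k) (x ^ 2)) +
    2 * (x : ℂ) ^ 2 * (pser (uCoeff m k) (x ^ 2) * pser (coeffDeriv (uCoeff (-m) k)) (x ^ 2) -
      pser (coeffDeriv (uCoeff m k)) (x ^ 2) * pser (uCoeff (-m) k) (x ^ 2)) with hΦ
  have hc : Continuous Φ := by
    have c1 := continuous_pser_sq hA
    have c2 := continuous_pser_sq hB
    have c3 := continuous_pser_sq hA.coeffDeriv
    have c4 := continuous_pser_sq hB.coeffDeriv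
    fun_prop
  have hG : ∀ μ : ℂ, (∀ n : ℤ, μ ≠ n) → Complex.Gamma (μ + 1) ≠ 0 := by
    intro μ hμ
    refine Complex.Gamma_ne_zero fun n hn => hμ (-(n + 1)) ?_
    push_cast
    linear_combination hn
  have h0 : Φ 0 ≠ 0 := by
    have e : ((0 : ℝ) ^ 2) = 0 := by norm_num
    simp only [hΦ, e, pser_zero]
    have g1 := hG m hm
    have g2 := hG (-m) fun n hn => hm (-n) (by push_cast; linear_combination -hn)
    simp only [uCoeff, pow_zero, Nat.factorial_zero, Nat.cast_one, Nat.cast_zero, add_zero,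
      one_mul, Complex.ofReal_zero]
    rw [zero_pow two_ne_zero, mul_zero, zero_mul, add_zero]
    exact mul_ne_zero (mul_ne_zero (by norm_num) hm0)
      (mul_ne_zero (one_div_ne_zero g1) (one_div_ne_zero g2))
  refine ⟨_, _, Φ 0, h1.isFundamentalPair h2 h0 fun x hx =>
    h1.wronskian_eq_limit h2 hc (fun y hy => ?_) hx⟩
  have hy' : (y : ℂ) ≠ 0 := Complex.ofReal_ne_zero.2 hy.ne'
  have hP : (y : ℂ) ^ (1 / 2 + m) * (y : ℂ) ^ (1 / 2 + -m) = y := by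
    rw [← Complex.cpow_add _ _ hy', show (1 / 2 + m) + (1 / 2 + -m) = 1 by ring, Complex.cpow_one]
  have e1 : (y : ℂ) * (1 / y) = 1 := by field_simp
  rw [u0_eq m k hy, u0_eq (-m) k hy]
  simp only [hΦ]
  generalize pser (uCoeff m k) (y ^ 2) = A
  generalize pser (uCoeff (-m) k) (y ^ 2) = B
  generalize pser (coeffDeriv (uCoeff m k)) (y ^ 2) = A'
  generalize pser (coeffDeriv (uCoeff (-m) k)) (y ^ 2) = B'
  linear_combination (-2 * m * (1 / (y : ℂ)) * (A * B) + 2 * y * (A * B' - A' * B)) * hP -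
    2 * m * (A * B) * e1

/-- The recurrence that raises `m` by one. -/
theorem IsFreeSolution.raise {m k : ℂ} {f f' : ℝ → ℂ} (h : IsFreeSolution m k f f') :
    IsFreeSolution (m + 1) k (fun x : ℝ => f' x - (m + 1 / 2) / x * f x)
      (fun x : ℝ => ((m + 1 / 2) ^ 2 / (x : ℂ) ^ 2 + k ^ 2) * f x - (m + 1 / 2) / x * f' x) := by
  intro x hx
  have hx' : (x : ℂ) ≠ 0 := Complex.ofReal_ne_zero.2 hx.ne'
  obtain ⟨h1, h2⟩ := h x hx
  have hinv : HasDerivAt (fun x : ℝ => (m + 1 / 2) / (x : ℂ)) (-(m + 1 / 2) / (x : ℂ) ^ 2) x := by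
    have := (((hasDerivAt_id (x : ℂ)).inv hx').const_mul (m + 1 / 2)).comp_ofReal
    refine this.congr_deriv ?_
    simp only [id_eq]
    ring
  have hinv2 : HasDerivAt (fun x : ℝ => (m + 1 / 2) ^ 2 / (x : ℂ) ^ 2 + k ^ 2)
      (-2 * (m + 1 / 2) ^ 2 / (x : ℂ) ^ 3) x := by
    have := ((((hasDerivAt_id (x : ℂ)).pow 2).inv (pow_ne_zero 2 hx')).const_mul
      ((m + 1 / 2) ^ 2)).comp_ofReal.add_const (k ^ 2)
    refine this.congr_deriv ?_
    simp only [id_eq, Pi.pow_apply]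
    field_simp
    ring
  constructor
  · refine (h2.fun_sub (hinv.fun_mul h1)).congr_deriv ?_
    field_simp
    ring
  · refine ((hinv2.fun_mul h1).fun_sub (hinv.fun_mul h2)).congr_deriv ?_
    field_simp
    ring

/-- The operator `∂ - (m+1/2)/x` multiplies the Wronskian by `-k²`, so independence survives for `k
≠ 0`. -/
theorem IsFundamentalPair.raise {m k w : ℂ} (hk : k ≠ 0) {h₁ h₂ : ℝ → ℂ}
    (h : IsFundamentalPair m k h₁ h₂ w) : ∃ g₁ g₂ w', IsFundamentalPair (m + 1) k g₁ g₂ w' := by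
  refine ⟨_, _, -k ^ 2 * w, h.left.raise.isFundamentalPair h.right.raise
    (mul_ne_zero (neg_ne_zero.2 (pow_ne_zero 2 hk)) h.2.2.1) fun x hx => ?_⟩
  have hx' : (x : ℂ) ≠ 0 := Complex.ofReal_ne_zero.2 hx.ne'
  rw [← h.2.2.2 x hx]
  field_simp
  ring

/-- At integer `m` the functions `u_{±m}^0` are dependent. For `k ≠ 0` the pair at `m = 0` is raised
to `|m|`, only `m²` entering the equation; for `k = 0` the powers `x^{1/2±m}` serve, or the
logarithmic pair if `m = 0`. -/
theorem exists_isFundamentalPair (m k : ℂ) : ∃ h₁ h₂ w, IsFundamentalPair m k h₁ h₂ w := by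
  by_cases hm : ∀ n : ℤ, m ≠ n
  · exact isFundamentalPair_of_not_int hm
  push Not at hm
  obtain ⟨n, rfl⟩ := hm
  by_cases hk : k = 0
  · subst hk
    by_cases hn : (n : ℂ) = 0
    · rw [hn]
      exact ⟨_, _, _, isFundamentalPair_zero 0⟩
    · exact isFundamentalPair_euler hn
  · have key : ∀ N : ℕ, ∃ h₁ h₂ w, IsFundamentalPair (N : ℂ) k h₁ h₂ w := by
      intro N
      induction N with
      | zero =>
        rw [Nat.cast_zero]
        exact ⟨_, _, _, isFundamentalPair_zero k⟩
      | succ N ih =>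
        obtain ⟨h₁, h₂, w, h⟩ := ih
        rw [Nat.cast_succ]
        exact h.raise hk
    obtain ⟨h₁, h₂, w, h⟩ := key n.natAbs
    refine ⟨h₁, h₂, w, h.of_sq_eq ?_⟩
    rw [← Int.cast_natCast, ← Int.cast_pow, ← Int.cast_pow, Int.natAbs_sq]

/-! ### Bounds for `m = 0` -/

theorem norm_cpow_half {x : ℝ} (hx : 0 < x) :
    ‖(x : ℂ) ^ ((1 / 2 : ℂ) + 0)‖ = x ^ (1 / 2 : ℝ) := by
  rw [norm_cpow_half_add 0 hx]
  simp

theorem exists_bound_series (k : ℂ) (a : ℝ) : ∃ M : ℝ, 0 ≤ M ∧ ∀ x, 0 < x → x ≤ a →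
    ‖pser (uCoeff 0 k) (x ^ 2)‖ ≤ M ∧ ‖pser (pCoeff k) (x ^ 2)‖ ≤ M ∧
    ‖pser (coeffDeriv (uCoeff 0 k)) (x ^ 2)‖ ≤ M ∧ ‖pser (coeffDeriv (pCoeff k)) (x ^ 2)‖ ≤ M := by
  obtain ⟨C₁, p₁, b₁⟩ := exists_bound_sq (uCoeff_expBounded 0 k).continuous a
  obtain ⟨C₂, p₂, b₂⟩ := exists_bound_sq (pCoeff_expBounded k).continuous a
  obtain ⟨C₃, p₃, b₃⟩ := exists_bound_sq (uCoeff_expBounded 0 k).coeffDeriv.continuous a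
  obtain ⟨C₄, p₄, b₄⟩ := exists_bound_sq (pCoeff_expBounded k).coeffDeriv.continuous a
  refine ⟨C₁ + C₂ + C₃ + C₄, by positivity, fun x hx hxa => ⟨?_, ?_, ?_, ?_⟩⟩
  · linarith [b₁ x hx hxa]
  · linarith [b₂ x hx hxa]
  · linarith [b₃ x hx hxa]
  · linarith [b₄ x hx hxa]

theorem p00_bound (k : ℂ) (a : ℝ) : ∃ C : ℝ, 0 ≤ C ∧ ∀ x, 0 < x → x ≤ a →
    ‖p00 k x‖ ≤ C * (x ^ (1 / 2 : ℝ) * (1 + |Real.log x|)) := by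
  obtain ⟨M, hM, hb⟩ := exists_bound_series k a
  refine ⟨M, hM, fun x hx hxa => ?_⟩
  obtain ⟨b1, b2, -, -⟩ := hb x hx hxa
  rw [p00_eq k hx, norm_mul, norm_cpow_half hx]
  have h : ‖(Real.log x : ℂ) * pser (uCoeff 0 k) (x ^ 2) - pser (pCoeff k) (x ^ 2)‖ ≤
      |Real.log x| * M + M := by
    refine (norm_sub_le _ _).trans ?_
    rw [norm_mul, Complex.norm_real, Real.norm_eq_abs]
    gcongr
  calc x ^ (1 / 2 : ℝ) * _ ≤ x ^ (1 / 2 : ℝ) * (|Real.log x| * M + M) := by gcongr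
    _ = _ := by ring

/-- By antisymmetry the logarithms enter only through `ℓ = ln x - ln y`, both in the kernel and in
its derivative. -/
theorem green_bound_zero (k : ℂ) (a : ℝ) : ∃ C : ℝ, 0 ≤ C ∧
    ∀ x y, 0 < y → y ≤ x → x ≤ a →
      ‖u0 0 k x * p00 k y - p00 k x * u0 0 k y‖ ≤
        C * (x ^ (1 / 2 : ℝ) * y ^ (1 / 2 : ℝ) * (1 + (Real.log x - Real.log y))) ∧
      ‖deriv (u0 0 k) x * p00 k y - deriv (p00 k) x * u0 0 k y‖ ≤
        C * (x ^ (-1 / 2 : ℝ) * y ^ (1 / 2 : ℝ) * (1 + (Real.log x - Real.log y))) := by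
  obtain ⟨M, hM, hb⟩ := exists_bound_series k a
  -- `3 M² (1+ℓ)` bounds each bracket of three products; the derivative involves two brackets and
  -- one product with weights `1/2`, `2x²` and `1`, whose sum is at most `2 + 2a²`.
  refine ⟨(2 + 2 * a ^ 2) * (3 * M ^ 2), by positivity, fun x y hy hyx hxa => ?_⟩
  have hx : 0 < x := hy.trans_le hyx
  have hx' : (x : ℂ) ≠ 0 := Complex.ofReal_ne_zero.2 hx.ne'
  obtain ⟨a1, a2, a3, a4⟩ := hb x hx hxa
  obtain ⟨c1, c2, -, -⟩ := hb y hy (hyx.trans hxa)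
  have hlog : 0 ≤ Real.log x - Real.log y := sub_nonneg.2 (Real.log_le_log hy hyx)
  rw [(u0_isFreeSolution 0 k).deriv_eq hx, (p00_isFreeSolution k).deriv_eq hx, u0_eq 0 k hx,
    u0_eq 0 k hy, p00_eq k hx, p00_eq k hy]
  simp only [pFactor, pFactorDeriv]
  have nx := norm_cpow_half hx
  have ny := norm_cpow_half hy
  generalize (x : ℂ) ^ ((1 / 2 : ℂ) + 0) = P at *
  generalize (y : ℂ) ^ ((1 / 2 : ℂ) + 0) = R at *
  generalize pser (uCoeff 0 k) (x ^ 2) = A at *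
  generalize pser (pCoeff k) (x ^ 2) = T at *
  generalize pser (coeffDeriv (uCoeff 0 k)) (x ^ 2) = A' at *
  generalize pser (coeffDeriv (pCoeff k)) (x ^ 2) = T' at *
  generalize pser (uCoeff 0 k) (y ^ 2) = B at *
  generalize pser (pCoeff k) (y ^ 2) = S at *
  set ℓ : ℝ := Real.log x - Real.log y with hℓ
  have hℓc : (Real.log y : ℂ) = Real.log x - (ℓ : ℂ) := by rw [hℓ]; push_cast; ring
  have nℓ : ‖(ℓ : ℂ)‖ = ℓ := by rw [Complex.norm_real, Real.norm_of_nonneg hlog]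
  rw [hℓc]
  generalize (Real.log x : ℂ) = L
  have bound3 : ∀ p q r s t v : ℂ, ‖p‖ ≤ M → ‖q‖ ≤ M → ‖r‖ ≤ M → ‖s‖ ≤ M → ‖t‖ ≤ M → ‖v‖ ≤ M →
      ‖-(ℓ : ℂ) * (p * q) - r * s + t * v‖ ≤ 3 * M ^ 2 * (1 + ℓ) := by
    intro p q r s t v hp hq hr hs ht hv
    have e1 : ‖p‖ * ‖q‖ ≤ M * M := mul_le_mul hp hq (norm_nonneg _) hM
    have e2 : ‖r‖ * ‖s‖ ≤ M * M := mul_le_mul hr hs (norm_nonneg _) hM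
    have e3 : ‖t‖ * ‖v‖ ≤ M * M := mul_le_mul ht hv (norm_nonneg _) hM
    calc ‖-(ℓ : ℂ) * (p * q) - r * s + t * v‖ ≤ ‖-(ℓ : ℂ) * (p * q)‖ + ‖r * s‖ + ‖t * v‖ :=
          (norm_add_le _ _).trans (add_le_add_left (norm_sub_le _ _) _)
      _ = ℓ * (‖p‖ * ‖q‖) + ‖r‖ * ‖s‖ + ‖t‖ * ‖v‖ := by
          rw [norm_mul, norm_neg, nℓ, norm_mul, norm_mul, norm_mul]
      _ ≤ ℓ * (M * M) + M * M + M * M := by gcongr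
      _ ≤ _ := by nlinarith [mul_nonneg hM hM, mul_nonneg hlog (mul_nonneg hM hM)]
  have n1 := bound3 A B A S T B a1 c1 a1 c2 a2 c1
  have n2 := bound3 A' B A' S T' B a3 c1 a3 c2 a4 c1
  have n3 : ‖A * B‖ ≤ 3 * M ^ 2 * (1 + ℓ) := by
    rw [norm_mul]
    have e1 : ‖A‖ * ‖B‖ ≤ M * M := mul_le_mul a1 c1 (norm_nonneg _) hM
    nlinarith [mul_nonneg hM hM, mul_nonneg hlog (mul_nonneg hM hM)]
  have hx2 : x ^ 2 ≤ a ^ 2 := by gcongr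
  have hpos : 0 ≤ 3 * M ^ 2 * (1 + ℓ) := by positivity
  constructor
  · have e : P * A * (R * ((L - ℓ) * B - S)) - P * (L * A - T) * (R * B) =
        P * R * (-(ℓ : ℂ) * (A * B) - A * S + T * B) := by ring
    rw [e, norm_mul, norm_mul, nx, ny]
    calc x ^ (1 / 2 : ℝ) * y ^ (1 / 2 : ℝ) * ‖-(ℓ : ℂ) * (A * B) - A * S + T * B‖
        ≤ x ^ (1 / 2 : ℝ) * y ^ (1 / 2 : ℝ) * ((2 + 2 * a ^ 2) * (3 * M ^ 2 * (1 + ℓ))) := by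
          gcongr
          refine n1.trans ?_
          exact le_mul_of_one_le_left hpos (by nlinarith [sq_nonneg a])
      _ = _ := by ring
  · have e : P * ((1 / 2 + 0) / (x : ℂ) * A + 2 * x * A') * (R * ((L - ℓ) * B - S)) -
        P * ((1 / 2 + 0) / (x : ℂ) * (L * A - T) + (1 / (x : ℂ) * A + L * (2 * x * A') -
          2 * x * T')) * (R * B) =
        P * R / x * (1 / 2 * (-(ℓ : ℂ) * (A * B) - A * S + T * B) +
          2 * (x : ℂ) ^ 2 * (-(ℓ : ℂ) * (A' * B) - A' * S + T' * B) - A * B) := by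
      field_simp
      ring
    rw [e, norm_mul, norm_div, norm_mul, nx, ny, Complex.norm_real, Real.norm_of_nonneg hx.le,
      show (-1 / 2 : ℝ) = 1 / 2 - 1 by norm_num, Real.rpow_sub_one hx.ne']
    have n4 : ‖1 / 2 * (-(ℓ : ℂ) * (A * B) - A * S + T * B) +
          2 * (x : ℂ) ^ 2 * (-(ℓ : ℂ) * (A' * B) - A' * S + T' * B) - A * B‖ ≤
        (2 + 2 * a ^ 2) * (3 * M ^ 2 * (1 + ℓ)) := by
      refine (norm_sub_le _ _).trans ?_
      have t1 : ‖(1 / 2 : ℂ) * (-(ℓ : ℂ) * (A * B) - A * S + T * B)‖ ≤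
          1 / 2 * (3 * M ^ 2 * (1 + ℓ)) := by
        rw [norm_mul]
        have : ‖(1 / 2 : ℂ)‖ = 1 / 2 := by norm_num
        rw [this]
        gcongr
      have t2 : ‖2 * (x : ℂ) ^ 2 * (-(ℓ : ℂ) * (A' * B) - A' * S + T' * B)‖ ≤
          2 * a ^ 2 * (3 * M ^ 2 * (1 + ℓ)) := by
        rw [norm_mul, norm_mul, norm_pow, Complex.norm_real, Real.norm_of_nonneg hx.le]
        simp only [RCLike.norm_ofNat]
        gcongr
      have t3 := norm_add_le ((1 / 2 : ℂ) * (-(ℓ : ℂ) * (A * B) - A * S + T * B))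
        (2 * (x : ℂ) ^ 2 * (-(ℓ : ℂ) * (A' * B) - A' * S + T' * B))
      nlinarith
    calc x ^ (1 / 2 : ℝ) * y ^ (1 / 2 : ℝ) / x * _
        ≤ x ^ (1 / 2 : ℝ) * y ^ (1 / 2 : ℝ) / x * ((2 + 2 * a ^ 2) * (3 * M ^ 2 * (1 + ℓ))) := by
          gcongr
      _ = _ := by ring

/-- Because of the logarithm in `p_0^0` the hypotheses do not force the Wronskian with it to tend to
`0`. The Wronskian with `u_0^0` does, which gives `e = c u_0^0`; then `u_0^0 ~ x^{1/2}` forces `c =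
0`. -/
theorem IsFreeSolution.eq_zero_of_isLittleO_zero {k : ℂ} {e e' : ℝ → ℂ}
    (he : IsFreeSolution 0 k e e')
    (o : e =o[𝓝[>] (0 : ℝ)] fun x => x ^ (1 / 2 : ℝ))
    (o' : e' =o[𝓝[>] (0 : ℝ)] fun x => x ^ (-1 / 2 : ℝ)) {x : ℝ} (hx : 0 < x) : e x = 0 := by
  have hu := u0_isFreeSolution 0 k
  have hp := p00_isFreeSolution k
  have hpair := isFundamentalPair_zero k
  set u' : ℝ → ℂ := fun x : ℝ => (x : ℂ) ^ ((1 / 2 : ℂ) + 0) *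
      ((1 / 2 + 0) / x * pser (uCoeff 0 k) (x ^ 2) +
        2 * x * pser (coeffDeriv (uCoeff 0 k)) (x ^ 2)) with hu'
  obtain ⟨M, hM, hb⟩ := exists_bound_series k 1
  have hev := Ioo_mem_nhdsGT (zero_lt_one (α := ℝ))
  have O : u0 0 k =O[𝓝[>] (0 : ℝ)] fun x => x ^ (1 / 2 : ℝ) := by
    refine IsBigO.of_bound M ?_
    filter_upwards [hev] with y hy
    have hy0 := hy.1
    rw [Real.norm_of_nonneg (Real.rpow_nonneg hy.1.le _), u0_eq 0 k hy.1, norm_mul,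
      norm_cpow_half hy.1, mul_comm]
    gcongr
    exact (hb y hy.1 hy.2.le).1
  have O' : u' =O[𝓝[>] (0 : ℝ)] fun x => x ^ (-1 / 2 : ℝ) := by
    refine IsBigO.of_bound (3 * M) ?_
    filter_upwards [hev] with y hy
    have hy0 := hy.1
    have hy' : (y : ℂ) ≠ 0 := Complex.ofReal_ne_zero.2 hy.1.ne'
    obtain ⟨b1, -, b3, -⟩ := hb y hy.1 hy.2.le
    have e1 : u' y = (y : ℂ) ^ ((1 / 2 : ℂ) + 0) / y * (1 / 2 * pser (uCoeff 0 k) (y ^ 2) +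
        2 * (y : ℂ) ^ 2 * pser (coeffDeriv (uCoeff 0 k)) (y ^ 2)) := by
      simp only [hu']
      field_simp
      ring
    rw [Real.norm_of_nonneg (Real.rpow_nonneg hy.1.le _), e1, norm_mul, norm_div,
      norm_cpow_half hy.1, Complex.norm_real, Real.norm_of_nonneg hy.1.le,
      show (-1 / 2 : ℝ) = 1 / 2 - 1 by norm_num, Real.rpow_sub_one hy.1.ne', mul_comm]
    gcongr
    · refine (norm_add_le _ _).trans ?_
      rw [norm_mul, norm_mul, norm_mul, norm_pow, Complex.norm_real, Real.norm_of_nonneg hy.1.le]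
      have hh : ‖(1 / 2 : ℂ)‖ = 1 / 2 := by norm_num
      rw [hh]
      simp only [RCLike.norm_ofNat]
      have hy2 : y ^ 2 ≤ 1 := pow_le_one₀ hy.1.le hy.2.le
      have : 2 * y ^ 2 * ‖pser (coeffDeriv (uCoeff 0 k)) (y ^ 2)‖ ≤ 2 * 1 * M := by gcongr
      linarith [norm_nonneg (pser (uCoeff 0 k) (y ^ 2))]
  have l1 : (fun y => e y * u' y) =o[𝓝[>] (0 : ℝ)] fun _ => (1 : ℝ) := by
    refine (o.mul_isBigO O').congr' EventuallyEq.rfl ?_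
    filter_upwards [self_mem_nhdsWithin] with y hy
    rw [← Real.rpow_add hy]
    norm_num
  have l2 : (fun y => e' y * u0 0 k y) =o[𝓝[>] (0 : ℝ)] fun _ => (1 : ℝ) := by
    refine (o'.mul_isBigO O).congr' EventuallyEq.rfl ?_
    filter_upwards [self_mem_nhdsWithin] with y hy
    rw [← Real.rpow_add hy]
    norm_num
  have l3 := (isLittleO_one_iff ℝ).1 (l1.sub l2)
  have hWu : ∀ y, 0 < y → e y * u' y - e' y * u0 0 k y = 0 := by
    intro y hy
    have l4 : Tendsto (fun z => e z * u' z - e' z * u0 0 k z) (𝓝[>] (0 : ℝ))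
        (𝓝 (e y * u' y - e' y * u0 0 k y)) := by
      refine tendsto_const_nhds.congr' ?_
      filter_upwards [self_mem_nhdsWithin] with z hz using he.wronskian_eq hu hy hz
    exact tendsto_nhds_unique l4 l3
  set c : ℂ := e x * deriv (p00 k) x - e' x * p00 k x with hc
  have hecu : ∀ y, 0 < y → e y = c * u0 0 k y := by
    intro y hy
    have h1 := hWu y hy
    have h2 := hpair.2.2.2 y hy
    have h3 := he.wronskian_eq hpair.right hx hy
    rw [hu.deriv_eq hy] at h2
    change u0 0 k y * deriv (p00 k) y - u' y * p00 k y = 1 at h2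
    rw [hc, h3]
    linear_combination (-e y) * h2 - p00 k y * h1
  have lim1 : Tendsto (fun y : ℝ => c * pser (uCoeff 0 k) (y ^ 2)) (𝓝[>] (0 : ℝ)) (𝓝 (c * 1)) := by
    have h := ((continuous_pser_sq (uCoeff_expBounded 0 k)).const_mul c).continuousAt (x := (0 : ℝ))
    have e0 : pser (uCoeff 0 k) ((0 : ℝ) ^ 2) = 1 := by
      rw [show ((0 : ℝ) ^ 2) = 0 by norm_num, pser_zero]
      simp [uCoeff]
    have h' := h.tendsto.mono_left (inf_le_left : 𝓝[>] (0 : ℝ) ≤ 𝓝 0)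
    simp only [e0] at h'
    exact h'
  have lim0 : Tendsto (fun y : ℝ => c * pser (uCoeff 0 k) (y ^ 2)) (𝓝[>] (0 : ℝ)) (𝓝 0) := by
    refine (isLittleO_one_iff ℝ).1 ?_
    have o2 : (fun y : ℝ => (y : ℂ) ^ (-((1 / 2 : ℂ) + 0)) * e y) =o[𝓝[>] (0 : ℝ)]
        fun y => y ^ (-(1 / 2) : ℝ) * y ^ (1 / 2 : ℝ) := by
      refine IsBigO.mul_isLittleO (IsBigO.of_bound 1 ?_) o
      filter_upwards [self_mem_nhdsWithin] with y hy
      rw [Complex.norm_cpow_eq_rpow_re_of_pos hy, Real.norm_of_nonneg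
        (Real.rpow_nonneg (le_of_lt hy) _)]
      simp
    refine o2.congr' ?_ ?_
    · filter_upwards [self_mem_nhdsWithin] with y hy
      have hy' : (y : ℂ) ≠ 0 := Complex.ofReal_ne_zero.2 (ne_of_gt hy)
      have hz : (y : ℂ) ^ (-((1 / 2 : ℂ) + 0)) * (y : ℂ) ^ ((1 / 2 : ℂ) + 0) = 1 := by
        rw [← Complex.cpow_add _ _ hy', neg_add_cancel, Complex.cpow_zero]
      rw [hecu y hy, u0_eq 0 k hy]
      linear_combination (c * pser (uCoeff 0 k) (y ^ 2)) * hz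
    · filter_upwards [self_mem_nhdsWithin] with y hy
      rw [← Real.rpow_add hy]
      norm_num
  have hc0 : c = 0 := by simpa using tendsto_nhds_unique lim1 lim0
  rw [hecu x hx, hc0, zero_mul]

/-! ### Admissibility of the perturbations -/

/-- The hypothesis covers `]0,1[`; on `[1,a]` local integrability of `Q` suffices. -/
theorem integrableOn_majorant {Q : ℝ → ℂ} (hQ : LocallyIntegrableOn Q (Ioi 0)) {ω ω' : ℝ → ℝ}
    {C : ℝ} (hω : ContinuousOn ω (Ioi 0)) (h0 : ∀ x, 0 < x → 0 ≤ ω x)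
    (hle : ∀ x, 0 < x → ω x ≤ C * ω' x)
    (hI : IntegrableOn (fun x => ω' x * ‖Q x‖) (Ioo 0 1)) (a : ℝ) :
    IntegrableOn (fun y => ω y * ‖Q y‖) (Ioc 0 a) := by
  have hs : Icc (1 : ℝ) a ⊆ Ioi 0 := fun x hx => lt_of_lt_of_le one_pos hx.1
  have i1 : IntegrableOn (fun y => ω y * ‖Q y‖) (Ioo 0 1) := by
    refine Integrable.mono' (hI.const_mul C) ?_ ?_
    · exact ((hω.mono Ioo_subset_Ioi_self).aestronglyMeasurable measurableSet_Ioo).mul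
        (hQ.aestronglyMeasurable.mono_set Ioo_subset_Ioi_self).norm
    · filter_upwards [ae_mem_Ioo 1] with x hx
      rw [norm_mul, norm_norm, Real.norm_of_nonneg (h0 x hx.1), ← mul_assoc]
      gcongr
      exact hle x hx.1
  have i2 : IntegrableOn (fun y => ω y * ‖Q y‖) (Icc 1 a) :=
    IntegrableOn.continuousOn_mul (hω.mono hs)
      (hQ.integrableOn_compact_subset hs isCompact_Icc).norm isCompact_Icc
  refine (i1.union i2).mono_set fun x hx => ?_
  rcases lt_or_ge x 1 with h | h
  · exact Or.inl ⟨hx.1, h⟩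
  · exact Or.inr ⟨h, hx.2⟩

theorem rpow_le_const_mul_rpow {p q : ℝ} (h : p ≤ q) {a x : ℝ} (hx : 0 < x) (hxa : x ≤ a) :
    x ^ q ≤ a ^ (q - p) * x ^ p := by
  have e : x ^ q = x ^ (q - p) * x ^ p := by
    rw [← Real.rpow_add hx]
    congr 1
    ring
  rw [e]
  have : 0 ≤ q - p := sub_nonneg.2 h
  gcongr

/-- Kernel times weight carries `y^{1/2-|Re m|} y^{1/2+Re m} = y^{Re m+ε-|Re m|} y^{1-ε}`. The
condition on `ε` says exactly that `ε ≥ 0` and `Re m + ε ≥ |Re m|`, so by `y ≤ x` the first power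
may be replaced by the same power of `x`. -/
theorem admissible_of_ne_zero {m k : ℂ} (hm : m ≠ 0) {Q : ℝ → ℂ} {ε : ℝ}
    (hε : 2 * max (-m.re) 0 ≤ ε) (hQ : L0 ε Q) :
    Admissible m k Q (fun x => x ^ (1 / 2 + m.re)) (fun y => y ^ (1 - ε)) (m.re + ε) := by
  have hε0 : 0 ≤ ε := (mul_nonneg zero_le_two (le_max_right _ _)).trans hε
  have hr : |m.re| ≤ m.re + ε := by
    have := le_max_left (-m.re) 0
    exact abs_le'.2 ⟨by linarith, by linarith⟩
  have hcont : ∀ p : ℝ, ContinuousOn (fun x : ℝ => x ^ p) (Ioi 0) := fun p x hx =>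
    (Real.continuousAt_rpow_const x p (Or.inl (ne_of_gt hx))).continuousWithinAt
  refine ⟨fun x hx => Real.rpow_pos_of_pos hx _, hcont _, fun a ha => ?_,
    hQ.1.aestronglyMeasurable, fun x hx => Real.rpow_nonneg hx.le _, fun a _ => ?_, ?_⟩
  · exact ⟨_, Real.rpow_nonneg ha.le _, fun x hx hxa =>
      rpow_le_const_mul_rpow (by linarith) hx hxa⟩
  · exact integrableOn_majorant hQ.1 (hcont _) (fun x hx => Real.rpow_nonneg hx.le _) (C := 1)
      (fun x _ => by rw [one_mul]) hQ.2 a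
  · intro h₁ h₂ w hp a _
    obtain ⟨C, hC, hG⟩ := hp.green_bound hm a
    refine ⟨C, hC, fun x y hy hyx hxa => ?_⟩
    have hx : 0 < x := hy.trans_le hyx
    have aux : ∀ q : ℝ, x ^ (q + |m.re|) * y ^ (1 / 2 - |m.re|) * y ^ (1 / 2 + m.re) ≤
        x ^ (q + (m.re + ε)) * y ^ (1 - ε) := by
      intro q
      have e1 : x ^ (q + (m.re + ε)) = x ^ (q + |m.re|) * x ^ (m.re + ε - |m.re|) := by
        rw [← Real.rpow_add hx]
        congr 1
        ring
      have e2 : y ^ (1 / 2 - |m.re|) * y ^ (1 / 2 + m.re) =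
          y ^ (m.re + ε - |m.re|) * y ^ (1 - ε) := by
        rw [← Real.rpow_add hy, ← Real.rpow_add hy]
        congr 1
        ring
      rw [mul_assoc, e2, e1, ← mul_assoc]
      have : 0 ≤ m.re + ε - |m.re| := by linarith
      gcongr
    obtain ⟨b1, b2⟩ := hG x y hy hyx hxa
    constructor
    · calc _ ≤ C * (x ^ (1 / 2 + |m.re|) * y ^ (1 / 2 - |m.re|)) * y ^ (1 / 2 + m.re) := by gcongr
        _ = C * (x ^ (1 / 2 + |m.re|) * y ^ (1 / 2 - |m.re|) * y ^ (1 / 2 + m.re)) := by ring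
        _ ≤ C * (x ^ (1 / 2 + (m.re + ε)) * y ^ (1 - ε)) :=
          mul_le_mul_of_nonneg_left (aux _) hC
        _ = _ := by ring
    · calc _ ≤ C * (x ^ (-1 / 2 + |m.re|) * y ^ (1 / 2 - |m.re|)) * y ^ (1 / 2 + m.re) := by gcongr
        _ = C * (x ^ (-1 / 2 + |m.re|) * y ^ (1 / 2 - |m.re|) * y ^ (1 / 2 + m.re)) := by ring
        _ ≤ C * (x ^ (-1 / 2 + (m.re + ε)) * y ^ (1 - ε)) :=
          mul_le_mul_of_nonneg_left (aux _) hC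
        _ = _ := by ring

/-- The weights `x^{1/2} (1 + |ln x|)^j` for `m = 0`. -/
theorem admissible_zero (k : ℂ) {Q : ℝ → ℂ} {ε : ℝ} (hε : 0 ≤ ε) (j : ℕ)
    (hQ : LocallyIntegrableOn Q (Ioi 0))
    (hI : ∀ a, IntegrableOn (fun y : ℝ => y ^ (1 - ε) * (1 + |Real.log y|) ^ (j + 1) * ‖Q y‖)
      (Ioc 0 a)) :
    Admissible 0 k Q (fun x => x ^ (1 / 2 : ℝ) * (1 + |Real.log x|) ^ j)
      (fun y => y ^ (1 - ε) * (1 + |Real.log y|) ^ (j + 1)) ε := by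
  have hone : ∀ x : ℝ, (1 : ℝ) ≤ 1 + |Real.log x| := fun x => by
    have := abs_nonneg (Real.log x)
    linarith
  refine ⟨fun x hx => ?_, ?_, fun a ha => ?_, hQ.aestronglyMeasurable, fun x hx => ?_,
    fun a _ => hI a, ?_⟩
  · exact mul_pos (Real.rpow_pos_of_pos hx _) (pow_pos (by linarith [hone x]) _)
  · intro x hx
    have hx0 : x ≠ 0 := ne_of_gt hx
    exact ((Real.continuousAt_rpow_const x _ (Or.inl hx0)).mul
      ((continuousAt_const.add (Real.continuousAt_log hx0).abs).pow j)).continuousWithinAt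
  · refine ⟨a ^ ((1 / 2 + ε) - 1 / 2), Real.rpow_nonneg ha.le _, fun x hx hxa =>
      (rpow_le_const_mul_rpow (p := 1 / 2) (by linarith) hx hxa).trans ?_⟩
    refine mul_le_mul_of_nonneg_left ?_ (Real.rpow_nonneg ha.le _)
    exact le_mul_of_one_le_right (Real.rpow_nonneg hx.le _) (one_le_pow₀ (hone x))
  · exact mul_nonneg (Real.rpow_nonneg hx.le _) (pow_nonneg (by linarith [hone x]) _)
  · intro h₁ h₂ w hp a ha
    obtain ⟨C, hC, hG⟩ := green_bound_zero k a
    refine ⟨‖w‖ * C * (1 + |Real.log a|), by positivity, fun x y hy hyx hxa => ?_⟩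
    have hx : 0 < x := hy.trans_le hyx
    obtain ⟨b1, b2⟩ := hG x y hy hyx hxa
    -- The normalized kernel does not depend on the pair, so the estimate for the explicit pair of
    -- Wronskian `1` transfers at the cost of a factor `‖w‖`.
    obtain ⟨e1, e2⟩ := hp.forwardGreen_eq (isFundamentalPair_zero k) hx hy
    have hw := hp.2.2.1
    rw [div_one, div_eq_iff hw] at e1 e2
    -- The kernel costs one factor `1 + |ln y|`: this is why the majorant has exponent `j + 1`.
    have hlog : 1 + (Real.log x - Real.log y) ≤ (1 + |Real.log a|) * (1 + |Real.log y|) := by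
      have l1 : Real.log x ≤ |Real.log a| := (Real.log_le_log hx hxa).trans (le_abs_self _)
      have l2 := neg_le_abs (Real.log y)
      nlinarith [mul_nonneg (abs_nonneg (Real.log a)) (abs_nonneg (Real.log y))]
    have hyy : y ^ (1 / 2 : ℝ) * y ^ (1 / 2 : ℝ) ≤ x ^ ε * y ^ (1 - ε) := by
      have : y ^ (1 / 2 : ℝ) * y ^ (1 / 2 : ℝ) = y ^ ε * y ^ (1 - ε) := by
        rw [← Real.rpow_add hy, ← Real.rpow_add hy]
        congr 1
        ring
      rw [this]
      gcongr
    have hlog0 : 0 ≤ 1 + (Real.log x - Real.log y) := by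
      have := Real.log_le_log hy hyx
      linarith
    have aux : ∀ (q : ℝ) (z : ℂ),
        ‖z‖ ≤ C * (x ^ q * y ^ (1 / 2 : ℝ) * (1 + (Real.log x - Real.log y))) →
        ‖z * w‖ * (y ^ (1 / 2 : ℝ) * (1 + |Real.log y|) ^ j) ≤
          ‖w‖ * C * (1 + |Real.log a|) * x ^ (q + ε) *
            (y ^ (1 - ε) * (1 + |Real.log y|) ^ (j + 1)) := by
      intro q z hz
      have := hone y
      rw [norm_mul, Real.rpow_add hx]
      calc ‖z‖ * ‖w‖ * (y ^ (1 / 2 : ℝ) * (1 + |Real.log y|) ^ j)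
          ≤ C * (x ^ q * y ^ (1 / 2 : ℝ) * (1 + (Real.log x - Real.log y))) * ‖w‖ *
            (y ^ (1 / 2 : ℝ) * (1 + |Real.log y|) ^ j) := by gcongr
        _ = ‖w‖ * C * x ^ q * (y ^ (1 / 2 : ℝ) * y ^ (1 / 2 : ℝ)) *
            (1 + (Real.log x - Real.log y)) * (1 + |Real.log y|) ^ j := by ring
        _ ≤ ‖w‖ * C * x ^ q * (x ^ ε * y ^ (1 - ε)) *
            ((1 + |Real.log a|) * (1 + |Real.log y|)) * (1 + |Real.log y|) ^ j := by gcongr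
        _ = _ := by ring
    rw [e1, e2]
    exact ⟨aux _ _ b1, aux _ _ b2⟩

theorem continuousOn_log_majorant (p : ℝ) (j : ℕ) :
    ContinuousOn (fun y : ℝ => y ^ p * (1 + |Real.log y|) ^ j) (Ioi 0) := by
  intro x hx
  have hx0 : x ≠ 0 := ne_of_gt hx
  exact ((Real.continuousAt_rpow_const x _ (Or.inl hx0)).mul
    ((continuousAt_const.add (Real.continuousAt_log hx0).abs).pow j)).continuousWithinAt

theorem log_majorant_nonneg (p : ℝ) (j : ℕ) (x : ℝ) (hx : 0 < x) :
    0 ≤ x ^ p * (1 + |Real.log x|) ^ j := by positivity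

theorem L0ln.integrableOn_one {ε : ℝ} {Q : ℝ → ℂ} (hQ : L0ln ε 1 Q) (a : ℝ) :
    IntegrableOn (fun y : ℝ => y ^ (1 - ε) * (1 + |Real.log y|) ^ (0 + 1) * ‖Q y‖) (Ioc 0 a) := by
  refine integrableOn_majorant hQ.1 (continuousOn_log_majorant _ _) (log_majorant_nonneg _ _)
    (C := 1) (fun x hx => ?_) hQ.2 a
  rw [Real.rpow_one, one_mul, zero_add, pow_one]

theorem L0ln.integrableOn_two {ε : ℝ} {Q : ℝ → ℂ} (hQ : L0ln ε 2 Q) (a : ℝ) :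
    IntegrableOn (fun y : ℝ => y ^ (1 - ε) * (1 + |Real.log y|) ^ (1 + 1) * ‖Q y‖) (Ioc 0 a) := by
  refine integrableOn_majorant hQ.1 (continuousOn_log_majorant _ _) (log_majorant_nonneg _ _)
    (C := 2) (fun x hx => ?_) hQ.2 a
  rw [Real.rpow_two, mul_left_comm]
  gcongr
  rw [one_add_one_eq_two]
  -- `(1+t)² ≤ 2(1+t²)`, whence the constant `2`.
  nlinarith [sq_nonneg (1 - |Real.log x|)]

/-! ### Conclusion for `u_m` and `p_0` -/

theorem u0_approximation {m k : ℂ} {Q : ℝ → ℂ} {ε : ℝ} (hε : 2 * max (-m.re) 0 ≤ ε)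
    (hQ : m ≠ 0 → L0 ε Q) (hQ0 : m = 0 → L0ln ε 1 Q) :
    ∃ u : ℝ → ℂ, IsInverseImage m k Q (fun x => x ^ (1 / 2 + m.re)) (u0 m k) u ∧
      IsUniqueApproximation m k Q (u0 m k) (m.re + ε) u ∧
      IsUniqueApproximation m k Q (u0 m k) |m.re| u := by
  have hε0 : 0 ≤ ε := (mul_nonneg zero_le_two (le_max_right _ _)).trans hε
  have hr : |m.re| ≤ m.re + ε := by
    have := le_max_left (-m.re) 0
    exact abs_le'.2 ⟨by linarith, by linarith⟩
  have hφr : ∀ a : ℝ, 0 < a → ∃ C : ℝ, 0 ≤ C ∧ ∀ x, 0 < x → x ≤ a →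
      x ^ (1 / 2 + |m.re|) ≤ C * x ^ (1 / 2 + m.re) := fun a ha =>
    ⟨_, Real.rpow_nonneg ha.le _, fun x hx hxa =>
      rpow_le_const_mul_rpow (by linarith [le_abs_self m.re]) hx hxa⟩
  by_cases hm : m = 0
  -- Here `j = 0`: `u_0^0` carries no logarithm, so the only one in the majorant comes from the
  -- kernel.
  · have A : Admissible m k Q (fun x => x ^ (1 / 2 + m.re))
        (fun y => y ^ (1 - ε) * (1 + |Real.log y|) ^ (0 + 1)) (m.re + ε) := by
      have := admissible_zero k hε0 0 (hQ0 hm).1 (hQ0 hm).integrableOn_one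
      subst hm
      simpa using this
    refine A.exists_unique_approximation hr hφr (exists_isFundamentalPair m k) ?_
      (u0_isFreeSolution m k) fun a _ => u0_bound m k a
    subst hm
    intro e e' he o o' x hx
    simp only [Complex.zero_re, abs_zero, add_zero] at o o'
    exact he.eq_zero_of_isLittleO_zero o o' hx
  · refine (admissible_of_ne_zero hm hε (hQ hm)).exists_unique_approximation hr hφr
      (exists_isFundamentalPair m k) ?_ (u0_isFreeSolution m k) fun a _ => u0_bound m k a
    obtain ⟨h₁, h₂, w, hp⟩ := exists_isFundamentalPair m k
    intro e e' he o o' x hx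
    exact he.eq_zero_of_isLittleO hm hp o o' hx

/-- Here `j = 1`: `p_0^0` itself needs a logarithm in the weight and the kernel adds another, hence
the hypothesis with `ln²`. -/
theorem p00_approximation {k : ℂ} {Q : ℝ → ℂ} {ε : ℝ} (hε : 0 ≤ ε) (hQ : L0ln ε 2 Q) :
    ∃ p : ℝ → ℂ,
      IsInverseImage 0 k Q (fun x => x ^ (1 / 2 : ℝ) * (1 + |Real.log x|)) (p00 k) p ∧
      IsUniqueApproximation 0 k Q (p00 k) ε p ∧ IsUniqueApproximation 0 k Q (p00 k) 0 p := by
  have A := admissible_zero k hε 1 hQ.1 hQ.integrableOn_two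
  simp only [pow_one] at A
  refine A.exists_unique_approximation hε (fun a _ => ⟨1, zero_le_one, fun x hx _ => ?_⟩)
    (exists_isFundamentalPair 0 k) ?_ (p00_isFreeSolution k) fun a _ => p00_bound k a
  · rw [add_zero, one_mul]
    exact le_mul_of_one_le_right (Real.rpow_nonneg hx.le _)
      (by linarith [abs_nonneg (Real.log x)])
  · intro e e' he o o' x hx
    simp only [add_zero] at o o'
    exact he.eq_zero_of_isLittleO_zero o o' hx

end PerturbedBessel

end

theorem mainTheorem2 (k : ℂ) (ε : ℝ) (Q : ℝ → ℂ) :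
    (∀ m : ℂ, 2 * max (-m.re) 0 ≤ ε →
      (m ≠ 0 → PerturbedBessel.L0 ε Q) → (m = 0 → PerturbedBessel.L0ln ε 1 Q) →
      ∃ u : ℝ → ℂ,
        PerturbedBessel.IsInverseImage m k Q (fun x => x ^ (1 / 2 + m.re))
          (PerturbedBessel.u0 m k) u ∧
        PerturbedBessel.IsUniqueApproximation m k Q (PerturbedBessel.u0 m k) (m.re + ε) u ∧
        PerturbedBessel.IsUniqueApproximation m k Q (PerturbedBessel.u0 m k) |m.re| u) ∧
    (0 ≤ ε → PerturbedBessel.L0ln ε 2 Q →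
      ∃ p : ℝ → ℂ,
        PerturbedBessel.IsInverseImage 0 k Q (fun x => x ^ (1 / 2 : ℝ) * (1 + |Real.log x|))
          (PerturbedBessel.p00 k) p ∧
        PerturbedBessel.IsUniqueApproximation 0 k Q (PerturbedBessel.p00 k) ε p ∧
        PerturbedBessel.IsUniqueApproximation 0 k Q (PerturbedBessel.p00 k) 0 p) :=
  ⟨fun _ hε hQ hQ0 => PerturbedBessel.u0_approximation hε hQ hQ0,
    fun hε hQ => PerturbedBessel.p00_approximation hε hQ⟩
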